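/- Let $S^3=\{(z,w)\in\mathbb{C}^2 : |z|^2+|w|^2=1\}$ with the round metric $g_1$ induced from $\mathbb{C}^2=\mathbb{R}^4$, and let $X_{(z,w)}=(iz,iw)$ be the unit vector field generating the circle action $e^{i\theta}\cdot(z,w)=(e^{i\theta}z,e^{i\theta}w)$. For $\epsilon>0$ let $g_\epsilon$ be the Riemannian metric on $S^3$ for which the line field $\mathcal V$ spanned by $X$ and its $g_1$-orthogonal complement $\mathcal H$ are orthogonal, with $g_\epsilon=\epsilon^2 g_1$ on $\mathcal V$ and $g_\epsilon=\epsilon g_1$ on $\mathcal H$; for $\epsilon\neq 1$, $(S^3,g_\epsilon)$ is called a Berger sphere. A smooth foliation $\mathcal F$ of a Riemannian manifold is metric if its orthogonal distribution $T\mathcal F^{\perp}$ is totally geodesic, i.e. $\nabla_YZ+\nabla_ZY$ is a section of $T\mathcal F^\perp$ whenever $Y,Z$ are smooth sections of $T\mathcal F^\perp$, where $\nabla$ is the Levi-Civita connection (equivalently, if its leaves are locally equidistant). Corollary. Let $\epsilon>0$, $\epsilon\neq 1$, and let $\mathcal F$ be a smooth one-dimensional metric foliation of the Berger sphere $(S^3,g_\epsilon)$.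 Then $\mathcal F$ is the orbit foliation of a globally defined isometric flow: there is a smooth action $\Phi:\mathbb{R}\times S^3\to S^3$ of $\mathbb{R}$ such that every $\Phi^t$ is an isometry of $(S^3,g_\epsilon)$, and for every $p\in S^3$ the leaf of $\mathcal F$ through $p$ is the orbit $\{\Phi^t(p) : t\in\mathbb{R}\}$. -/

import Mathlib

open scoped Manifold ContDiff Topology
open Bundle

/-! ### One-dimensional foliations of a smooth manifold -/

section Foliation

variable {E : Type*} [NormedAddCommGroup E] [NormedSpace ℝ E]
  {H : Type*} [TopologicalSpace H]

/-- A smooth one-dimensional foliation, of codimension `q`, of a manifold `M` (modelled through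
`I`): a decomposition of `M` into path-connected leaves (the classes of the relation `sameLeaf`),
such that around every point there is a smooth foliated chart `φ = (t, y)` with values in
`ℝ × ℝ^q`, in whose domain `U` the path components of each set `leaf ∩ U` (the plaques) are exactly
the nonempty level sets of the transverse coordinate `y`. -/
structure OneDimFoliation (I : ModelWithCorners ℝ E H) (M : Type*) [TopologicalSpace M]
    [ChartedSpace H M] (q : ℕ) where
  /-- `sameLeaf x y`: the points `x` and `y` lie on the same leaf. -/
  sameLeaf : Setoid M
  isPathConnected_leaf : ∀ x : M, IsPathConnected {y : M | sameLeaf x y}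
  exists_foliatedChart : ∀ p : M, ∃ φ : OpenPartialHomeomorph M (ℝ × EuclideanSpace ℝ (Fin q)),
    p ∈ φ.source ∧
    ContMDiffOn I 𝓘(ℝ, ℝ × EuclideanSpace ℝ (Fin q)) ∞ φ φ.source ∧
    ContMDiffOn 𝓘(ℝ, ℝ × EuclideanSpace ℝ (Fin q)) I ∞ φ.symm φ.target ∧
    ∀ x ∈ φ.source, ∀ y ∈ φ.source,
      (JoinedIn ({z : M | sameLeaf x z} ∩ φ.source) x y ↔ (φ x).2 = (φ y).2)

namespace OneDimFoliation

variable {I : ModelWithCorners ℝ E H} {M : Type*} [TopologicalSpace M] [ChartedSpace H M] {q : ℕ}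

/-- The leaf of the foliation through the point `x`. -/
def leaf (F : OneDimFoliation I M q) (x : M) : Set M := {y : M | F.sameLeaf x y}

/-- The tangent line `T_p F` of the foliation at `p`, as a set of tangent vectors: the velocities
at `p` of the smooth curves through `p` that lie in the leaf through `p`. -/
def tangentLine (F : OneDimFoliation I M q) (p : M) : Set (TangentSpace I p) :=
  {v | ∃ γ : ℝ → M, ContMDiff 𝓘(ℝ, ℝ) I ∞ γ ∧ (∀ t, γ t ∈ F.leaf p) ∧
    tangentMap 𝓘(ℝ, ℝ) I γ ⟨0, (1 : ℝ)⟩ = ⟨p, v⟩}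

end OneDimFoliation

end Foliation

/-! ### Levi-Civita connection, metric foliations, isometric flows -/

section Riemannian

variable {E : Type*} [NormedAddCommGroup E] [NormedSpace ℝ E] [FiniteDimensional ℝ E]
  {H : Type*} [TopologicalSpace H] {I : ModelWithCorners ℝ E H}
  {M : Type*} [TopologicalSpace M] [ChartedSpace H M] [IsManifold I ∞ M]

/-- `cov` is the Levi-Civita connection of the Riemannian metric `g`: it is torsion-free and
compatible with `g`. Here `cov Y x (X x)` is `(∇_X Y)(x)`. -/
structure IsLeviCivita (g : ContMDiffRiemannianMetric I ∞ E (TangentSpace I : M → Type _))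
    (cov : CovariantDerivative I E (TangentSpace I : M → Type _)) : Prop where
  torsion_free : ∀ (X Y : Π x : M, TangentSpace I x) (x : M),
    MDifferentiableAt I I.tangent (fun y ↦ (⟨y, X y⟩ : TangentBundle I M)) x →
    MDifferentiableAt I I.tangent (fun y ↦ (⟨y, Y y⟩ : TangentBundle I M)) x →
    cov Y x (X x) - cov X x (Y x) = VectorField.mlieBracket I X Y x
  metric : ∀ (Y Z : Π x : M, TangentSpace I x) (x : M) (v : TangentSpace I x),
    MDifferentiableAt I I.tangent (fun y ↦ (⟨y, Y y⟩ : TangentBundle I M)) x →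
    MDifferentiableAt I I.tangent (fun y ↦ (⟨y, Z y⟩ : TangentBundle I M)) x →
    mvfderiv I (fun y ↦ g.inner y (Y y) (Z y)) x v =
      g.inner x (cov Y x v) (Z x) + g.inner x (Y x) (cov Z x v)

namespace OneDimFoliation

variable {q : ℕ}


/-- The vector field `X` is a smooth section of the `g`-orthogonal distribution of `F`. -/
def IsOrthogonalSection (F : OneDimFoliation I M q)
    (g : ContMDiffRiemannianMetric I ∞ E (TangentSpace I : M → Type _))
    (X : Π x : M, TangentSpace I x) : Prop :=
  ContMDiff I I.tangent ∞ (fun x ↦ (⟨x, X x⟩ : TangentBundle I M)) ∧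
    ∀ x, ∀ v ∈ F.tangentLine x, g.inner x (X x) v = 0

/-- The foliation `F` is metric with respect to `g`: its orthogonal distribution is totally
geodesic, i.e. `∇_X Y + ∇_Y X` is orthogonal to `F` whenever the smooth vector fields `X` and `Y`
are, where `∇` is the Levi-Civita connection of `g`. -/
def IsMetric (F : OneDimFoliation I M q)
    (g : ContMDiffRiemannianMetric I ∞ E (TangentSpace I : M → Type _)) : Prop :=
  ∃ cov : CovariantDerivative I E (TangentSpace I : M → Type _), IsLeviCivita g cov ∧
    ∀ X Y : Π x : M, TangentSpace I x, F.IsOrthogonalSection g X → F.IsOrthogonalSection g Y →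
      ∀ x, ∀ v ∈ F.tangentLine x, g.inner x (cov Y x (X x) + cov X x (Y x)) v = 0

end OneDimFoliation

/-- The (globally defined, continuous) flow `Φ` on `M` is smooth, and every `Φ t` is an isometry
of the Riemannian metric `g`. -/
def IsIsometricFlow (g : ContMDiffRiemannianMetric I ∞ E (TangentSpace I : M → Type _))
    (Φ : Flow ℝ M) : Prop :=
  ContMDiff (𝓘(ℝ, ℝ).prod I) I ∞ (fun z : ℝ × M ↦ Φ z.1 z.2) ∧
    ∀ (t : ℝ) (p : M) (v w : TangentSpace I p),
      g.inner (Φ t p) (mfderiv I I (Φ t) p v) (mfderiv I I (Φ t) p w) = g.inner p v w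

end Riemannian

/-! ### Berger spheres -/

/-- The complex plane `ℂ²`, with its Euclidean norm and its real inner product `Re ⟪v, w⟫`. -/
abbrev C2 : Type := EuclideanSpace ℂ (Fin 2)

instance finrank_C2 : Fact (Module.finrank ℝ C2 = 3 + 1) :=
  ⟨by rw [← Module.finrank_mul_finrank ℝ ℂ C2]; simp⟩

/-- The unit sphere `S³` of `ℂ²`, with Mathlib's smooth structure. -/
abbrev S3 : Type := Metric.sphere (0 : C2) 1

noncomputable section Berger

theorem contDiff_smulRight_self {V : Type*} [NormedAddCommGroup V] [NormedSpace ℝ V]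
    (a b : ℝ) (β : V →L[ℝ] V →L[ℝ] ℝ) :
    ContDiff ℝ ∞ (fun l : V →L[ℝ] ℝ ↦ a • l.smulRight l + b • (β - l.smulRight l)) := by
  have h1 : ContDiff ℝ ∞ (fun l : V →L[ℝ] ℝ ↦ l.smulRight l) :=
    ContDiff.smulRight contDiff_id contDiff_id
  exact (h1.const_smul a).add ((contDiff_const.sub h1).const_smul b)

theorem contDiff_pullback {V W : Type*} [NormedAddCommGroup V] [NormedSpace ℝ V]
    [NormedAddCommGroup W] [NormedSpace ℝ W] :
    ContDiff ℝ ∞ (fun z : (V →L[ℝ] V →L[ℝ] ℝ) × (W →L[ℝ] V) × (W →L[ℝ] V) ↦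
      (z.1.bilinearComp z.2.1 z.2.2)) := by
  have h : (fun z : (V →L[ℝ] V →L[ℝ] ℝ) × (W →L[ℝ] V) × (W →L[ℝ] V) ↦
      (z.1.bilinearComp z.2.1 z.2.2)) = fun z ↦
      ((ContinuousLinearMap.compL ℝ W V ℝ).flip z.2.2).comp (z.1.comp z.2.1) := by
    ext z v w
    simp
  rw [h]
  exact ((ContinuousLinearMap.contDiff _).comp (contDiff_snd.comp contDiff_snd)).clm_comp
    (contDiff_fst.clm_comp (contDiff_fst.comp contDiff_snd))

/-- The differential at `p` of the inclusion of `S³` in `ℂ²`. -/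
def sphereIncl (p : S3) : TangentSpace (𝓡 3) p →L[ℝ] C2 :=
  mvfderiv (𝓡 3) ((↑) : S3 → C2) p

theorem contMDiffAt_pullback {E : Type*} [NormedAddCommGroup E] [NormedSpace ℝ E]
    {H : Type*} [TopologicalSpace H] {I : ModelWithCorners ℝ E H}
    {M : Type*} [TopologicalSpace M] [ChartedSpace H M]
    {V W : Type*} [NormedAddCommGroup V] [NormedSpace ℝ V]
    [NormedAddCommGroup W] [NormedSpace ℝ W] {x₀ : M}
    {B : M → V →L[ℝ] V →L[ℝ] ℝ} (hB : ContMDiffAt I 𝓘(ℝ, V →L[ℝ] V →L[ℝ] ℝ) ∞ B x₀)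
    {A : M → W →L[ℝ] V} (hA : ContMDiffAt I 𝓘(ℝ, W →L[ℝ] V) ∞ A x₀) :
    ContMDiffAt I 𝓘(ℝ, W →L[ℝ] W →L[ℝ] ℝ) ∞
      (fun x ↦ (B x).bilinearComp (A x) (A x)) x₀ := by
  have h := (contDiff_pullback (V := V) (W := W)).contMDiff.contMDiffAt (x := (B x₀, A x₀, A x₀))
  exact ContMDiffAt.comp (g := fun z : (V →L[ℝ] V →L[ℝ] ℝ) × (W →L[ℝ] V) × (W →L[ℝ] V) ↦
    z.1.bilinearComp z.2.1 z.2.2) (f := fun x ↦ (B x, A x, A x)) x₀ h (hB.prodMk_space (hA.prodMk_space hA))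

theorem contMDiff_pullback_form {E : Type*} [NormedAddCommGroup E] [NormedSpace ℝ E]
    {H : Type*} [TopologicalSpace H] {I : ModelWithCorners ℝ E H}
    {M : Type*} [TopologicalSpace M] [ChartedSpace H M] [IsManifold I ∞ M]
    {V : Type*} [NormedAddCommGroup V] [NormedSpace ℝ V] {f : M → V} (hf : ContMDiff I 𝓘(ℝ, V) ∞ f)
    {B : M → V →L[ℝ] V →L[ℝ] ℝ} (hB : ContMDiff I 𝓘(ℝ, V →L[ℝ] V →L[ℝ] ℝ) ∞ B) :
    ContMDiff I (I.prod 𝓘(ℝ, E →L[ℝ] E →L[ℝ] ℝ)) ∞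
      (fun p : M ↦ TotalSpace.mk' (E →L[ℝ] E →L[ℝ] ℝ)
        (E := fun p : M ↦ TangentSpace I p →L[ℝ] TangentSpace I p →L[ℝ] ℝ) p
        ((mvfderiv I f p).precomp ℝ ∘L B p ∘L mvfderiv I f p)) := by
  intro x₀
  have hA := (hf x₀).mfderiv_const (m := ∞) (by simp)
  set A := inTangentCoordinates I 𝓘(ℝ, V) id f (mfderiv I 𝓘(ℝ, V) f) x₀ with hAdef
  rw [contMDiffAt_hom_bundle]
  refine ⟨contMDiffAt_id, ?_⟩
  have h2 : ContMDiffAt I 𝓘(ℝ, E →L[ℝ] E →L[ℝ] ℝ) ∞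
      (fun x ↦ (B x).bilinearComp (A x) (A x)) x₀ :=
    contMDiffAt_pullback (hB x₀) hA
  refine h2.congr_of_eventuallyEq ?_
  filter_upwards [(trivializationAt E (TangentSpace I : M → Type _)
    x₀).open_baseSet.mem_nhds (FiberBundle.mem_baseSet_trivializationAt' x₀)] with x hx
  ext v w
  rw [inCoordinates_apply_eq₂ hx hx (Set.mem_univ _)]
  have hAx : ∀ v, A x v = mvfderiv I f x ((trivializationAt E
      (TangentSpace I : M → Type _) x₀).symm x v) := by
    intro v
    rw [hAdef]
    simp only [inTangentCoordinates, ContinuousLinearMap.inCoordinates, id,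
      TangentBundle.continuousLinearMapAt_model_space]
    change mvfderiv I f x ((trivializationAt E (TangentSpace I : M → Type _) x₀).symmL ℝ x v) = _
    rw [Trivialization.symmL_apply _ hx]
  simp [hAx]

/-- The real Euclidean inner product of `ℂ² = ℝ⁴`. -/
def realInner : C2 →L[ℝ] C2 →L[ℝ] ℝ := innerSL ℝ

theorem realInner_apply (v w : C2) : realInner v w = inner ℝ v w := rfl

/-- The real linear form `v ↦ ⟨v, ip⟩`, where `X_p = ip` is the unit vector field that generates
the circle action `e^{iθ} • (z, w) = (e^{iθ} z, e^{iθ} w)` on `S³`. -/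
def hopfForm (p : S3) : C2 →L[ℝ] ℝ := realInner (Complex.I • (p : C2))

/-- The bilinear form `ε² ⟨v, ip⟩⟨w, ip⟩ + ε (⟨v, w⟩ - ⟨v, ip⟩⟨w, ip⟩)` on `ℂ²`. -/
def bergerForm (ε : ℝ) (p : S3) : C2 →L[ℝ] C2 →L[ℝ] ℝ :=
  ε ^ 2 • (hopfForm p).smulRight (hopfForm p) +
    ε • (realInner - (hopfForm p).smulRight (hopfForm p))

theorem bergerForm_apply (ε : ℝ) (p : S3) (v w : C2) :
    bergerForm ε p v w = ε ^ 2 * (hopfForm p v * hopfForm p w) +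
      ε * (inner ℝ v w - hopfForm p v * hopfForm p w) := by
  simp [bergerForm, realInner_apply]

/-- The form `g_ε` on `T_p S³`, the pullback of `bergerForm ε p` under the inclusion: the line
spanned by `X_p = ip` is orthogonal to the `g₁`-orthogonal complement of `X_p`, and `g_ε` is
`ε² g₁` on that line and `ε g₁` on that complement, where `g₁` is the round metric. -/
def bergerInner (ε : ℝ) (p : S3) :
    TangentSpace (𝓡 3) p →L[ℝ] TangentSpace (𝓡 3) p →L[ℝ] ℝ :=
  (sphereIncl p).precomp ℝ ∘L bergerForm ε p ∘L sphereIncl p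

theorem bergerInner_apply (ε : ℝ) (p : S3) (v w : TangentSpace (𝓡 3) p) :
    bergerInner ε p v w = bergerForm ε p (sphereIncl p v) (sphereIncl p w) := rfl

theorem norm_hopf (p : S3) : ‖Complex.I • (p : C2)‖ = 1 := by
  rw [norm_smul]; simp

theorem hopfForm_sq_le (p : S3) (v : C2) : hopfForm p v ^ 2 ≤ ‖v‖ ^ 2 := by
  have h := abs_real_inner_le_norm (Complex.I • (p : C2)) v
  rw [norm_hopf, one_mul] at h
  exact sq_le_sq' (abs_le.mp h).1 (abs_le.mp h).2

theorem bergerForm_self_ge (ε : ℝ) (p : S3) (v : C2) :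
    min ε (ε ^ 2) * ‖v‖ ^ 2 ≤ bergerForm ε p v v := by
  have h := hopfForm_sq_le p v
  rw [bergerForm_apply, real_inner_self_eq_norm_sq]
  have h1 := min_le_left ε (ε ^ 2)
  have h2 := min_le_right ε (ε ^ 2)
  nlinarith [sq_nonneg (hopfForm p v)]

theorem sphereIncl_injective (p : S3) : Function.Injective (sphereIncl p) :=
  injective_mvfderiv_subtypeVal_sphere p

theorem bergerInner_isVonNBounded {ε : ℝ} (hε : 0 < ε) (p : S3) :
    Bornology.IsVonNBounded ℝ {v : TangentSpace (𝓡 3) p | bergerInner ε p v v < 1} := by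
  let L : EuclideanSpace ℝ (Fin 3) →L[ℝ] C2 := sphereIncl p
  obtain ⟨K, -, hK⟩ := (L : EuclideanSpace ℝ (Fin 3) →ₗ[ℝ] C2).exists_antilipschitzWith
    (LinearMap.ker_eq_bot.mpr (sphereIncl_injective p))
  set c := min ε (ε ^ 2) with hc
  have hc0 : 0 < c := by positivity
  change Bornology.IsVonNBounded ℝ
    {v : EuclideanSpace ℝ (Fin 3) | bergerForm ε p (L v) (L v) < 1}
  refine (NormedSpace.isVonNBounded_closedBall ℝ _ (K * Real.sqrt (1 / c))).subset ?_
  intro v hv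
  have h1 : c * ‖L v‖ ^ 2 ≤ 1 := (bergerForm_self_ge ε p (L v)).trans (le_of_lt hv)
  have h2 : ‖L v‖ ≤ Real.sqrt (1 / c) := by
    apply Real.le_sqrt_of_sq_le
    rw [le_div_iff₀ hc0]
    linarith
  have h3 : ‖v‖ ≤ K * ‖L v‖ := by
    simpa [dist_zero_right] using hK.le_mul_dist v 0
  rw [mem_closedBall_zero_iff]
  exact h3.trans (by gcongr)

theorem bergerInner_contMDiff (ε : ℝ) :
    ContMDiff (𝓡 3) ((𝓡 3).prod 𝓘(ℝ, EuclideanSpace ℝ (Fin 3) →L[ℝ]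
        EuclideanSpace ℝ (Fin 3) →L[ℝ] ℝ)) ∞
      (fun p : S3 ↦ TotalSpace.mk' (EuclideanSpace ℝ (Fin 3) →L[ℝ]
        EuclideanSpace ℝ (Fin 3) →L[ℝ] ℝ) p (bergerInner ε p)) := by
  have hV : ContMDiff (𝓡 3) 𝓘(ℝ, C2 →L[ℝ] ℝ) ∞ hopfForm := by
    have h0 : ContDiff ℝ ∞ (fun v : C2 ↦ realInner (Complex.I • v)) :=
      realInner.contDiff.comp (contDiff_id.const_smul Complex.I)
    exact h0.contMDiff.comp contMDiff_coe_sphere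
  have hB : ContMDiff (𝓡 3) 𝓘(ℝ, C2 →L[ℝ] C2 →L[ℝ] ℝ) ∞ (bergerForm ε) := by
    exact (contDiff_smulRight_self _ _ _).contMDiff.comp hV
  exact contMDiff_pullback_form contMDiff_coe_sphere hB

/-- The smooth Riemannian metric `g_ε` on `S³`. For `ε > 0`, `ε ≠ 1`, the Riemannian manifold
`(S³, g_ε)` is a Berger sphere. -/
def bergerMetric (ε : ℝ) (hε : 0 < ε) :
    ContMDiffRiemannianMetric (𝓡 3) ∞ (EuclideanSpace ℝ (Fin 3))
      (TangentSpace (𝓡 3) : S3 → Type _) where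
  inner := bergerInner ε
  symm p v w := by
    simp only [bergerInner_apply, bergerForm_apply, real_inner_comm]
    ring
  pos p v hv := by
    have h := bergerForm_self_ge ε p (sphereIncl p v)
    have h0 : sphereIncl p v ≠ 0 := fun h0 ↦
      hv (sphereIncl_injective p (by rw [h0, map_zero]))
    have : 0 < min ε (ε ^ 2) * ‖sphereIncl p v‖ ^ 2 := by positivity
    exact this.trans_le h
  isVonNBounded := bergerInner_isVonNBounded hε
  contMDiff := bergerInner_contMDiff ε

end Berger

/-!
The tangent lines of a metric foliation of a Berger sphere are spanned by a Killing field,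
    and Killing fields of Berger
spheres are the linear fields `x ↦ K x` with `K` skew-Hermitian. The flow `exp (t K)` of such a field acts by unitary
maps, which are isometries of `g_ε`, and its orbits are the leaves.

The work is local. Let `E₁`, `E₂`, `E₃` be the orthonormal frame of linear vector fields `i x / ε`, `J x / √ε`,
`J (i x) / √ε`, and let `T = t₁ E₁ + t₂ E₂ + t₃ E₃` be a unit field spanning the foliation. That the foliation is metric
means `⟨∇_X T, Y⟩ + ⟨∇_Y T, X⟩ = 0` for `X`, `Y` orthogonal to `T`, a first order equation for the coefficients `tᵢ`
(`SpansTangent.metric_equation`). The claim is that `T` is then, up to a factor,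
    a Killing field. This is false for the
round metric, `ε = 1`, in the absence of global assumptions; for `ε ≠ 1` it holds on every open set.

Where `T` is not tangent to the Hopf fibres, take the frame `T`, `e₁`,
    `e₂` with `e₂` orthogonal to the Hopf field, and
write `C` and `S` for the cosine and sine of the angle between `T` and the Hopf field. The structure equations of this
frame involve three functions: the components `k`,
    `l` of the curvature of the leaves and the integrability function `a`
of the orthogonal distribution. The main step is `k = 0`, that is,
    the leaves make a constant angle with the Hopf fibres
(`IsUnitMetricOn.frame_k_eq_zero`). If `k ≠ 0`, the integrability conditions of the structure equations imply an
algebraic relation between `a`, `k`, `l` and the angle (`AdaptedFrame.algebraic_relation`). In suitable functions, on which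
`e₁` acts by multiplication by integer multiples of `k`, this relation splits into parts of different weights;
    each part
vanishes, and the part of weight `0` is a nonzero multiple of `(4 / ε - 4) C²`, a contradiction
(`AdaptedFrame.c_mul_C_sq_eq_zero`). A similar but simpler argument gives `1 - l C / S - a = 0`
(`IsUnitMetricOn.frame_psi_eq_zero`). Now all derivatives of the `tᵢ` are known and satisfy the Killing equations
(`UnitMetricField.isKillingDirection_of_adapted`). By density the same is true at the points where `T` is tangent to the
Hopf fibres (`IsUnitMetricOn.isKillingDirection`). Every value `2 |x|² T x` is the image of `x` under an explicit
skew-Hermitian matrix depending on `x`, whose entries all have the same logarithmic derivatives; hence the entries are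
constant up to a common factor, and `T x` is a multiple of `K x` with `K` constant
(`IsUnitMetricOn.exists_skewAdjoint`). To work with linear fields throughout,
    the `tᵢ` are extended from the sphere to a
cone in `ℂ²` as functions constant along rays.

Two skew-Hermitian maps that span the same lines on an open set are proportional
(`eq_smul_of_eventually_eq_smul`), so by connectedness of `S³` one `K` serves for all points
(`exists_global_skewAdjoint_spansLine`). A comparison in foliated charts shows that leaves and orbits coincide
(`leaf_eq_orbit`).
-/

/-! ### The adapted frame of a unit field: algebra -/

/-- The moving frame adapted to a unit field `T` that spans a metric foliation of a Berger sphere and is nowhere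
tangent to the Hopf fibres, written algebraically: `R` is a ring of functions, vector fields are derivations of `R`,
and `c` is the constant `4 / ε - 4`, which vanishes for the round metric only. The brackets and the equations for `a`
and `l` are consequences of the metric equation of `T`, see `UnitMetricField.adaptedFrame`. -/
structure AdaptedFrame (R : Type*) [CommRing R] [Algebra ℝ R] (c : R) where
  /-- The unit field tangent to the foliation. -/
  T : Derivation ℝ R R
  /-- The unit field orthogonal to `T` in the plane of `T` and the Hopf field. -/
  e₁ : Derivation ℝ R R
  /-- The unit field orthogonal to `T` and to the Hopf field. -/
  e₂ : Derivation ℝ R R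
  /-- The sine of the angle between `T` and the Hopf field. -/
  S : R
  /-- The inverse of `S`. -/
  S' : R
  /-- The cosine of the angle between `T` and the Hopf field. -/
  C : R
  /-- The function `a` with `⟨[e₁, e₂], T⟩ = -2 a`: it measures how far the orthogonal distribution is from being
  integrable. -/
  a : R
  /-- The `e₁`-component of the geodesic curvature `∇_T T` of the leaves. -/
  k : R
  /-- The `e₂`-component of the geodesic curvature `∇_T T` of the leaves. -/
  l : R
  sq : S ^ 2 + C ^ 2 = 1
  inv : S * S' = 1
  T_c : T c = 0
  e₁_c : e₁ c = 0
  e₂_c : e₂ c = 0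
  T_C : T C = S * k
  e₁_C : e₁ C = 0
  e₂_C : e₂ C = -S * (a + 1)
  T_e₁ : ∀ f, T (e₁ f) - e₁ (T f) = -k * T f + (1 - l * C * S' - a) * e₂ f
  T_e₂ : ∀ f, T (e₂ f) - e₂ (T f) = -l * T f - (1 - l * C * S' - a) * e₁ f
  e₁_e₂ : ∀ f, e₁ (e₂ f) - e₂ (e₁ f) = -2 * a * T f + (a + 1) * C * S' * e₁ f
  e₂_a : e₂ a = 2 * a * l - c * S * C
  e₂_l : e₂ l = l ^ 2 - a ^ 2 + 1 + c * S ^ 2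
  e₁_l : e₁ l = k * l + T a + (a + 1) * C * S' * k

namespace AdaptedFrame

variable {R : Type*} [CommRing R] [Algebra ℝ R] {c : R} (A : AdaptedFrame R c)

theorem two_mul_cancel {x y : R} (h : 2 * x = 2 * y) : x = y := by
  have h2 : algebraMap ℝ R (1/2) * 2 = 1 := by
    rw [← map_ofNat (algebraMap ℝ R) 2, ← map_mul]; norm_num
  linear_combination algebraMap ℝ R (1/2) * h + (y - x) * h2

theorem derivation_S (D : Derivation ℝ R R) : D A.S = - A.S' * A.C * D A.C := by
  have h := congrArg D A.sq
  simp only [map_add, Derivation.leibniz_pow, Derivation.map_one_eq_zero, smul_eq_mul,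
    nsmul_eq_mul] at h
  norm_num at h
  apply two_mul_cancel
  linear_combination A.S' * h - 2 * D A.S * A.inv

theorem T_S : A.T A.S = - A.C * A.k := by
  rw [derivation_S, A.T_C]; linear_combination - A.C * A.k * A.inv
theorem e₁_S : A.e₁ A.S = 0 := by
  rw [derivation_S, A.e₁_C]; ring
theorem e₂_S : A.e₂ A.S = A.C * (A.a + 1) := by
  rw [derivation_S, A.e₂_C]; linear_combination A.C * (A.a + 1) * A.inv

theorem e₁_S' : A.e₁ A.S' = 0 := by
  have h := congrArg A.e₁ A.inv
  simp only [Derivation.leibniz, smul_eq_mul, A.e₁_S, Derivation.map_one_eq_zero] at h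
  linear_combination A.S' * h - A.e₁ A.S' * A.inv

theorem S_cancel {x y : R} (h : A.S * x = A.S * y) : x = y := by
  linear_combination A.S' * h + (y - x) * A.inv

theorem e₁_a : A.e₁ A.a = 2 * A.a * A.k := by
  apply A.S_cancel
  have h := A.e₁_e₂ A.C
  simp only [A.e₁_C, A.e₂_C, A.T_C, Derivation.leibniz, smul_eq_mul, A.e₁_S, map_add, map_neg,
    Derivation.map_one_eq_zero, map_zero] at h
  linear_combination -h

theorem e₁_k : A.e₁ A.k = A.k ^ 2 + (1 - A.l * A.C * A.S' - A.a) * (A.a + 1) := by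
  apply A.S_cancel
  have h := A.T_e₁ A.C
  simp only [A.e₁_C, A.e₂_C, A.T_C, Derivation.leibniz, smul_eq_mul, A.e₁_S, map_zero] at h
  linear_combination -h

theorem e₂_k : A.e₂ A.k = A.l * A.k - A.T A.a := by
  apply A.S_cancel
  have h := A.T_e₂ A.C
  simp only [A.e₁_C, A.e₂_C, A.T_C, Derivation.leibniz, smul_eq_mul, A.e₂_S, A.T_S, map_add, map_neg,
    Derivation.map_one_eq_zero] at h
  linear_combination -h

/-- The commutator of `e₁` and `e₂`, applied to `a`. -/
theorem three_a_T_a : 3 * (A.a * A.T A.a) = - c * A.k * A.S * A.C := by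
  apply two_mul_cancel
  have h := A.e₁_e₂ A.a
  simp only [A.e₂_a, A.e₁_a, A.e₁_C, A.e₁_S, Derivation.leibniz, smul_eq_mul, A.e₂_k,
    A.e₁_l, A.e₁_c, map_sub, ← Nat.cast_ofNat (R := R), Derivation.map_natCast] at h
  push_cast at h
  linear_combination h

theorem e₁_T_a : A.e₁ (A.T A.a) = 3 * A.k * A.T A.a + 2 * A.a * A.T A.k
    - (1 - A.l * A.C * A.S' - A.a) * (2 * A.a * A.l - c * A.S * A.C) := by
  have h := A.T_e₁ A.a
  simp only [A.e₂_a, A.e₁_a, Derivation.leibniz, smul_eq_mul,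
     ← Nat.cast_ofNat (R := R), Derivation.map_natCast] at h
  push_cast at h
  linear_combination -h

/-- The `e₁`-derivative of `three_a_T_a`. -/
theorem T_k : 6 * A.a ^ 2 * A.T A.k = 4 * c * A.S * A.C * A.k ^ 2
    + (1 - A.l * A.C * A.S' - A.a) *
      (6 * A.a ^ 2 * A.l - 3 * A.a * c * A.S * A.C - c * A.S * A.C * (A.a + 1)) := by
  have h := congrArg A.e₁ A.three_a_T_a
  have h3 := A.three_a_T_a
  simp only [A.e₁_a, A.e₁_T_a, A.e₁_k, A.e₁_S, A.e₁_C, A.e₁_c, Derivation.leibniz, smul_eq_mul, map_neg,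
     ← Nat.cast_ofNat (R := R), Derivation.map_natCast] at h
  push_cast at h
  linear_combination h - 5 * A.k * h3

theorem e₂_T_a : A.e₂ (A.T A.a) = 3 * A.l * A.T A.a + 2 * A.a * A.T A.l
    + c * A.k * (A.C ^ 2 - A.S ^ 2)
    + (1 - A.l * A.C * A.S' - A.a) * (2 * A.a * A.k) := by
  have h := A.T_e₂ A.a
  simp only [A.e₂_a, A.e₁_a, A.T_S, A.T_C, A.T_c, map_sub, Derivation.leibniz, smul_eq_mul,
     ← Nat.cast_ofNat (R := R), Derivation.map_natCast] at h
  push_cast at h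
  linear_combination -h

/-- The `e₂`-derivative of `three_a_T_a`. -/
theorem T_l : 18 * A.a ^ 3 * A.T A.l = - 3 * A.a * c * A.k * A.l * A.S * A.C
    - 4 * c ^ 2 * A.S ^ 2 * A.C ^ 2 * A.k
    - 3 * A.a * c * A.k * (A.a + 1) * (A.C ^ 2 - A.S ^ 2) + 15 * A.a * A.l * c * A.k * A.S * A.C
    - 9 * A.a ^ 2 * c * A.k * (A.C ^ 2 - A.S ^ 2)
    - 18 * A.a ^ 3 * A.k * (1 - A.l * A.C * A.S' - A.a) := by
  have h := congrArg A.e₂ A.three_a_T_a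
  have h3 := A.three_a_T_a
  simp only [A.e₂_a, A.e₂_T_a, A.e₂_k, A.e₂_S, A.e₂_C, A.e₂_c, Derivation.leibniz, smul_eq_mul, map_neg,
     ← Nat.cast_ofNat (R := R), Derivation.map_natCast] at h
  push_cast at h
  linear_combination 3 * A.a * h + (4 * c * A.S * A.C - 15 * A.a * A.l) * h3

theorem T_S' : A.T A.S' = A.S' ^ 2 * A.C * A.k := by
  have h := congrArg A.T A.inv
  simp only [Derivation.leibniz, smul_eq_mul, A.T_S, Derivation.map_one_eq_zero] at h
  linear_combination A.S' * h - A.T A.S' * A.inv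

/-- An algebraic relation between the functions of the frame: it is what remains of the commutator of `T` and `e₁`,
applied to `k`, once all derivatives are eliminated. -/
theorem algebraic_relation : c * A.C * A.k * (60 * A.a ^ 3 - 60 * A.a ^ 2 - 48 * A.a
      + 30 * A.a * (2 * A.a + 1) * (A.l * A.C * A.S') + 60 * A.a * A.k ^ 2
      + c * A.C ^ 2 * (8 * A.a + 5)) = 0 := by
  have h0 := A.T_e₁ A.k
  have h1 := congrArg A.e₁ A.T_k
  have h3 := A.three_a_T_a
  have hk := A.T_k
  have hl := A.T_l
  simp only [A.e₁_k, A.e₂_k, A.e₁_a, A.e₁_S, A.e₁_C, A.e₁_l, A.e₁_c, A.T_C, A.e₁_S', A.T_S', Derivation.leibniz,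
      smul_eq_mul,
     map_add, map_sub, Derivation.leibniz_pow, nsmul_eq_mul, Derivation.map_one_eq_zero,
     ← Nat.cast_ofNat (R := R), Derivation.map_natCast] at h0 h1
  push_cast at h0 h1
  norm_num at h0 h1
  have hS : A.S * A.C * A.C = A.S * (1 - A.S ^ 2) := by linear_combination A.S * A.sq
  -- from here on the derivatives are unknowns, to be eliminated by linear algebra over the ring
  generalize A.T A.a = p at *
  generalize A.T A.k = Tk at *
  generalize A.T A.l = Tl at *
  generalize A.e₁ Tk = eTk at *
  have hi := A.inv
  have hs := A.sq
  generalize A.S' = V at *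
  generalize A.S = S at *
  generalize A.C = C at *
  generalize A.a = a at *
  generalize A.k = k at *
  generalize A.l = l at *
  obtain ⟨n, hn⟩ : ∃ n, l = n * S := ⟨l * V, by linear_combination -l * hi⟩
  obtain ⟨G, hG⟩ : ∃ G, C = G * S := ⟨C * V, by linear_combination -C * hi⟩
  have hCV : C * V = G := by rw [hG]; linear_combination G * hi
  have hlCV : l * C * V = n * C := by rw [hn]; linear_combination n * C * hi
  have h0' : 2 * (k * Tk) + ((1 - n * C - a) * p + (a + 1) * (- l * k - G * Tl - l * k * G ^ 2 - p)) - eTk =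
      -(k * Tk) + (1 - n * C - a) * (l * k - p) := by
    rw [← hlCV, ← hCV]; linear_combination h0 + (a + 1) * l * k * hi
  have h1' : 6 * a ^ 2 * eTk + Tk * (6 * (2 * (a * (2 * a * k)))) =
    4 * c * S * C * (2 * (k * (k ^ 2 + (1 - n * C - a) * (a + 1)))) +
      ((1 - n * C - a) *
          (6 * a ^ 2 * (k * l + p + (a + 1) * G * k) + l * (6 * (2 * (a * (2 * a * k)))) -
              C * (S * (c * (3 * (2 * a * k)))) -
            c * S * C * (2 * a * k)) +
        (6 * a ^ 2 * l - 3 * a * c * S * C - c * S * C * (a + 1)) *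
          (-(G * (k * l + p + (a + 1) * G * k)) - 2 * a * k)) := by
    rw [← hlCV, ← hCV]; linear_combination h1
  rw [hlCV] at hk hl ⊢
  have key : ∀ x, S * x = 0 → x = 0 := fun x hx => by linear_combination V * hx - x * hi
  apply key
  clear h0 h1 key hlCV hCV hi
  subst hn hG
  linear_combination (exp := 1) 18 * a ^ 3 * h0' + 3 * a * h1' - 21 * a * k * hk + (a + 1) * G * hl
   - (12*a^2*(1 - n * (G * S) - a)-6*a^2*(a+1)+G*(6*a^2*(n * S)-c*S*(G * S)*(4*a+1)) - 6*a^2*(1 - n * (G * S) - a)) * h3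

/-- If a sum of functions that `D` scales by the weights `0`, `2 k`, `3 k`, `4 k`, `5 k` vanishes,
    with `k` invertible,
then so does the part of weight `0`, up to an integer factor: apply `D` four times and eliminate. -/
theorem weight_zero_part_eq_zero (D : Derivation ℝ R R) {k k' w₀ w₂ w₃ w₄ w₅ : R} (hk : k * k' = 1)
    (h₀ : D w₀ = 0) (h₂ : D w₂ = 2 * k * w₂) (h₃ : D w₃ = 3 * k * w₃) (h₄ : D w₄ = 4 * k * w₄)
    (h₅ : D w₅ = 5 * k * w₅) (h : w₀ + w₂ + w₃ + w₄ + w₅ = 0) : 120 * w₀ = 0 := by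
  have step : ∀ x₂ x₃ x₄ x₅ : ℕ, x₂ * w₂ + x₃ * w₃ + x₄ * w₄ + x₅ * w₅ = -w₀ ∨
      x₂ * w₂ + x₃ * w₃ + x₄ * w₄ + x₅ * w₅ = 0 →
      (2 * x₂ : ℕ) * w₂ + (3 * x₃ : ℕ) * w₃ + (4 * x₄ : ℕ) * w₄ + (5 * x₅ : ℕ) * w₅ = 0 := by
    intro x₂ x₃ x₄ x₅ hx
    have hD : D (x₂ * w₂ + x₃ * w₃ + x₄ * w₄ + x₅ * w₅) = 0 := by
      rcases hx with hx | hx <;> rw [hx] <;> simp [h₀]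
    simp only [map_add, Derivation.leibniz, smul_eq_mul, Derivation.map_natCast, h₂, h₃, h₄, h₅]
      at hD
    push_cast
    linear_combination k' * hD - (2 * x₂ * w₂ + 3 * x₃ * w₃ + 4 * x₄ * w₄ + 5 * x₅ * w₅) * hk
  have s₁ := step 1 1 1 1 (Or.inl (by push_cast; linear_combination h))
  have s₂ := step _ _ _ _ (Or.inr s₁)
  have s₃ := step _ _ _ _ (Or.inr s₂)
  have s₄ := step _ _ _ _ (Or.inr s₃)
  push_cast at s₁ s₂ s₃ s₄
  linear_combination 120 * h - 154 * s₁ + 71 * s₂ - 14 * s₃ + s₄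

/-- The relation `algebraic_relation` cannot hold where `a` and `k` are invertible. The derivation `e₁` scales `a`, `M`
and `K` below by `2 k`, `k` and `2 k` and annihilates `c`, `C` and `C / S`;
    written in these functions the relation is a
sum of parts of weights `0`, `2`, `3`, `4` and `5`, and the part of weight `0` is a multiple of `c C²`. -/
theorem c_mul_C_sq_eq_zero {a' k' : R} (ha : A.a * a' = 1) (hk : A.k * k' = 1)
    (h : 60 * A.a ^ 3 - 60 * A.a ^ 2 - 48 * A.a
      + 30 * A.a * (2 * A.a + 1) * (A.l * A.C * A.S') + 60 * A.a * A.k ^ 2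
      + c * A.C ^ 2 * (8 * A.a + 5) = 0) : c * A.C ^ 2 = 0 := by
  have hp := A.three_a_T_a
  -- `G` is the cotangent of the angle between `T` and the Hopf field
  set G := A.C * A.S' with hG
  have hCG : A.C = G * A.S := by rw [hG]; linear_combination -A.C * A.inv
  have h1G : (1 + G ^ 2) * A.S ^ 2 = 1 := by
    linear_combination A.sq - (A.C + G * A.S) * hCG
  have eG : A.e₁ G = 0 := by
    rw [hG]; simp [A.e₁_C, A.e₁_S']
  have ea' : A.e₁ a' = - 2 * a' * A.k := by
    have h := congrArg A.e₁ ha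
    simp only [Derivation.leibniz, smul_eq_mul, A.e₁_a, Derivation.map_one_eq_zero] at h
    linear_combination a' * h - A.e₁ a' * ha - 2 * a' * A.k * ha
  have hTa : 3 * A.T A.a = - c * A.k * A.S * A.C * a' := by
    linear_combination a' * hp - 3 * A.T A.a * ha
  have el := A.e₁_l
  have ek := A.e₁_k
  have hm : A.l * A.C * A.S' = A.l * G := by rw [hG]; ring
  have hm' : (A.a + 1) * A.C * A.S' = (A.a + 1) * G := by rw [hG]; ring
  rw [hm'] at el
  rw [hm] at ek h
  obtain ⟨M, hM⟩ : ∃ M, M = 9 * A.l * G - 9 * G ^ 2 * (A.a - 1) - c * A.C ^ 2 * a' := ⟨_, rfl⟩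
  have eM : A.e₁ M = A.k * M := by
    rw [hM]
    simp only [Derivation.leibniz, smul_eq_mul, A.e₁_a, Derivation.map_one_eq_zero, eG, map_sub, el, A.e₁_c, ea',
        A.e₁_C,
      Derivation.leibniz_pow, nsmul_eq_mul, ← Nat.cast_ofNat (R := R), Derivation.map_natCast]
    push_cast
    rw [hCG] at hTa ⊢
    linear_combination 3 * G * hTa
  obtain ⟨K, hK⟩ : ∃ K, K = 18 * A.k ^ 2 + 18 * (1 + G ^ 2) * (A.a ^ 2 + 1) - 2 * c * A.C ^ 2
      - c * A.C ^ 2 * a' + 4 * M * A.a - 4 * M := ⟨_, rfl⟩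
  have eK : A.e₁ K = 2 * A.k * K := by
    rw [hK]
    simp only [Derivation.leibniz, smul_eq_mul, A.e₁_a, Derivation.map_one_eq_zero, eG, map_sub, map_add, eM, ek,
        A.e₁_c, ea', A.e₁_C,
      Derivation.leibniz_pow, nsmul_eq_mul, ← Nat.cast_ofNat (R := R), Derivation.map_natCast]
    push_cast
    rw [hM]
    linear_combination -4 * c * A.C ^ 2 * A.k * ha
  have h0 : 120 * (210 * (c * A.C ^ 2)) = 0 := by
    refine weight_zero_part_eq_zero A.e₁ (k := A.k) hk (w₂ := (-1944 - 1620 * G ^ 2 + 384 * c * A.C ^ 2) * A.a)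
      (w₃ := 300 * M * A.a) (w₄ := 60 * K * A.a - (1080 + 540 * G ^ 2) * A.a ^ 2)
      (w₅ := -120 * M * A.a ^ 2) ?_ ?_ ?_ ?_ ?_ ?_
    iterate 5
      simp only [Derivation.leibniz, smul_eq_mul, A.e₁_a, eM, eK, A.e₁_c, A.e₁_C, eG, map_sub, map_add, map_neg,
        Derivation.leibniz_pow, nsmul_eq_mul, ← Nat.cast_ofNat (R := R), Derivation.map_natCast]
      push_cast
      ring
    rw [hK, hM]
    linear_combination 18 * h + (-120 * c * A.C ^ 2 * A.a - 120 * c * A.C ^ 2) * ha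
  have h2 : algebraMap ℝ R (1/25200) * 25200 = 1 := by
    rw [← map_ofNat (algebraMap ℝ R) 25200, ← map_mul]; norm_num
  linear_combination algebraMap ℝ R (1/25200) * h0 - c * A.C ^ 2 * h2
end AdaptedFrame

namespace AdaptedFrame
variable {R : Type*} [CommRing R] [Algebra ℝ R] {c : R} (A : AdaptedFrame R c)

/-- For a frame with `k = 0`, that is, when the angle with the Hopf fibres is constant along the leaves, `a` is
constant along the leaves. -/
theorem T_a_eq_zero (hk : A.k = 0) : A.T A.a = 0 := by
  have h := A.e₂_k
  rw [hk, map_zero, mul_zero] at h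
  linear_combination h

theorem a_mul_T_l_eq_zero (hk : A.k = 0) : A.a * A.T A.l = 0 := by
  apply two_mul_cancel
  have h := A.e₂_T_a
  rw [A.T_a_eq_zero hk, hk, map_zero] at h
  linear_combination -h

theorem T_l_eq_zero (hk : A.k = 0) (hψ : 1 - A.l * A.C * A.S' - A.a = 0) : A.T A.l = 0 := by
  have h1 := A.a_mul_T_l_eq_zero hk
  have h2 := congrArg A.T hψ
  simp only [Derivation.leibniz, smul_eq_mul, map_sub, A.T_C, A.T_S', Derivation.map_one_eq_zero,
    A.T_a_eq_zero hk, hk, map_zero] at h2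
  linear_combination h1 - A.l * h2 + A.T A.l * hψ

/-- Where the rotation coefficient `ψ = 1 - l C / S - a` of `e₁` along `T` is invertible, `a = -1`, which forces
`2 l = -c S C`, and the equation for `l` then gives an equation for the angle alone. -/
theorem c_mul_eq_zero {ψ' : R} (hk : A.k = 0) (hψ : (1 - A.l * A.C * A.S' - A.a) * ψ' = 1) :
    c * (c * A.C ^ 2 + 4) = 0 := by
  have h1 := A.e₁_k
  rw [hk, map_zero] at h1
  have ha : A.a + 1 = 0 := by linear_combination -ψ' * h1 - (A.a + 1) * hψ
  have h2 := congrArg A.e₂ ha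
  simp only [map_add, Derivation.map_one_eq_zero, map_zero, A.e₂_a, add_zero] at h2
  have hl : 2 * A.l = - c * A.S * A.C := by linear_combination 2 * A.l * ha - h2
  have h3 := congrArg A.e₂ hl
  simp only [Derivation.leibniz, smul_eq_mul, map_neg, A.e₂_l, A.e₂_S, A.e₂_C, A.e₂_c,
      ← Nat.cast_ofNat (R := R), Derivation.map_natCast] at h3
  push_cast at h3
  apply A.S_cancel
  apply A.S_cancel
  linear_combination 2 * h3 + (c * A.S * A.C - 2 * A.l) * hl +
    (-2 * c * A.C ^ 2 + 2 * c * A.S ^ 2 + 4 * (A.a - 1)) * ha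

end AdaptedFrame

/-! ### Unit fields of metric foliations: algebra -/

/-- A unit field `T = t₁ E₁ + t₂ E₂ + t₃ E₃` that spans a metric foliation of a Berger sphere, written algebraically:
`E₁`, `E₂`, `E₃` is an orthonormal frame with `E₁` along the Hopf fibres, `ν = 2 / ε`, and `metric` says that
`⟨∇_x T, y⟩ + ⟨∇_y T, x⟩ = 0` for `x = ∑ xᵢ Eᵢ` and `y = ∑ yᵢ Eᵢ` orthogonal to `T`. -/
structure UnitMetricField (R : Type*) [CommRing R] [Algebra ℝ R] (ν : R) where
  E₁ : Derivation ℝ R R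
  E₂ : Derivation ℝ R R
  E₃ : Derivation ℝ R R
  E₁_ν : E₁ ν = 0
  E₂_ν : E₂ ν = 0
  E₃_ν : E₃ ν = 0
  E₂_E₃ : ∀ f, E₂ (E₃ f) - E₃ (E₂ f) = 2 * E₁ f
  E₁_E₂ : ∀ f, E₁ (E₂ f) - E₂ (E₁ f) = ν * E₃ f
  E₃_E₁ : ∀ f, E₃ (E₁ f) - E₁ (E₃ f) = ν * E₂ f
  t₁ : R
  t₂ : R
  t₃ : R
  unit : t₁ ^ 2 + t₂ ^ 2 + t₃ ^ 2 = 1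
  metric : ∀ x₁ x₂ x₃ y₁ y₂ y₃ : R, x₁ * t₁ + x₂ * t₂ + x₃ * t₃ = 0 →
    y₁ * t₁ + y₂ * t₂ + y₃ * t₃ = 0 →
    2 * E₁ t₁ * x₁ * y₁ + 2 * E₂ t₂ * x₂ * y₂ + 2 * E₃ t₃ * x₃ * y₃ +
    (E₁ t₂ + E₂ t₁ - (ν - 2) * t₃) * (x₁ * y₂ + x₂ * y₁) +
    (E₁ t₃ + E₃ t₁ + (ν - 2) * t₂) * (x₁ * y₃ + x₃ * y₁) +
    (E₂ t₃ + E₃ t₂) * (x₂ * y₃ + x₃ * y₂) = 0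

namespace UnitMetricField
variable {R : Type*} [CommRing R] [Algebra ℝ R] {ν : R} (B : UnitMetricField R ν)

/-- The derivation along the vector field `x₁ E₁ + x₂ E₂ + x₃ E₃`. -/
def along (x₁ x₂ x₃ : R) : Derivation ℝ R R := x₁ • B.E₁ + x₂ • B.E₂ + x₃ • B.E₃

theorem along_apply (x₁ x₂ x₃ f : R) :
    B.along x₁ x₂ x₃ f = x₁ * B.E₁ f + x₂ * B.E₂ f + x₃ * B.E₃ f := by
  simp [along]

variable {S S' : R}

/-- The derivatives of a pair of functions on the unit circle are determined by the derivative `x D y - y D x` of its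
angle. -/
theorem along_mul_swap (D : Derivation ℝ R R) {x y : R} (h : x ^ 2 + y ^ 2 = 1) :
    D x = - y * (x * D y - y * D x) ∧ D y = x * (x * D y - y * D x) := by
  have h1 := congrArg D h
  simp only [map_add, Derivation.leibniz_pow, Derivation.map_one_eq_zero, smul_eq_mul,
    nsmul_eq_mul] at h1
  norm_num at h1
  have h2 : x * D x + y * D y = 0 := by
    apply AdaptedFrame.two_mul_cancel; linear_combination h1
  constructor
  · linear_combination x * h2 - D x * h
  · linear_combination y * h2 - D y * h

/-- For `T = C E₁ + S (x E₂ + y E₃)`, the frame `e₁ = S E₁ - C (x E₂ + y E₃)`, `e₂ = y E₂ - x E₃` of the orthogonal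
distribution reduces the metric equation to three scalar equations, for the pairs `(e₁, e₁)`, `(e₂, e₂)`, `(e₁,
    e₂)`. -/
theorem adapted_relations (hS : S ^ 2 + B.t₁ ^ 2 = 1) (hS' : S * S' = 1) {x y a : R} {e₁ e₂ : Derivation ℝ R R}
    (h₁ : ∀ f, e₁ f = S * B.E₁ f - B.t₁ * x * B.E₂ f - B.t₁ * y * B.E₃ f)
    (h₂ : ∀ f, e₂ f = y * B.E₂ f - x * B.E₃ f)
    (hx : B.t₂ = S * x) (hy : B.t₃ = S * y) (ha : a = - S' * e₂ B.t₁ - 1) :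
    x ^ 2 + y ^ 2 = 1 ∧ e₁ B.t₁ = 0 ∧ x * e₂ y - y * e₂ x = 0 ∧
     S * (x * e₁ y - y * e₁ x) = - (a + 1 + (ν - 2) * S ^ 2) := by
  have hxy : x ^ 2 + y ^ 2 = 1 := by
    have := B.unit
    rw [hx, hy] at this
    linear_combination S' ^ 2 * this - S' ^ 2 * hS - (x ^ 2 + y ^ 2 - 1) * (S * S' + 1) * hS'
  have hds : ∀ D : Derivation ℝ R R, D S = - S' * B.t₁ * D B.t₁ := by
    intro D
    have h := congrArg D hS
    simp only [map_add, Derivation.leibniz_pow, Derivation.map_one_eq_zero, smul_eq_mul,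
      nsmul_eq_mul] at h
    norm_num at h
    apply AdaptedFrame.two_mul_cancel
    linear_combination S' * h - 2 * D S * hS'
  have m11 := B.metric S (-B.t₁ * x) (-B.t₁ * y) S (-B.t₁ * x) (-B.t₁ * y)
    (by rw [hx, hy]; linear_combination - B.t₁ * S * hxy)
    (by rw [hx, hy]; linear_combination - B.t₁ * S * hxy)
  have m12 := B.metric S (-B.t₁ * x) (-B.t₁ * y) 0 y (-x)
    (by rw [hx, hy]; linear_combination - B.t₁ * S * hxy)
    (by rw [hx, hy]; ring)
  have m22 := B.metric 0 y (-x) 0 y (-x)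
    (by rw [hx, hy]; ring)
    (by rw [hx, hy]; ring)
  have dxy := fun D : Derivation ℝ R R => along_mul_swap D hxy
  obtain ⟨w, hw⟩ : ∃ w : Derivation ℝ R R → R, ∀ D, w D = x * D y - y * D x := ⟨_, fun _ => rfl⟩
  simp only [← hw] at dxy
  simp only [hx, hy, Derivation.leibniz, smul_eq_mul, hds, (dxy _).1, (dxy _).2] at m11 m12 m22
  have e₁C : e₁ B.t₁ = 0 := by
    apply AdaptedFrame.two_mul_cancel
    rw [h₁]
    linear_combination S * m11 - 2 * (S * B.E₁ B.t₁ - B.t₁ * x * B.E₂ B.t₁ - B.t₁ * y * B.E₃ B.t₁) *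
      (hS + B.t₁ ^ 2 * ((x ^ 2 + y ^ 2) * hS' + hxy))
  have hw₂ : x * e₂ y - y * e₂ x = y * w B.E₂ - x * w B.E₃ := by
    rw [h₂, h₂, hw, hw]; ring
  have hw₁ : x * e₁ y - y * e₁ x = S * w B.E₁ - B.t₁ * x * w B.E₂ - B.t₁ * y * w B.E₃ := by
    rw [h₁, h₁, hw, hw, hw]; ring
  refine ⟨hxy, e₁C, ?_, ?_⟩
  · apply AdaptedFrame.two_mul_cancel
    rw [hw₂]
    linear_combination - S' * m22 - 2 * (y * w B.E₂ - x * w B.E₃) * ((x ^ 2 + y ^ 2) * hS' + hxy)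
  · rw [hw₁, ha, h₂]
    linear_combination -m12 + (y * B.E₂ B.t₁ - x * B.E₃ B.t₁) * (S' * hS - S * hS' + B.t₁ ^ 2 * S' * hxy) -
      (S * (S * w B.E₁ - B.t₁ * x * w B.E₂ - B.t₁ * y * w B.E₃) + (ν - 2) * S ^ 2) * hxy

/-- The structure equations of the frame `T`, `e₁`, `e₂`. -/
theorem adapted_brackets (hS : S ^ 2 + B.t₁ ^ 2 = 1) (hS' : S * S' = 1) {x y k a l : R} {T e₁ e₂ : Derivation ℝ R R}
    (hT : ∀ f, T f = B.t₁ * B.E₁ f + S * x * B.E₂ f + S * y * B.E₃ f)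
    (h₁ : ∀ f, e₁ f = S * B.E₁ f - B.t₁ * x * B.E₂ f - B.t₁ * y * B.E₃ f)
    (h₂ : ∀ f, e₂ f = y * B.E₂ f - x * B.E₃ f)
    (hx : B.t₂ = S * x) (hy : B.t₃ = S * y) (hk : k = S' * T B.t₁) (ha : a = - S' * e₂ B.t₁ - 1)
    (hl : l = - S * (x * T y - y * T x) - (ν - 2) * B.t₁ * S) :
    (∀ f, T (e₁ f) - e₁ (T f) = -k * T f + (1 - l * B.t₁ * S' - a) * e₂ f) ∧
    (∀ f, T (e₂ f) - e₂ (T f) = -l * T f - (1 - l * B.t₁ * S' - a) * e₁ f) ∧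
    (∀ f, e₁ (e₂ f) - e₂ (e₁ f) = -2 * a * T f + (a + 1) * B.t₁ * S' * e₁ f) := by
  obtain ⟨hxy, e₁C, hw₂, hw₁⟩ := B.adapted_relations hS hS' h₁ h₂ hx hy ha
  have TC : T B.t₁ = S * k := by rw [hk]; linear_combination - T B.t₁ * hS'
  have e₂C : e₂ B.t₁ = - S * (a + 1) := by rw [ha]; linear_combination - e₂ B.t₁ * hS'
  have hds : ∀ D : Derivation ℝ R R, D S = - S' * B.t₁ * D B.t₁ := by
    intro D
    have h := congrArg D hS
    simp only [map_add, Derivation.leibniz_pow, Derivation.map_one_eq_zero, smul_eq_mul,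
      nsmul_eq_mul] at h
    norm_num at h
    apply AdaptedFrame.two_mul_cancel
    linear_combination S' * h - 2 * D S * hS'
  have TS : T S = - B.t₁ * k := by rw [hds, TC]; linear_combination - B.t₁ * k * hS'
  have e₁S : e₁ S = 0 := by rw [hds, e₁C]; ring
  have e₂S : e₂ S = B.t₁ * (a + 1) := by rw [hds, e₂C]; linear_combination B.t₁ * (a + 1) * hS'
  have dT := along_mul_swap T hxy
  have d1 := along_mul_swap e₁ hxy
  have d2 := along_mul_swap e₂ hxy
  have wT : x * T y - y * T x = - S' * (l + (ν - 2) * B.t₁ * S) := by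
    rw [hl]; linear_combination - (x * T y - y * T x) * hS'
  have w1 : x * e₁ y - y * e₁ x = - S' * (a + 1 + (ν - 2) * S ^ 2) := by
    linear_combination S' * hw₁ - (x * e₁ y - y * e₁ x) * hS'
  rw [wT] at dT
  rw [w1] at d1
  rw [hw₂] at d2
  have b23 := fun f => B.E₂_E₃ f
  have b12 := fun f => B.E₁_E₂ f
  have b31 := fun f => B.E₃_E₁ f
  refine ⟨fun f => ?_, fun f => ?_, fun f => ?_⟩
  · have h : T (e₁ f) - e₁ (T f) = (T S - e₁ B.t₁) * B.E₁ f - (T (B.t₁ * x) + e₁ (S * x)) * B.E₂ f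
        - (T (B.t₁ * y) + e₁ (S * y)) * B.E₃ f
        - (B.t₁ ^ 2 + S ^ 2) * (x * (ν * B.E₃ f) - y * (ν * B.E₂ f)) := by
      rw [h₁ f, hT f]
      simp only [map_add, map_sub, Derivation.leibniz, smul_eq_mul]
      rw [hT (B.E₁ f), hT (B.E₂ f), hT (B.E₃ f), h₁ (B.E₁ f), h₁ (B.E₂ f), h₁ (B.E₃ f)]
      linear_combination - (B.t₁ ^ 2 + S ^ 2) * (x * b12 f - y * b31 f)
    rw [h, h₂ f, hT f]
    simp only [Derivation.leibniz, smul_eq_mul, TC, TS, e₁C, e₁S, dT, d1]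
    linear_combination (-(y * B.E₂ f - x * B.E₃ f)) *
      (((ν - 2) * (B.t₁ ^ 2 + S ^ 2) + a + 1) * hS' - 2 * hS)
  · have h : T (e₂ f) - e₂ (T f) = (- e₂ B.t₁) * B.E₁ f + (T y - e₂ (S * x)) * B.E₂ f
        - (T x + e₂ (S * y)) * B.E₃ f
        + B.t₁ * y * (ν * B.E₃ f) + B.t₁ * x * (ν * B.E₂ f) - S * (x ^ 2 + y ^ 2) * (2 * B.E₁ f) := by
      rw [h₂ f, hT f]
      simp only [map_add, map_sub, Derivation.leibniz, smul_eq_mul]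
      rw [hT (B.E₂ f), hT (B.E₃ f), h₂ (B.E₁ f), h₂ (B.E₂ f), h₂ (B.E₃ f)]
      linear_combination B.t₁ * y * b12 f + B.t₁ * x * b31 f - S * (x ^ 2 + y ^ 2) * b23 f
    rw [h, h₁ f, hT f]
    simp only [Derivation.leibniz, smul_eq_mul, e₂C, e₂S, dT, d2]
    linear_combination B.E₁ f * (-2 * S * hxy - l * B.t₁ * hS') + (x * B.E₂ f + y * B.E₃ f) *
      (l * S' * hS - (l * S + (ν - 2) * B.t₁) * hS')
  · have h : e₁ (e₂ f) - e₂ (e₁ f) = (- e₂ S) * B.E₁ f + (e₁ y + e₂ (B.t₁ * x)) * B.E₂ f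
        - (e₁ x - e₂ (B.t₁ * y)) * B.E₃ f
        + S * y * (ν * B.E₃ f) + S * x * (ν * B.E₂ f) + B.t₁ * (x ^ 2 + y ^ 2) * (2 * B.E₁ f) := by
      rw [h₂ f, h₁ f]
      simp only [map_sub, Derivation.leibniz, smul_eq_mul]
      rw [h₁ (B.E₂ f), h₁ (B.E₃ f), h₂ (B.E₁ f), h₂ (B.E₂ f), h₂ (B.E₃ f)]
      linear_combination S * y * b12 f + S * x * b31 f + B.t₁ * (x ^ 2 + y ^ 2) * b23 f
    rw [h, h₁ f, hT f]
    simp only [Derivation.leibniz, smul_eq_mul, e₂C, e₂S, d1, d2]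
    linear_combination B.E₁ f * (2 * B.t₁ * hxy - (a + 1) * B.t₁ * hS') +
      (x * B.E₂ f + y * B.E₃ f) * ((a + 1) * S' * hS - (a + ν - 1) * S * hS')

/-- The integrability conditions of the frame: the form `x dy - y dx` is closed, evaluated on the three pairs of
fields of the frame. -/
theorem adapted_curvature (hS : S ^ 2 + B.t₁ ^ 2 = 1) (hS' : S * S' = 1) {x y k a l : R} {T e₁ e₂ : Derivation ℝ R R}
    (hT : ∀ f, T f = B.t₁ * B.E₁ f + S * x * B.E₂ f + S * y * B.E₃ f)
    (h₁ : ∀ f, e₁ f = S * B.E₁ f - B.t₁ * x * B.E₂ f - B.t₁ * y * B.E₃ f)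
    (h₂ : ∀ f, e₂ f = y * B.E₂ f - x * B.E₃ f)
    (hx : B.t₂ = S * x) (hy : B.t₃ = S * y) (hk : k = S' * T B.t₁) (ha : a = - S' * e₂ B.t₁ - 1)
    (hl : l = - S * (x * T y - y * T x) - (ν - 2) * B.t₁ * S) :
    e₂ a = 2 * a * l - (2 * ν - 4) * S * B.t₁ ∧
    e₂ l = l ^ 2 - a ^ 2 + 1 + (2 * ν - 4) * S ^ 2 ∧
    e₁ l = k * l + T a + (a + 1) * B.t₁ * S' * k := by
  obtain ⟨hxy, e₁C, hw₂, hw₁⟩ := B.adapted_relations hS hS' h₁ h₂ hx hy ha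
  obtain ⟨b01, b02, b12⟩ := B.adapted_brackets hS hS' hT h₁ h₂ hx hy hk ha hl
  have TC : T B.t₁ = S * k := by rw [hk]; linear_combination - T B.t₁ * hS'
  have e₂C : e₂ B.t₁ = - S * (a + 1) := by rw [ha]; linear_combination - e₂ B.t₁ * hS'
  have hds : ∀ D : Derivation ℝ R R, D S = - S' * B.t₁ * D B.t₁ := by
    intro D
    have h := congrArg D hS
    simp only [map_add, Derivation.leibniz_pow, Derivation.map_one_eq_zero, smul_eq_mul,
      nsmul_eq_mul] at h
    norm_num at h
    apply AdaptedFrame.two_mul_cancel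
    linear_combination S' * h - 2 * D S * hS'
  have TS : T S = - B.t₁ * k := by rw [hds, TC]; linear_combination - B.t₁ * k * hS'
  have e₁S : e₁ S = 0 := by rw [hds, e₁C]; ring
  have e₂S : e₂ S = B.t₁ * (a + 1) := by rw [hds, e₂C]; linear_combination B.t₁ * (a + 1) * hS'
  have hds' : ∀ D : Derivation ℝ R R, D S' = - S' ^ 2 * D S := by
    intro D
    have h := congrArg D hS'
    simp only [Derivation.leibniz, smul_eq_mul, Derivation.map_one_eq_zero] at h
    linear_combination S' * h - D S' * hS'
  have dν : T ν = 0 ∧ e₁ ν = 0 ∧ e₂ ν = 0 := by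
    refine ⟨?_, ?_, ?_⟩
    · rw [hT, B.E₁_ν, B.E₂_ν, B.E₃_ν]; ring
    · rw [h₁, B.E₁_ν, B.E₂_ν, B.E₃_ν]; ring
    · rw [h₂, B.E₂_ν, B.E₃_ν]; ring
  have dT := along_mul_swap T hxy
  have d1 := along_mul_swap e₁ hxy
  have d2 := along_mul_swap e₂ hxy
  have wT : x * T y - y * T x = - S' * (l + (ν - 2) * B.t₁ * S) := by
    rw [hl]; linear_combination - (x * T y - y * T x) * hS'
  have w1 : x * e₁ y - y * e₁ x = - S' * (a + 1 + (ν - 2) * S ^ 2) := by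
    linear_combination S' * hw₁ - (x * e₁ y - y * e₁ x) * hS'
  rw [wT] at dT
  rw [w1] at d1
  rw [hw₂] at d2
  -- the structure equation of the angle form `x dy - y dx`, in each pair of the frame
  have closed : ∀ {D D' : Derivation ℝ R R} {u u' : R}, D x = - y * u ∧ D y = x * u →
      D' x = - y * u' ∧ D' y = x * u' → x * (D (D' y) - D' (D y)) - y * (D (D' x) - D' (D x)) =
        D u' - D' u := by
    rintro D D' u u' ⟨h1, h2⟩ ⟨h3, h4⟩
    rw [h1, h2, h3, h4]
    simp only [Derivation.leibniz, smul_eq_mul, map_neg, h1, h2, h3, h4]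
    linear_combination (D u' - D' u) * hxy
  have c01 := closed dT d1
  have c02 := closed dT d2
  have c12 := closed d1 d2
  rw [b01, b01] at c01
  rw [b02, b02] at c02
  rw [b12, b12] at c12
  rw [dT.1, dT.2, d2.1, d2.2] at c01
  rw [dT.1, dT.2, d1.1, d1.2] at c02 c12
  simp only [Derivation.leibniz, smul_eq_mul, map_neg, map_add, map_sub, map_zero, hds', TS, e₁S, e₁C,
    e₂S, e₂C, dν, Derivation.leibniz_pow, nsmul_eq_mul, Derivation.map_one_eq_zero,
     ← Nat.cast_ofNat (R := R), Derivation.map_natCast] at c01 c02 c12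
  push_cast at c01 c02 c12
  norm_num at c01 c02 c12
  refine ⟨?_, ?_, ?_⟩
  · linear_combination -S * c12 + S * (2 * a * S' * (l + (ν - 2) * B.t₁ * S) -
      (a + 1) * B.t₁ * S' ^ 2 * (a + 1 + (ν - 2) * S ^ 2)) * hxy -
      (e₂ a - (2 * a * l - (2 * ν - 4) * S * B.t₁)) * hS'
  · linear_combination -S * c02 + S * (l * S' * (l + (ν - 2) * B.t₁ * S) +
      (1 - l * B.t₁ * S' - a) * S' * (a + 1 + (ν - 2) * S ^ 2)) * hxy -
      (-l * S' * B.t₁ * (a + 1) - (ν - 2) * B.t₁ ^ 2 * (a + 1) * (S * S' + 1) +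
        e₂ l + (ν - 2) * (B.t₁ ^ 2 - S ^ 2) * (a + 1) - l * (l + (ν - 2) * B.t₁ * S) -
        (1 - l * B.t₁ * S' - a) * (a + 1 + (ν - 2) * S ^ 2) + (ν - 2) * l * B.t₁ * S) * hS'
  · linear_combination -S * c01 + S * (k * S' * (l + (ν - 2) * B.t₁ * S)) * hxy -
      (-(T a - 2 * (ν - 2) * S * B.t₁ * k) - (a + 1 + (ν - 2) * S ^ 2) * S' * B.t₁ * k -
        (ν - 2) * S * B.t₁ * k + e₁ l - k * (l + (ν - 2) * B.t₁ * S)) * hS'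

/-- The adapted frame of a unit field whose first coefficient `t₁ = C` satisfies `S² + C² = 1` with `S` invertible. -/
def adaptedFrame (hS : S ^ 2 + B.t₁ ^ 2 = 1) (hS' : S * S' = 1) :
    AdaptedFrame R (2 * ν - 4) :=
  let T := B.along B.t₁ B.t₂ B.t₃
  let e₁ := B.along S (-B.t₁ * (B.t₂ * S')) (-B.t₁ * (B.t₃ * S'))
  let e₂ := B.along 0 (B.t₃ * S') (-(B.t₂ * S'))
  let k := S' * T B.t₁
  let a := - S' * e₂ B.t₁ - 1
  let l := - S * ((B.t₂ * S') * T (B.t₃ * S') - (B.t₃ * S') * T (B.t₂ * S')) - (ν - 2) * B.t₁ * S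
  have hx : B.t₂ = S * (B.t₂ * S') := by linear_combination - B.t₂ * hS'
  have hy : B.t₃ = S * (B.t₃ * S') := by linear_combination - B.t₃ * hS'
  have hT : ∀ f, T f = B.t₁ * B.E₁ f + S * (B.t₂ * S') * B.E₂ f + S * (B.t₃ * S') * B.E₃ f :=
    fun f => by rw [← hx, ← hy]; exact B.along_apply _ _ _ f
  have h₁ : ∀ f, e₁ f = S * B.E₁ f - B.t₁ * (B.t₂ * S') * B.E₂ f - B.t₁ * (B.t₃ * S') * B.E₃ f :=
    fun f => by rw [B.along_apply]; ring
  have h₂ : ∀ f, e₂ f = (B.t₃ * S') * B.E₂ f - (B.t₂ * S') * B.E₃ f :=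
    fun f => by rw [B.along_apply]; ring
  have hrel := B.adapted_relations (a := a) hS hS' h₁ h₂ hx hy rfl
  have hbr := B.adapted_brackets (k := k) (a := a) (l := l) hS hS' hT h₁ h₂ hx hy rfl rfl rfl
  have hcurv := B.adapted_curvature (k := k) (a := a) (l := l) hS hS' hT h₁ h₂ hx hy rfl rfl rfl
  have hD : ∀ D : Derivation ℝ R R, D (2 * ν - 4) = 2 * D ν := fun D => by
    simp only [map_sub, Derivation.leibniz, smul_eq_mul, ← Nat.cast_ofNat (R := R),
      Derivation.map_natCast]
    ring
  { T := T
    e₁ := e₁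
    e₂ := e₂
    S := S
    S' := S'
    C := B.t₁
    a := a
    k := k
    l := l
    sq := hS
    inv := hS'
    T_c := by rw [hD, hT, B.E₁_ν, B.E₂_ν, B.E₃_ν]; ring
    e₁_c := by rw [hD, h₁, B.E₁_ν, B.E₂_ν, B.E₃_ν]; ring
    e₂_c := by rw [hD, h₂, B.E₂_ν, B.E₃_ν]; ring
    T_C := by linear_combination - T B.t₁ * hS'
    e₁_C := hrel.2.1
    e₂_C := by linear_combination - e₂ B.t₁ * hS'
    T_e₁ := hbr.1
    T_e₂ := hbr.2.1
    e₁_e₂ := hbr.2.2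
    e₂_a := hcurv.1
    e₂_l := hcurv.2.1
    e₁_l := hcurv.2.2 }

/-- The unit field `T` is a multiple of a Killing field. Killing fields have the form `K₀ + μ E₁`, where `K₀`
commutes with the frame and `μ` is a constant, so the coefficients `kᵢ` of a Killing field satisfy
`[Eⱼ, ∑ kᵢ Eᵢ] = μ [Eⱼ, E₁]`. If the Killing field is `f T` with `N = ν μ / f`, then these are the equations below,
with `Eⱼ f / f` eliminated by means of `t₁² + t₂² + t₃² = 1`. -/
structure IsKillingDirection (N : R) : Prop where
  E₁_t₁ : B.E₁ B.t₁ = 0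
  E₁_t₂ : B.E₁ B.t₂ = ν * B.t₃
  E₁_t₃ : B.E₁ B.t₃ = - ν * B.t₂
  E₁_N : B.E₁ N = 0
  E₂_t₁ : B.E₂ B.t₁ = -2 * B.t₃ - (-2 * B.t₃ * B.t₁ + (ν * B.t₁ - N) * B.t₃) * B.t₁
  E₂_t₂ : B.E₂ B.t₂ = - (-2 * B.t₃ * B.t₁ + (ν * B.t₁ - N) * B.t₃) * B.t₂
  E₂_t₃ : B.E₂ B.t₃ = (ν * B.t₁ - N) - (-2 * B.t₃ * B.t₁ + (ν * B.t₁ - N) * B.t₃) * B.t₃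
  E₂_N : B.E₂ N = - (-2 * B.t₃ * B.t₁ + (ν * B.t₁ - N) * B.t₃) * N
  E₃_t₁ : B.E₃ B.t₁ = 2 * B.t₂ - (2 * B.t₂ * B.t₁ - (ν * B.t₁ - N) * B.t₂) * B.t₁
  E₃_t₂ : B.E₃ B.t₂ = - (ν * B.t₁ - N) - (2 * B.t₂ * B.t₁ - (ν * B.t₁ - N) * B.t₂) * B.t₂
  E₃_t₃ : B.E₃ B.t₃ = - (2 * B.t₂ * B.t₁ - (ν * B.t₁ - N) * B.t₂) * B.t₃
  E₃_N : B.E₃ N = - (2 * B.t₂ * B.t₁ - (ν * B.t₁ - N) * B.t₂) * N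

/-- The function `N = ν μ / f` of `IsKillingDirection`, where `f T` is a Killing field with Hopf component `μ E₁`,
in terms of the first derivatives of the unit field `T`. This expression makes sense also where `T` is tangent to the
Hopf fibres. -/
noncomputable def hopfPart : R := algebraMap ℝ R (1 / 2) * (B.t₁ * (4 -
    (B.t₁ * (B.E₂ B.t₃ - B.E₃ B.t₂) + B.t₂ * (B.E₃ B.t₁ - B.E₁ B.t₃) + B.t₃ * (B.E₁ B.t₂ - B.E₂ B.t₁))
    + (ν - 2) * (1 + B.t₁ ^ 2))) + (B.t₃ * B.along B.t₁ B.t₂ B.t₃ B.t₂ - B.t₂ * B.along B.t₁ B.t₂ B.t₃ B.t₃)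

/-- The given frame in terms of the adapted one. -/
theorem adaptedFrame_apply (hS : S ^ 2 + B.t₁ ^ 2 = 1) (hS' : S * S' = 1) (f : R) :
    B.E₁ f = B.t₁ * (B.adaptedFrame hS hS').T f + S * (B.adaptedFrame hS hS').e₁ f ∧
    B.E₂ f = B.t₂ * (B.adaptedFrame hS hS').T f - B.t₁ * (B.t₂ * S') * (B.adaptedFrame hS hS').e₁ f
      + (B.t₃ * S') * (B.adaptedFrame hS hS').e₂ f ∧
    B.E₃ f = B.t₃ * (B.adaptedFrame hS hS').T f - B.t₁ * (B.t₃ * S') * (B.adaptedFrame hS hS').e₁ f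
      - (B.t₂ * S') * (B.adaptedFrame hS hS').e₂ f := by
  have hT : (B.adaptedFrame hS hS').T f = _ := B.along_apply _ _ _ f
  have h₁ : (B.adaptedFrame hS hS').e₁ f = _ := B.along_apply _ _ _ f
  have h₂ : (B.adaptedFrame hS hS').e₂ f = _ := B.along_apply _ _ _ f
  have hu := B.unit
  have hyz : (B.t₂ ^ 2 + B.t₃ ^ 2) = S ^ 2 := by linear_combination hu - hS
  have hyz' : (B.t₂ ^ 2 + B.t₃ ^ 2) * S' ^ 2 = 1 := by
    rw [hyz]; linear_combination (S * S' + 1) * hS'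
  rw [hT, h₁, h₂]
  refine ⟨?_, ?_, ?_⟩
  · linear_combination -B.E₁ f * hS + (B.t₁ * B.t₂ * B.E₂ f + B.t₁ * B.t₃ * B.E₃ f) * hS'
  · linear_combination B.t₁ * B.t₂ * B.E₁ f * hS' - B.E₂ f * (-B.t₂ ^ 2 * (S * S' + 1) * hS' +
      B.t₂ ^ 2 * S' ^ 2 * hS + hyz') -
      B.E₃ f * B.t₂ * B.t₃ * (-(S * S' + 1) * hS' + S' ^ 2 * hS)
  · linear_combination B.t₁ * B.t₃ * B.E₁ f * hS' - B.E₃ f * (-B.t₃ ^ 2 * (S * S' + 1) * hS' +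
      B.t₃ ^ 2 * S' ^ 2 * hS + hyz') -
      B.E₂ f * B.t₂ * B.t₃ * (-(S * S' + 1) * hS' + S' ^ 2 * hS)

theorem adaptedFrame_t₂_t₃ (hS : S ^ 2 + B.t₁ ^ 2 = 1) (hS' : S * S' = 1)
    {A : AdaptedFrame R (2 * ν - 4)} (hA : A = B.adaptedFrame hS hS') :
    A.T B.t₂ = B.t₃ * S' * (A.l + (ν - 2) * B.t₁ * S) - B.t₂ * S' * B.t₁ * A.k ∧
    A.T B.t₃ = -(B.t₂ * S') * (A.l + (ν - 2) * B.t₁ * S) - B.t₃ * S' * B.t₁ * A.k ∧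
    A.e₁ B.t₂ = B.t₃ * S' * (A.a + 1 + (ν - 2) * S ^ 2) ∧
    A.e₁ B.t₃ = -(B.t₂ * S') * (A.a + 1 + (ν - 2) * S ^ 2) ∧
    A.e₂ B.t₂ = B.t₂ * S' * B.t₁ * (A.a + 1) ∧
    A.e₂ B.t₃ = B.t₃ * S' * B.t₁ * (A.a + 1) := by
  have hx : B.t₂ = S * (B.t₂ * S') := by linear_combination - B.t₂ * hS'
  have hy : B.t₃ = S * (B.t₃ * S') := by linear_combination - B.t₃ * hS'
  have h₁ : ∀ f, A.e₁ f = S * B.E₁ f - B.t₁ * (B.t₂ * S') * B.E₂ f - B.t₁ * (B.t₃ * S') * B.E₃ f :=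
    fun f => by rw [hA]; refine (B.along_apply _ _ _ f).trans ?_; ring
  have h₂ : ∀ f, A.e₂ f = (B.t₃ * S') * B.E₂ f - (B.t₂ * S') * B.E₃ f :=
    fun f => by rw [hA]; refine (B.along_apply _ _ _ f).trans ?_; ring
  have ha : A.a = - S' * A.e₂ B.t₁ - 1 := by rw [hA]; rfl
  obtain ⟨hxy, e₁C, hw₂, hw₁⟩ := B.adapted_relations (a := A.a) hS hS' h₁ h₂ hx hy ha
  have hl : A.l = - S * ((B.t₂ * S') * A.T (B.t₃ * S') - (B.t₃ * S') * A.T (B.t₂ * S')) -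
      (ν - 2) * B.t₁ * S := by rw [hA]; rfl
  have dT := along_mul_swap A.T hxy
  have d1 := along_mul_swap A.e₁ hxy
  have d2 := along_mul_swap A.e₂ hxy
  rw [hw₂] at d2
  have TS := A.T_S
  have e₁S := A.e₁_S
  have e₂S := A.e₂_S
  have hAS : A.S = S := by rw [hA]; rfl
  have hAC : A.C = B.t₁ := by rw [hA]; rfl
  rw [hAS, hAC] at TS e₂S
  rw [hAS] at e₁S
  have dt₂ : ∀ D : Derivation ℝ R R, D B.t₂ = S * D (B.t₂ * S') + B.t₂ * S' * D S := fun D => by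
    conv_lhs => rw [hx]
    simp only [Derivation.leibniz, smul_eq_mul]
  have dt₃ : ∀ D : Derivation ℝ R R, D B.t₃ = S * D (B.t₃ * S') + B.t₃ * S' * D S := fun D => by
    conv_lhs => rw [hy]
    simp only [Derivation.leibniz, smul_eq_mul]
  simp only [dt₂ A.T, dt₃ A.T, dt₂ A.e₁, dt₃ A.e₁, dt₂ A.e₂, dt₃ A.e₂, TS, e₁S, e₂S]
  refine ⟨?_, ?_, ?_, ?_, ?_, ?_⟩
  · linear_combination S * dT.1 - B.t₃ * S' * hl
  · linear_combination S * dT.2 + B.t₂ * S' * hl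
  · linear_combination S * d1.1 - B.t₃ * S' * hw₁
  · linear_combination S * d1.2 + B.t₂ * S' * hw₁
  · linear_combination S * d2.1
  · linear_combination S * d2.2

theorem hopfPart_eq (hS : S ^ 2 + B.t₁ ^ 2 = 1) (hS' : S * S' = 1)
    {A : AdaptedFrame R (2 * ν - 4)} (hA : A = B.adaptedFrame hS hS') :
    B.hopfPart = B.t₁ * (1 - A.a) + S * A.l + (ν - 2) * B.t₁ := by
  have h := B.adaptedFrame_apply hS hS'
  rw [← hA] at h
  obtain ⟨h1, h2, h3, h4, h5, h6⟩ := B.adaptedFrame_t₂_t₃ hS hS' hA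
  have hT : B.along B.t₁ B.t₂ B.t₃ = A.T := by rw [hA]; rfl
  have hAC : A.C = B.t₁ := by rw [hA]; rfl
  have hAS : A.S = S := by rw [hA]; rfl
  have hu := B.unit
  have e1 := A.T_C
  have e2 := A.e₁_C
  have e3 := A.e₂_C
  rw [hAC, hAS] at e1 e3
  rw [hAC] at e2
  have h2' : algebraMap ℝ R (1/2) * 2 = 1 := by
    rw [← map_ofNat (algebraMap ℝ R) 2, ← map_mul]; norm_num
  obtain ⟨x, hx'⟩ : ∃ x, B.t₂ * S' = x := ⟨_, rfl⟩
  obtain ⟨y, hy'⟩ : ∃ y, B.t₃ * S' = y := ⟨_, rfl⟩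
  rw [hopfPart, hT]
  simp only [(h _).1, (h _).2.1, (h _).2.2, h1, h2, h3, h4, h5, h6, e1, e2, e3, hx', hy']
  have hx : B.t₂ = S * x := by rw [← hx']; linear_combination - B.t₂ * hS'
  have hy : B.t₃ = S * y := by rw [← hy']; linear_combination - B.t₃ * hS'
  have hxy : x ^ 2 + y ^ 2 = 1 := by
    rw [← hx', ← hy']
    linear_combination S' ^ 2 * (hu - hS) + (S * S' + 1) * hS'
  apply AdaptedFrame.two_mul_cancel
  rw [hx, hy]
  generalize A.a = a
  generalize A.l = l
  generalize A.k = k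
  clear hx hy hx' hy' hu e1 e2 e3 h h1 h2 h3 h4 h5 h6 hT hAC hAS hA hS'
  generalize B.t₁ = C at *
  generalize algebraMap ℝ R (1 / 2) = r at *
  grind

/-- A unit field is a multiple of a Killing field if, in its adapted frame, both the `e₁`-component `k` of the
curvature of the leaves and the rotation coefficient `ψ = 1 - l C / S - a` vanish. -/
theorem isKillingDirection_of_adapted (hS : S ^ 2 + B.t₁ ^ 2 = 1) (hS' : S * S' = 1)
    {A : AdaptedFrame R (2 * ν - 4)} (hA : A = B.adaptedFrame hS hS') (hk : A.k = 0)
    (hψ : 1 - A.l * A.C * A.S' - A.a = 0) : B.IsKillingDirection B.hopfPart := by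
  have h := B.adaptedFrame_apply hS hS'
  rw [← hA] at h
  obtain ⟨h1, h2, h3, h4, h5, h6⟩ := B.adaptedFrame_t₂_t₃ hS hS' hA
  have hAC : A.C = B.t₁ := by rw [hA]; rfl
  have hAS : A.S = S := by rw [hA]; rfl
  have hAS' : A.S' = S' := by rw [hA]; rfl
  have hu := B.unit
  have e1 := A.T_C
  have e2 := A.e₁_C
  have e3 := A.e₂_C
  have e4 := A.T_S
  have e5 := A.e₁_S
  have e6 := A.e₂_S
  have Ta := A.T_a_eq_zero hk
  have Tl := A.T_l_eq_zero hk hψ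
  have e₁a := A.e₁_a
  have e₁l := A.e₁_l
  have e₂a := A.e₂_a
  have e₂l := A.e₂_l
  rw [hAC, hAS, hk, mul_zero] at e1
  rw [hAC, hAS] at e3 e6 e₂a
  rw [hAC, hAS, hk, mul_zero] at e4
  rw [hAC] at e2
  rw [hAS] at e5 e₂l
  rw [hk] at e₁a h1 h2
  rw [hk, Ta, zero_mul, mul_zero, add_zero, add_zero] at e₁l
  rw [mul_zero] at e₁a h1 h2
  rw [hAC, hAS'] at hψ
  have hN := B.hopfPart_eq hS hS' hA
  -- the Hopf component `n` of the Killing field, up to a multiple of `t₁`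
  obtain ⟨n, hn⟩ : ∃ n, n = B.t₁ * (1 - A.a) + S * A.l := ⟨_, rfl⟩
  have ha : A.a = 1 - n * B.t₁ := by
    rw [hn]; linear_combination (1 - A.a) * hS - S ^ 2 * hψ - A.l * B.t₁ * S * hS'
  have hl : A.l = n * S := by
    rw [hn]; linear_combination -A.l * hS - B.t₁ * S * hψ - B.t₁ ^ 2 * A.l * hS'
  have Tn : A.T n = 0 := by
    rw [hn]
    simp only [Derivation.leibniz, map_add, map_sub, Derivation.map_one_eq_zero, smul_eq_mul, e1, e4,
      Ta, Tl]
    ring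
  have e₁n : A.e₁ n = 0 := by
    rw [hn]
    simp only [Derivation.leibniz, map_add, map_sub, Derivation.map_one_eq_zero, smul_eq_mul, e2, e5,
      e₁a, e₁l]
    ring
  have dν : A.T ν = 0 ∧ A.e₁ ν = 0 ∧ A.e₂ ν = 0 := by
    refine ⟨?_, ?_, ?_⟩
    · rw [hA]; exact (B.along_apply _ _ _ ν).trans (by rw [B.E₁_ν, B.E₂_ν, B.E₃_ν]; ring)
    · rw [hA]; exact (B.along_apply _ _ _ ν).trans (by rw [B.E₁_ν, B.E₂_ν, B.E₃_ν]; ring)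
    · rw [hA]; exact (B.along_apply _ _ _ ν).trans (by rw [B.E₁_ν, B.E₂_ν, B.E₃_ν]; ring)
  have e₂n : A.e₂ n = S * (n ^ 2 + 2 * (ν - 2)) := by
    conv_lhs => rw [hn]
    simp only [Derivation.leibniz, map_add, map_sub, Derivation.map_one_eq_zero, smul_eq_mul, e3, e6,
      e₂a, e₂l]
    rw [ha, hl]
    linear_combination (S * (n ^ 2 + 2 * (ν - 2))) * hS
  obtain ⟨x, hx'⟩ : ∃ x, B.t₂ * S' = x := ⟨_, rfl⟩
  obtain ⟨y, hy'⟩ : ∃ y, B.t₃ * S' = y := ⟨_, rfl⟩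
  have hx : B.t₂ = S * x := by rw [← hx']; linear_combination - B.t₂ * hS'
  have hy : B.t₃ = S * y := by rw [← hy']; linear_combination - B.t₃ * hS'
  have hxy : x ^ 2 + y ^ 2 = 1 := by
    rw [← hx', ← hy']
    linear_combination S' ^ 2 * (hu - hS) + (S * S' + 1) * hS'
  rw [← hn] at hN
  have d2 : ∀ D : Derivation ℝ R R, D (2 : R) = 0 := fun D => by
    simp only [← Nat.cast_ofNat (R := R), Derivation.map_natCast]
  constructor
  all_goals simp only [hN, map_add, map_sub, Derivation.leibniz, smul_eq_mul, d2,
    (h _).1, (h _).2.1, (h _).2.2, h1, h2, h3, h4, h5, h6, e1, e2, e3, Tn, e₁n, e₂n, dν, hx', hy']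
  all_goals clear h1 h2 h3 h4 h5 h6 e1 e2 e3 Tn e₁n e₂n hx' hy' h dν e4 e5 e6 Ta Tl e₁a e₁l e₂a e₂l hu hn hN d2 hψ hk hAC hAS hAS' hA hS'
  all_goals try rw [ha]
  all_goals try rw [hl]
  all_goals try rw [hx]
  all_goals try rw [hy]
  all_goals clear hx hy ha hl
  all_goals generalize B.t₁ = C at *
  all_goals grind

end UnitMetricField

/-! ### Smooth functions and linear vector fields on an open set -/

section

variable {V : Type*} [NormedAddCommGroup V] [NormedSpace ℝ V] {U : Set V}

/-- The algebra of the functions on `U` that are the restriction of a function smooth on `U`. -/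
def smoothFunctions (U : Set V) : Subalgebra ℝ (U → ℝ) where
  carrier := {g | ∃ f : V → ℝ, ContDiffOn ℝ ∞ f U ∧ ∀ x : U, g x = f x}
  mul_mem' := by
    rintro _ _ ⟨f, hf, h⟩ ⟨f', hf', h'⟩
    exact ⟨fun x => f x * f' x, hf.mul hf', fun x => by simp [h, h']⟩
  add_mem' := by
    rintro _ _ ⟨f, hf, h⟩ ⟨f', hf', h'⟩
    exact ⟨fun x => f x + f' x, hf.add hf', fun x => by simp [h, h']⟩
  algebraMap_mem' r := ⟨fun _ => r, contDiffOn_const, fun _ => rfl⟩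

namespace smoothFunctions

/-- The element of `smoothFunctions U` given by a function smooth on `U`. -/
def mk (f : V → ℝ) (hf : ContDiffOn ℝ ∞ f U) : smoothFunctions U :=
  ⟨fun x => f x, f, hf, fun _ => rfl⟩

theorem mk_apply (f : V → ℝ) (hf : ContDiffOn ℝ ∞ f U) (x : U) :
    (mk f hf : U → ℝ) x = f x := rfl

/-- A function on the whole space that restricts to `g` on `U`. Its values outside `U` are arbitrary. -/
noncomputable def extend (g : smoothFunctions U) : V → ℝ := g.2.choose

theorem contDiffOn_extend (g : smoothFunctions U) : ContDiffOn ℝ ∞ (extend g) U := g.2.choose_spec.1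

theorem extend_apply (g : smoothFunctions U) (x : U) : (g : U → ℝ) x = (extend g) x := g.2.choose_spec.2 x

theorem fderiv_extend (hU : IsOpen U) (g : smoothFunctions U) {f : V → ℝ} (h : ∀ x : U, (g : U → ℝ) x = f x) {x : V}
    (hx : x ∈ U) : fderiv ℝ (extend g) x = fderiv ℝ f x := by
  apply Filter.EventuallyEq.fderiv_eq
  filter_upwards [hU.mem_nhds hx] with y hy
  rw [← h ⟨y, hy⟩, extend_apply]

theorem differentiableAt_extend (hU : IsOpen U) (g : smoothFunctions U) {x : V} (hx : x ∈ U) :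
    DifferentiableAt ℝ (extend g) x :=
  ((contDiffOn_extend g).contDiffAt (hU.mem_nhds hx)).differentiableAt (by simp)

theorem contDiffOn_fderiv_apply (hU : IsOpen U) {f : V → ℝ} (hf : ContDiffOn ℝ ∞ f U) (A : V →L[ℝ] V) :
    ContDiffOn ℝ ∞ (fun x => fderiv ℝ f x (A x)) U :=
  (hf.fderiv_of_isOpen hU (by simp)).clm_apply A.contDiff.contDiffOn

/-- The derivation of `smoothFunctions U` along the linear vector field `x ↦ A x`. -/
noncomputable def linearField (hU : IsOpen U) (A : V →L[ℝ] V) :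
    Derivation ℝ (smoothFunctions U) (smoothFunctions U) :=
  Derivation.mk'
    { toFun := fun g => mk (fun x => fderiv ℝ (extend g) x (A x))
        (contDiffOn_fderiv_apply hU (contDiffOn_extend g) A)
      map_add' := fun g h => by
        ext x
        have := fderiv_extend hU (g + h) (f := fun x => (extend g) x + (extend h) x)
          (fun x => by simp [← extend_apply]) x.2
        change fderiv ℝ (extend (g + h)) x (A x) = _
        rw [this, fderiv_fun_add (differentiableAt_extend hU g x.2) (differentiableAt_extend hU h x.2)]
        rfl
      map_smul' := fun r g => by
        ext x
        have := fderiv_extend hU (r • g) (f := fun x => r • (extend g) x)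
          (fun x => by simp [← extend_apply]) x.2
        change fderiv ℝ (extend (r • g)) x (A x) = _
        rw [this, fderiv_fun_const_smul (differentiableAt_extend hU g x.2)]
        rfl }
    (fun g h => by
      ext x
      have := fderiv_extend hU (g * h) (f := fun x => (extend g) x * (extend h) x)
          (fun x => by simp [← extend_apply]) x.2
      change fderiv ℝ (extend (g * h)) x (A x) = _
      rw [this, fderiv_fun_mul (differentiableAt_extend hU g x.2) (differentiableAt_extend hU h x.2),
        ← extend_apply, ← extend_apply]
      rfl)

theorem linearField_apply (hU : IsOpen U) (A : V →L[ℝ] V) (g : smoothFunctions U) {f : V → ℝ} (h : ∀ x : U,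
    (g : U → ℝ) x = f x) (x : U) :
    (linearField hU A g : U → ℝ) x = fderiv ℝ f x (A x) := by
  rw [← fderiv_extend hU g h x.2]; rfl

theorem linearField_commutator (hU : IsOpen U) (A B : V →L[ℝ] V) (g : smoothFunctions U) :
    linearField hU A (linearField hU B g) - linearField hU B (linearField hU A g) =
      linearField hU (B.comp A - A.comp B) g := by
  ext x
  have hs : IsSymmSndFDerivAt ℝ (extend g) x :=
    ((contDiffOn_extend g).contDiffAt (hU.mem_nhds x.2)).isSymmSndFDerivAt (by
      simp only [minSmoothness_of_isRCLikeNormedField]; exact WithTop.coe_le_coe.2 le_top)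
  have hd : DifferentiableAt ℝ (fderiv ℝ (extend g)) x :=
    (((contDiffOn_extend g).fderiv_of_isOpen hU (m := ∞) (by simp)).contDiffAt
      (hU.mem_nhds x.2)).differentiableAt (by simp)
  have key : ∀ A B : V →L[ℝ] V, (linearField hU A (linearField hU B g) : U → ℝ) x =
      fderiv ℝ (fderiv ℝ (extend g)) x (A x) (B x) + fderiv ℝ (extend g) x (B (A x)) := by
    intro A B
    rw [linearField_apply hU A _ (f := fun x => fderiv ℝ (extend g) x (B x)) (fun _ => rfl),
      fderiv_clm_apply hd B.differentiableAt]
    simp [add_comm]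
  change (linearField hU A (linearField hU B g) : U → ℝ) x - (linearField hU B (linearField hU A g) : U → ℝ) x =
    fderiv ℝ (extend g) x (B (A x) - A (B x))
  rw [key, key, hs.eq, map_sub]
  ring

theorem continuous_coe (g : smoothFunctions U) : Continuous (g : U → ℝ) := by
  have : (g : U → ℝ) = U.domRestrict (extend g) := funext (extend_apply g)
  rw [this]
  exact (contDiffOn_extend g).continuousOn.domRestrict

theorem exists_mul_eq_one (g : smoothFunctions U) (h : ∀ x : U, (g : U → ℝ) x ≠ 0) :
    ∃ g' : smoothFunctions U, g * g' = 1 := by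
  refine ⟨mk (fun x => ((extend g) x)⁻¹) ((contDiffOn_extend g).inv fun x hx => ?_), ?_⟩
  · rw [← extend_apply g ⟨x, hx⟩]; exact h _
  · ext x
    change (g : U → ℝ) x * ((extend g) x)⁻¹ = 1
    rw [← extend_apply g]
    exact mul_inv_cancel₀ (h x)

/-- Restriction to a smaller set. -/
def res {U' : Set V} (h : U' ⊆ U) : smoothFunctions U →ₐ[ℝ] smoothFunctions U' where
  toFun g := ⟨fun x => (g : U → ℝ) ⟨x, h x.2⟩, g.2.imp fun _ hf =>
    ⟨hf.1.mono h, fun x => hf.2 ⟨x, h x.2⟩⟩⟩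
  map_one' := rfl
  map_mul' _ _ := rfl
  map_zero' := rfl
  map_add' _ _ := rfl
  commutes' _ := rfl

theorem res_apply {U' : Set V} (h : U' ⊆ U) (g : smoothFunctions U) (x : U') :
    (res h g : U' → ℝ) x = (g : U → ℝ) ⟨x, h x.2⟩ := rfl

theorem res_mk {U' : Set V} (h : U' ⊆ U) (f : V → ℝ) (hf : ContDiffOn ℝ ∞ f U) :
    res h (mk f hf) = mk f (hf.mono h) := rfl

theorem linearField_res {U' : Set V} (h : U' ⊆ U) (hU : IsOpen U) (hU' : IsOpen U')
    (A : V →L[ℝ] V) (g : smoothFunctions U) :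
    linearField hU' A (res h g) = res h (linearField hU A g) := by
  ext x
  rw [linearField_apply hU' A _ (f := extend g) (fun x => extend_apply g ⟨x, h x.2⟩)]
  rfl

theorem isOpen_ne_zero (hU : IsOpen U) (g : smoothFunctions U) :
    IsOpen {x | ∃ hx : x ∈ U, (g : U → ℝ) ⟨x, hx⟩ ≠ 0} := by
  have : {x | ∃ hx : x ∈ U, (g : U → ℝ) ⟨x, hx⟩ ≠ 0} = (↑) '' ((g : U → ℝ) ⁻¹' {0}ᶜ) := by
    ext x; simp only [ne_eq, Set.mem_ofPred_eq, Set.mem_image, Set.mem_preimage,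
      Set.mem_compl_iff, Set.mem_singleton_iff, Subtype.exists, exists_and_right, exists_eq_right]
  rw [this]
  exact hU.isOpenMap_subtype_val _ (isOpen_compl_singleton.preimage (continuous_coe g))

end smoothFunctions

/-! ### Unit fields of metric foliations on an open set -/

/-- The field `t₁ E₁ + t₂ E₂ + t₃ E₃` is smooth and of unit length on `U`,
    for the metric that makes the frame of linear
vector fields `E₁`, `E₂`, `E₃` orthonormal, and it satisfies the metric equation of `UnitMetricField` on `U`. -/
structure IsUnitMetricOn (E₁ E₂ E₃ : V →L[ℝ] V) (ν : ℝ) (t₁ t₂ t₃ : V → ℝ) (U : Set V) : Prop where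
  contDiffOn₁ : ContDiffOn ℝ ∞ t₁ U
  contDiffOn₂ : ContDiffOn ℝ ∞ t₂ U
  contDiffOn₃ : ContDiffOn ℝ ∞ t₃ U
  unit : ∀ x ∈ U, t₁ x ^ 2 + t₂ x ^ 2 + t₃ x ^ 2 = 1
  metric : ∀ x ∈ U, ∀ x₁ x₂ x₃ y₁ y₂ y₃ : ℝ, x₁ * t₁ x + x₂ * t₂ x + x₃ * t₃ x = 0 →
    y₁ * t₁ x + y₂ * t₂ x + y₃ * t₃ x = 0 →
    2 * fderiv ℝ t₁ x (E₁ x) * x₁ * y₁ + 2 * fderiv ℝ t₂ x (E₂ x) * x₂ * y₂ +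
      2 * fderiv ℝ t₃ x (E₃ x) * x₃ * y₃ +
    (fderiv ℝ t₂ x (E₁ x) + fderiv ℝ t₁ x (E₂ x) - (ν - 2) * t₃ x) * (x₁ * y₂ + x₂ * y₁) +
    (fderiv ℝ t₃ x (E₁ x) + fderiv ℝ t₁ x (E₃ x) + (ν - 2) * t₂ x) * (x₁ * y₃ + x₃ * y₁) +
    (fderiv ℝ t₃ x (E₂ x) + fderiv ℝ t₂ x (E₃ x)) * (x₂ * y₃ + x₃ * y₂) = 0

/-- The commutators of the linear maps `E₁`, `E₂`, `E₃`; as brackets of vector fields they are `[E₂, E₃] = 2 E₁`,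
`[E₁, E₂] = ν E₃`, `[E₃, E₁] = ν E₂`. -/
structure IsBergerFrame (E₁ E₂ E₃ : V →L[ℝ] V) (ν : ℝ) : Prop where
  E₂_E₃ : E₃.comp E₂ - E₂.comp E₃ = (2 : ℝ) • E₁
  E₁_E₂ : E₂.comp E₁ - E₁.comp E₂ = ν • E₃
  E₃_E₁ : E₁.comp E₃ - E₃.comp E₁ = ν • E₂

namespace IsUnitMetricOn

variable {E₁ E₂ E₃ : V →L[ℝ] V} {ν : ℝ} {t₁ t₂ t₃ : V → ℝ}

theorem mono (h : IsUnitMetricOn E₁ E₂ E₃ ν t₁ t₂ t₃ U) {U' : Set V} (hU' : U' ⊆ U) :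
    IsUnitMetricOn E₁ E₂ E₃ ν t₁ t₂ t₃ U' where
  contDiffOn₁ := h.contDiffOn₁.mono hU'
  contDiffOn₂ := h.contDiffOn₂.mono hU'
  contDiffOn₃ := h.contDiffOn₃.mono hU'
  unit x hx := h.unit x (hU' hx)
  metric x hx := h.metric x (hU' hx)

open smoothFunctions in
theorem linearField_smul (hU : IsOpen U) (r : ℝ) (A : V →L[ℝ] V) (g : smoothFunctions U) :
    linearField hU (r • A) g = algebraMap ℝ (smoothFunctions U) r * linearField hU A g := by
  ext x
  change fderiv ℝ (extend g) x (r • A x) = r * fderiv ℝ (extend g) x (A x)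
  simp

open smoothFunctions in
/-- The unit field on `U`, over the ring of smooth functions on `U`. -/
noncomputable def toField (h : IsUnitMetricOn E₁ E₂ E₃ ν t₁ t₂ t₃ U) (hU : IsOpen U)
    (hE : IsBergerFrame E₁ E₂ E₃ ν) : UnitMetricField (smoothFunctions U) (algebraMap ℝ (smoothFunctions U) ν) where
  E₁ := linearField hU E₁
  E₂ := linearField hU E₂
  E₃ := linearField hU E₃
  E₁_ν := Derivation.map_algebraMap _ _
  E₂_ν := Derivation.map_algebraMap _ _
  E₃_ν := Derivation.map_algebraMap _ _
  E₂_E₃ f := by rw [linearField_commutator, hE.E₂_E₃, linearField_smul, map_ofNat]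
  E₁_E₂ f := by rw [linearField_commutator, hE.E₁_E₂, linearField_smul]
  E₃_E₁ f := by rw [linearField_commutator, hE.E₃_E₁, linearField_smul]
  t₁ := smoothFunctions.mk t₁ h.contDiffOn₁
  t₂ := smoothFunctions.mk t₂ h.contDiffOn₂
  t₃ := smoothFunctions.mk t₃ h.contDiffOn₃
  unit := by ext x; exact h.unit x x.2
  metric x₁ x₂ x₃ y₁ y₂ y₃ hx hy := by
    ext x
    have h1 := h.metric x x.2 (x₁.1 x) (x₂.1 x) (x₃.1 x) (y₁.1 x) (y₂.1 x) (y₃.1 x)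
      (congrFun (congrArg Subtype.val hx) x) (congrFun (congrArg Subtype.val hy) x)
    have e := fun (A : V →L[ℝ] V) (f : V → ℝ) (hf : ContDiffOn ℝ ∞ f U) =>
      linearField_apply hU A (smoothFunctions.mk f hf) (fun _ => rfl) x
    simp only [← e _ _ h.contDiffOn₁, ← e _ _ h.contDiffOn₂, ← e _ _ h.contDiffOn₃] at h1
    exact h1

theorem contDiffOn_sqrt (h : IsUnitMetricOn E₁ E₂ E₃ ν t₁ t₂ t₃ U) (hreg : ∀ x ∈ U, t₁ x ^ 2 < 1) :
    ContDiffOn ℝ ∞ (fun x => √(1 - t₁ x ^ 2)) U :=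
  (contDiffOn_const.sub (h.contDiffOn₁.pow 2)).sqrt fun x hx => by
    have := hreg x hx
    linarith

/-- The adapted frame of a unit field that is nowhere vertical. -/
noncomputable def frame (h : IsUnitMetricOn E₁ E₂ E₃ ν t₁ t₂ t₃ U) (hU : IsOpen U)
    (hE : IsBergerFrame E₁ E₂ E₃ ν) (hreg : ∀ x ∈ U, t₁ x ^ 2 < 1) :
    AdaptedFrame (smoothFunctions U) (2 * algebraMap ℝ (smoothFunctions U) ν - 4) :=
  (h.toField hU hE).adaptedFrame (S := smoothFunctions.mk _ (h.contDiffOn_sqrt hreg))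
    (S' := smoothFunctions.mk (fun x => (√(1 - t₁ x ^ 2))⁻¹) ((h.contDiffOn_sqrt hreg).inv fun x hx =>
      (Real.sqrt_pos.2 (by have := hreg x hx; linarith)).ne'))
    (by
      ext x
      change √(1 - t₁ x ^ 2) ^ 2 + t₁ x ^ 2 = 1
      rw [Real.sq_sqrt (by have := hreg x x.2; linarith)]
      ring)
    (by
      ext x
      change √(1 - t₁ x ^ 2) * (√(1 - t₁ x ^ 2))⁻¹ = 1
      exact mul_inv_cancel₀ (Real.sqrt_pos.2 (by have := hreg x x.2; linarith)).ne')

open smoothFunctions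

theorem frame_mono (h : IsUnitMetricOn E₁ E₂ E₃ ν t₁ t₂ t₃ U) (hU : IsOpen U)
    (hE : IsBergerFrame E₁ E₂ E₃ ν) (hreg : ∀ x ∈ U, t₁ x ^ 2 < 1) {U' : Set V} (hU' : IsOpen U')
    (hUU' : U' ⊆ U) :
    ((h.mono hUU').frame hU' hE (fun x hx => hreg x (hUU' hx))).k = res hUU' (h.frame hU hE hreg).k ∧
    ((h.mono hUU').frame hU' hE (fun x hx => hreg x (hUU' hx))).a = res hUU' (h.frame hU hE hreg).a ∧
    ((h.mono hUU').frame hU' hE (fun x hx => hreg x (hUU' hx))).l = res hUU' (h.frame hU hE hreg).l ∧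
    ((h.mono hUU').frame hU' hE (fun x hx => hreg x (hUU' hx))).C = res hUU' (h.frame hU hE hreg).C ∧
    ((h.mono hUU').frame hU' hE (fun x hx => hreg x (hUU' hx))).S' = res hUU' (h.frame hU hE hreg).S' ∧
    ((h.mono hUU').frame hU' hE (fun x hx => hreg x (hUU' hx))).S = res hUU' (h.frame hU hE hreg).S := by
  refine ⟨?_, ?_, ?_, rfl, rfl, rfl⟩ <;>
  simp only [frame, UnitMetricField.adaptedFrame, UnitMetricField.along_apply, toField, map_mul,
    map_add, map_sub, map_neg, map_one, map_zero, ← linearField_res hUU' hU hU', res_mk, AlgHom.commutes, map_ofNat]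

theorem hopfPart_mono (h : IsUnitMetricOn E₁ E₂ E₃ ν t₁ t₂ t₃ U) (hU : IsOpen U)
    (hE : IsBergerFrame E₁ E₂ E₃ ν) {U' : Set V} (hU' : IsOpen U') (hUU' : U' ⊆ U) :
    ((h.mono hUU').toField hU' hE).hopfPart = res hUU' (h.toField hU hE).hopfPart := by
  simp only [UnitMetricField.hopfPart, UnitMetricField.along_apply, toField, map_mul, map_pow,
    map_add, map_sub, map_one, ← linearField_res hUU' hU hU', res_mk, AlgHom.commutes, map_ofNat]

end IsUnitMetricOn

end

/-! ### From the metric equation to the Killing equations -/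

section

variable {V : Type*} [NormedAddCommGroup V] [NormedSpace ℝ V] {U : Set V}

namespace IsUnitMetricOn
open smoothFunctions
variable {E₁ E₂ E₃ : V →L[ℝ] V} {ν : ℝ} {t₁ t₂ t₃ : V → ℝ}

theorem exists_const_inv (hν : ν ≠ 2) : ∃ c' : smoothFunctions U,
    (2 * algebraMap ℝ (smoothFunctions U) ν - 4) * c' = 1 := by
  refine ⟨algebraMap ℝ _ (2 * ν - 4)⁻¹, ?_⟩
  have : (2 * algebraMap ℝ (smoothFunctions U) ν - 4) = algebraMap ℝ _ (2 * ν - 4) := by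
    simp only [map_sub, map_mul, map_ofNat]
  rw [this, ← map_mul, mul_inv_cancel₀ (fun h => hν (by linarith)), map_one]

/-- The leaves make a constant angle with the Hopf fibres: otherwise there is a nonempty open set on which `k`, `C`
and `a` are invertible, and `c_mul_C_sq_eq_zero` applies. This is where a metric other than the round one is needed. -/
theorem frame_k_eq_zero (h : IsUnitMetricOn E₁ E₂ E₃ ν t₁ t₂ t₃ U) (hU : IsOpen U)
    (hE : IsBergerFrame E₁ E₂ E₃ ν) (hreg : ∀ x ∈ U, t₁ x ^ 2 < 1) (hν : ν ≠ 2) :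
    (h.frame hU hE hreg).k = 0 := by
  by_contra hk
  obtain ⟨x₀, hx₀⟩ : ∃ x, ((h.frame hU hE hreg).k : U → ℝ) x ≠ 0 := by
    by_contra! hc
    exact hk (by ext x; exact hc x)
  set U₁ := {x | ∃ hx : x ∈ U, ((h.frame hU hE hreg).k : U → ℝ) ⟨x, hx⟩ ≠ 0} with hU₁def
  have hU₁ : IsOpen U₁ := isOpen_ne_zero hU _
  have hU₁U : U₁ ⊆ U := fun x hx => hx.1
  set A₁ := (h.mono hU₁U).frame hU₁ hE (fun x hx => hreg x (hU₁U hx)) with hA₁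
  have hk₁ : A₁.k = res hU₁U (h.frame hU hE hreg).k := (h.frame_mono hU hE hreg hU₁ hU₁U).1
  obtain ⟨x₁, hx₁⟩ : ∃ x, (A₁.C : U₁ → ℝ) x ≠ 0 := by
    by_contra! hc
    have hC : A₁.C = 0 := by ext x; exact hc x
    have h1 := A₁.T_C
    rw [hC, map_zero] at h1
    have : A₁.k = 0 := A₁.S_cancel (by rw [mul_zero, ← h1])
    rw [hk₁] at this
    exact hx₀ (congrFun (congrArg Subtype.val this) ⟨x₀.1, x₀.2, hx₀⟩)
  set U₂ := {x | ∃ hx : x ∈ U₁, (A₁.C : U₁ → ℝ) ⟨x, hx⟩ ≠ 0} with hU₂def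
  have hU₂ : IsOpen U₂ := isOpen_ne_zero hU₁ _
  have hU₂U : U₂ ⊆ U₁ := fun x hx => hx.1
  set A₂ := (h.mono (hU₂U.trans hU₁U)).frame hU₂ hE (fun x hx => hreg x (hU₁U (hU₂U hx))) with hA₂
  have hm₂ := (h.mono hU₁U).frame_mono hU₁ hE (fun x hx => hreg x (hU₁U hx)) hU₂ hU₂U
  obtain ⟨c₂, hc₂⟩ := exists_const_inv (U := U₂) hν
  obtain ⟨k₂, hk₂⟩ := exists_mul_eq_one A₂.k (fun x => by
    rw [hm₂.1, res_apply, ← hA₁, hk₁, res_apply]; exact x.2.1.2)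
  obtain ⟨C₂, hC₂⟩ := exists_mul_eq_one A₂.C (fun x => by
    rw [hm₂.2.2.2.1, res_apply]; exact x.2.2)
  obtain ⟨x₂, hx₂⟩ : ∃ x, (A₂.a : U₂ → ℝ) x ≠ 0 := by
    by_contra! hc
    have ha : A₂.a = 0 := by ext x; exact hc x
    have h1 := A₂.three_a_T_a
    rw [ha, map_zero, mul_zero, mul_zero] at h1
    have : (1 : smoothFunctions U₂) = 0 := by
      calc (1 : smoothFunctions U₂) = (_ * c₂) * (A₂.k * k₂) * (A₂.S * A₂.S') * (A₂.C * C₂) := by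
            rw [hc₂, hk₂, A₂.inv, hC₂]; ring
        _ = 0 := by linear_combination c₂ * k₂ * A₂.S' * C₂ * h1
    exact one_ne_zero (congrFun (congrArg Subtype.val this) ⟨x₁.1, x₁.2, hx₁⟩ : (1 : ℝ) = 0)
  set U₃ := {x | ∃ hx : x ∈ U₂, (A₂.a : U₂ → ℝ) ⟨x, hx⟩ ≠ 0} with hU₃def
  have hU₃ : IsOpen U₃ := isOpen_ne_zero hU₂ _
  have hU₃U : U₃ ⊆ U₂ := fun x hx => hx.1
  set A₃ := (h.mono (hU₃U.trans (hU₂U.trans hU₁U))).frame hU₃ hE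
    (fun x hx => hreg x (hU₁U (hU₂U (hU₃U hx)))) with hA₃
  have hm₃ := (h.mono (hU₂U.trans hU₁U)).frame_mono hU₂ hE
    (fun x hx => hreg x (hU₁U (hU₂U hx))) hU₃ hU₃U
  obtain ⟨c₃, hc₃⟩ := exists_const_inv (U := U₃) hν
  obtain ⟨k₃, hk₃⟩ := exists_mul_eq_one A₃.k (fun x => by
    rw [hm₃.1, res_apply, hm₂.1, res_apply, ← hA₁, hk₁, res_apply]; exact x.2.1.1.2)
  obtain ⟨C₃, hC₃⟩ := exists_mul_eq_one A₃.C (fun x => by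
    rw [hm₃.2.2.2.1, res_apply, hm₂.2.2.2.1, res_apply]; exact x.2.1.2)
  obtain ⟨a₃, ha₃⟩ := exists_mul_eq_one A₃.a (fun x => by
    rw [hm₃.2.1, res_apply]; exact x.2.2)
  have hcC := A₃.c_mul_C_sq_eq_zero ha₃ hk₃ (by
    have h1 := A₃.algebraic_relation
    set Q := 60 * A₃.a ^ 3 - 60 * A₃.a ^ 2 - 48 * A₃.a
      + 30 * A₃.a * (2 * A₃.a + 1) * (A₃.l * A₃.C * A₃.S') + 60 * A₃.a * A₃.k ^ 2
      + (2 * algebraMap ℝ (smoothFunctions U₃) ν - 4) * A₃.C ^ 2 * (8 * A₃.a + 5)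
    calc Q = ((2 * algebraMap ℝ (smoothFunctions U₃) ν - 4) * c₃) * (A₃.k * k₃) * (A₃.C * C₃) * Q := by
            rw [hc₃, hk₃, hC₃]; ring
        _ = 0 := by linear_combination c₃ * k₃ * C₃ * h1)
  have : (1 : smoothFunctions U₃) = 0 := by
    calc (1 : smoothFunctions U₃) = (_ * c₃) * (A₃.C * C₃) ^ 2 := by
            rw [hc₃, hC₃]; ring
        _ = 0 := by linear_combination c₃ * C₃ ^ 2 * hcC
  exact one_ne_zero (congrFun (congrArg Subtype.val this) ⟨x₂.1, x₂.2, hx₂⟩ : (1 : ℝ) = 0)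

theorem frame_psi_eq_zero (h : IsUnitMetricOn E₁ E₂ E₃ ν t₁ t₂ t₃ U) (hU : IsOpen U)
    (hE : IsBergerFrame E₁ E₂ E₃ ν) (hreg : ∀ x ∈ U, t₁ x ^ 2 < 1) (hν : ν ≠ 2) (hν0 : 0 < ν) :
    1 - (h.frame hU hE hreg).l * (h.frame hU hE hreg).C * (h.frame hU hE hreg).S' -
      (h.frame hU hE hreg).a = 0 := by
  by_contra hψ
  set A := h.frame hU hE hreg with hA
  obtain ⟨x₀, hx₀⟩ : ∃ x, ((1 - A.l * A.C * A.S' - A.a : smoothFunctions U) : U → ℝ) x ≠ 0 := by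
    by_contra! hc
    exact hψ (by ext x; exact hc x)
  set U₁ := {x | ∃ hx : x ∈ U, ((1 - A.l * A.C * A.S' - A.a : smoothFunctions U) : U → ℝ) ⟨x, hx⟩ ≠ 0} with hU₁def
  have hU₁ : IsOpen U₁ := isOpen_ne_zero hU _
  have hU₁U : U₁ ⊆ U := fun x hx => hx.1
  obtain ⟨-, hm₂, hm₃, hm₄, hm₅, -⟩ := h.frame_mono hU hE hreg hU₁ hU₁U
  have hk := (h.mono hU₁U).frame_k_eq_zero hU₁ hE (fun x hx => hreg x (hU₁U hx)) hν
  set A₁ := (h.mono hU₁U).frame hU₁ hE (fun x hx => hreg x (hU₁U hx)) with hA₁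
  obtain ⟨ψ', hψ'⟩ := exists_mul_eq_one (1 - A₁.l * A₁.C * A₁.S' - A₁.a) (fun x => by
    rw [hm₂, hm₃, hm₄, hm₅]; exact x.2.2)
  have h1 := congrFun (congrArg Subtype.val (A₁.c_mul_eq_zero hk hψ')) ⟨x₀.1, x₀.2, hx₀⟩
  have h2 : (2 * ν - 4) * ((2 * ν - 4) * t₁ x₀.1 ^ 2 + 4) = 0 := h1
  have h3 := hreg x₀.1 x₀.2
  rcases mul_eq_zero.1 h2 with h4 | h4
  · exact hν (by linarith)
  · nlinarith [sq_nonneg (t₁ x₀.1)]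

end IsUnitMetricOn

namespace UnitMetricField
variable {R : Type*} [CommRing R] [Algebra ℝ R] {ν : R} (B : UnitMetricField R ν)

/-- A unit field tangent to the Hopf fibres is a Killing field. -/
theorem isKillingDirection_of_vertical (h₁ : B.t₁ ^ 2 = 1) (h₂ : B.t₂ = 0) (h₃ : B.t₃ = 0) :
    B.IsKillingDirection B.hopfPart := by
  have d : ∀ D : Derivation ℝ R R, D B.t₁ = 0 := fun D => by
    have h := congrArg D h₁
    simp only [Derivation.leibniz_pow, Derivation.map_one_eq_zero, smul_eq_mul, nsmul_eq_mul] at h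
    norm_num at h
    apply AdaptedFrame.two_mul_cancel
    linear_combination B.t₁ * h - 2 * D B.t₁ * h₁
  have h2' : algebraMap ℝ R (1/2) * 2 = 1 := by
    rw [← map_ofNat (algebraMap ℝ R) 2, ← map_mul]; norm_num
  have hN : B.hopfPart = ν * B.t₁ := by
    rw [hopfPart, h₂, h₃]
    simp only [map_zero]
    linear_combination B.t₁ * (algebraMap ℝ R (1/2) * ((ν - 2) * h₁) + ν * h2')
  have e₁ := B.E₁_ν
  have e₂ := B.E₂_ν
  have e₃ := B.E₃_ν
  constructor <;> simp [h₂, h₃, hN, d, e₁, e₂, e₃]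

end UnitMetricField

namespace IsUnitMetricOn
open smoothFunctions
variable {E₁ E₂ E₃ : V →L[ℝ] V} {ν : ℝ} {t₁ t₂ t₃ : V → ℝ}

/-- The Killing equations hold on the open set where the field is not tangent to the Hopf fibres, and on the interior
of its complement. The union of these two sets is dense, hence the equations hold everywhere. -/
theorem isKillingDirection (h : IsUnitMetricOn E₁ E₂ E₃ ν t₁ t₂ t₃ U) (hU : IsOpen U)
    (hE : IsBergerFrame E₁ E₂ E₃ ν) (hν : ν ≠ 2) (hν0 : 0 < ν) :
    (h.toField hU hE).IsKillingDirection (h.toField hU hE).hopfPart := by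
  set G₁ := {x ∈ U | t₁ x ^ 2 < 1} with hG₁
  set G₂ := interior {x ∈ U | t₁ x ^ 2 = 1} with hG₂
  have hG₁U : G₁ ⊆ U := fun x hx => hx.1
  have hG₂U : G₂ ⊆ U := fun x hx => (interior_subset hx).1
  have hle : ∀ x ∈ U, t₁ x ^ 2 ≤ 1 := fun x hx => by
    have := h.unit x hx
    nlinarith [sq_nonneg (t₂ x), sq_nonneg (t₃ x)]
  have hG₁o : IsOpen G₁ := by
    have := (h.contDiffOn₁.continuousOn.pow 2).isOpen_inter_preimage hU (isOpen_Iio (a := (1 : ℝ)))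
    exact this
  have K₁ : ((h.mono hG₁U).toField hG₁o hE).IsKillingDirection ((h.mono hG₁U).toField hG₁o hE).hopfPart :=
    UnitMetricField.isKillingDirection_of_adapted _ _ _ (A := (h.mono hG₁U).frame hG₁o hE (fun x hx => hx.2))
      rfl (frame_k_eq_zero _ _ _ _ hν) (frame_psi_eq_zero _ _ _ _ hν hν0)
  have K₂ : ((h.mono hG₂U).toField isOpen_interior hE).IsKillingDirection
      ((h.mono hG₂U).toField isOpen_interior hE).hopfPart := by
    have h1 : ∀ x : G₂, t₁ x ^ 2 = 1 := fun x => (interior_subset x.2).2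
    apply UnitMetricField.isKillingDirection_of_vertical
    · ext x; exact h1 x
    · ext x
      have := h.unit x (hG₂U x.2)
      change t₂ x = 0
      nlinarith [h1 x, sq_nonneg (t₂ x), sq_nonneg (t₃ x)]
    · ext x
      have := h.unit x (hG₂U x.2)
      change t₃ x = 0
      nlinarith [h1 x, sq_nonneg (t₂ x), sq_nonneg (t₃ x)]
  have ext' : ∀ f g : smoothFunctions U, res hG₁U f = res hG₁U g → res hG₂U f = res hG₂U g → f = g := by
    intro f g h1 h2
    by_contra hne
    obtain ⟨x₀, hx₀⟩ : ∃ x, ((f - g : smoothFunctions U) : U → ℝ) x ≠ 0 := by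
      by_contra! hc
      exact hne (sub_eq_zero.1 (by ext x; exact hc x))
    have hW := isOpen_ne_zero hU (f - g)
    refine absurd (?_ : (x₀ : V) ∈ G₂) fun hx => hx₀ ?_
    · refine mem_interior.2 ⟨_, fun x hx => ⟨hx.1, ?_⟩, hW, ⟨x₀.2, hx₀⟩⟩
      by_contra hlt
      have hx1 : x ∈ G₁ := ⟨hx.1, lt_of_le_of_ne (hle x hx.1) hlt⟩
      exact hx.2 (sub_eq_zero.2 (congrFun (congrArg Subtype.val h1) ⟨x, hx1⟩))
    · exact sub_eq_zero.2 (congrFun (congrArg Subtype.val h2) ⟨x₀, hx⟩)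
  have e₁ := h.hopfPart_mono hU hE hG₁o hG₁U
  have e₂ := h.hopfPart_mono hU hE isOpen_interior hG₂U
  rw [e₁] at K₁
  rw [e₂] at K₂
  have r₁ := fun A g => linearField_res hG₁U hU hG₁o A g
  have r₂ := fun A g => linearField_res hG₂U hU isOpen_interior A g
  constructor <;> apply ext' <;>
  simp only [toField, map_mul, map_add, map_sub, map_neg, map_zero, AlgHom.commutes, map_ofNat,
    ← r₁, ← r₂]
  exacts [K₁.1, K₂.1, K₁.2, K₂.2, K₁.3, K₂.3, K₁.4, K₂.4, K₁.5, K₂.5, K₁.6, K₂.6, K₁.7, K₂.7, K₁.8, K₂.8,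
    K₁.9, K₂.9, K₁.10, K₂.10, K₁.11, K₂.11, K₁.12, K₂.12]

end IsUnitMetricOn

end

/-! ### Killing fields in linear coordinates -/

namespace UnitMetricField
variable {R : Type*} [CommRing R] [Algebra ℝ R] {ν δ : R}

/-- If the unit field is invariant under `D`, which commutes with the frame, then so is its Hopf part. -/
theorem radial_hopfPart (B : UnitMetricField R ν) (D : Derivation ℝ R R) (hν : D ν = 0) (h₁ : D B.t₁ = 0)
    (h₂ : D B.t₂ = 0)
    (h₃ : D B.t₃ = 0) (c₁ : ∀ f, D (B.E₁ f) = B.E₁ (D f)) (c₂ : ∀ f, D (B.E₂ f) = B.E₂ (D f))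
    (c₃ : ∀ f, D (B.E₃ f) = B.E₃ (D f)) : D B.hopfPart = 0 := by
  simp [hopfPart, along_apply, hν, h₁, h₂, h₃, c₁, c₂, c₃, ← Nat.cast_ofNat (R := R), -Nat.cast_ofNat]

/-- Functions that are differentiated by the frame as the coordinates of `(z₀ + i z₁, w₀ + i w₁) ∈ ℂ²` are by the
fields `δ² i x`, `δ J x`, `δ J (i x)`, with `J (z, w) = (-w̄, z̄)`. -/
structure Coordinates (B : UnitMetricField R ν) (δ : R) where
  ν_eq : ν = 2 * δ ^ 2
  z₀ : R
  z₁ : R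
  w₀ : R
  w₁ : R
  E₁_z₀ : B.E₁ z₀ = - δ ^ 2 * z₁
  E₁_z₁ : B.E₁ z₁ = δ ^ 2 * z₀
  E₁_w₀ : B.E₁ w₀ = - δ ^ 2 * w₁
  E₁_w₁ : B.E₁ w₁ = δ ^ 2 * w₀
  E₂_z₀ : B.E₂ z₀ = - δ * w₀
  E₂_z₁ : B.E₂ z₁ = δ * w₁
  E₂_w₀ : B.E₂ w₀ = δ * z₀
  E₂_w₁ : B.E₂ w₁ = - δ * z₁
  E₃_z₀ : B.E₃ z₀ = δ * w₁
  E₃_z₁ : B.E₃ z₁ = δ * w₀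
  E₃_w₀ : B.E₃ w₀ = - δ * z₁
  E₃_w₁ : B.E₃ w₁ = - δ * z₀

namespace Coordinates
variable {B : UnitMetricField R ν} (Z : B.Coordinates δ)

/-- The square of the norm of `(z₀ + i z₁, w₀ + i w₁)`. -/
noncomputable def normSq : R := Z.z₀ ^ 2 + Z.z₁ ^ 2 + Z.w₀ ^ 2 + Z.w₁ ^ 2
/-- The derivative along `E₂` of the third coefficient of the Killing field, up to the normalization. -/
noncomputable def alpha (_ : B.Coordinates δ) : R := ν * B.t₁ - B.hopfPart
/-- The entry `p` of the skew-Hermitian matrix `[[i(p + r), s₀ + i s₁], [-s₀ + i s₁,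
    i(p - r)]]` that maps the point with
coordinates `z₀`, `z₁`, `w₀`, `w₁` to `2 normSq` times the unit field. The trace of the matrix is `2 i p`; the
entries `r`, `s₀`, `s₁` are `killR`, `killS₀`, `killS₁`. The matrix varies with the point; that its entries are
proportional to constants is the content of `kill_deriv`. -/
noncomputable def killP : R := Z.normSq * B.hopfPart
/-- The entry `r` of the matrix described at `killP`. -/
noncomputable def killR : R := Z.alpha * (Z.z₀ ^ 2 + Z.z₁ ^ 2 - Z.w₀ ^ 2 - Z.w₁ ^ 2)
  + 4 * δ * (B.t₂ * (Z.w₀ * Z.z₁ + Z.w₁ * Z.z₀) + B.t₃ * (Z.w₀ * Z.z₀ - Z.w₁ * Z.z₁))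
/-- The entry `s₀` of the matrix described at `killP`. -/
noncomputable def killS₀ : R := -2 * Z.alpha * (Z.z₁ * Z.w₀ - Z.z₀ * Z.w₁)
  - 2 * δ * (B.t₂ * (Z.w₀ ^ 2 - Z.w₁ ^ 2) - 2 * B.t₃ * Z.w₀ * Z.w₁ + B.t₂ * (Z.z₀ ^ 2 - Z.z₁ ^ 2)
    - 2 * B.t₃ * Z.z₀ * Z.z₁)
/-- The entry `s₁` of the matrix described at `killP`. -/
noncomputable def killS₁ : R := 2 * Z.alpha * (Z.z₀ * Z.w₀ + Z.z₁ * Z.w₁)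
  - 2 * δ * (-2 * B.t₂ * Z.w₀ * Z.w₁ - B.t₃ * (Z.w₀ ^ 2 - Z.w₁ ^ 2) + 2 * B.t₂ * Z.z₀ * Z.z₁
    + B.t₃ * (Z.z₀ ^ 2 - Z.z₁ ^ 2))

theorem kill_field_z₀ : -(Z.killP + Z.killR) * Z.z₁ + (Z.killS₀ * Z.w₀ - Z.killS₁ * Z.w₁) = 2 * Z.normSq *
    (B.t₁ * (- δ ^ 2 * Z.z₁) + B.t₂ * (- δ * Z.w₀) + B.t₃ * (δ * Z.w₁)) := by
  have hν := Z.ν_eq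
  subst hν
  simp only [killP, killR, killS₀, killS₁, alpha, normSq]; ring
theorem kill_field_z₁ : (Z.killP + Z.killR) * Z.z₀ + (Z.killS₀ * Z.w₁ + Z.killS₁ * Z.w₀) = 2 * Z.normSq *
    (B.t₁ * (δ ^ 2 * Z.z₀) + B.t₂ * (δ * Z.w₁) + B.t₃ * (δ * Z.w₀)) := by
  have hν := Z.ν_eq
  subst hν
  simp only [killP, killR, killS₀, killS₁, alpha, normSq]; ring
theorem kill_field_w₀ : -(Z.killP - Z.killR) * Z.w₁ - (Z.killS₀ * Z.z₀ + Z.killS₁ * Z.z₁) = 2 * Z.normSq *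
    (B.t₁ * (- δ ^ 2 * Z.w₁) + B.t₂ * (δ * Z.z₀) + B.t₃ * (- δ * Z.z₁)) := by
  have hν := Z.ν_eq
  subst hν
  simp only [killP, killR, killS₀, killS₁, alpha, normSq]; ring
theorem kill_field_w₁ : (Z.killP - Z.killR) * Z.w₀ - (Z.killS₀ * Z.z₁ - Z.killS₁ * Z.z₀) = 2 * Z.normSq *
    (B.t₁ * (δ ^ 2 * Z.w₀) + B.t₂ * (- δ * Z.z₁) + B.t₃ * (- δ * Z.z₀)) := by
  have hν := Z.ν_eq
  subst hν
  simp only [killP, killR, killS₀, killS₁, alpha, normSq]; ring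

/-- All entries of the matrix have the same logarithmic derivatives along the frame. -/
theorem kill_deriv (hδ : B.E₁ δ = 0 ∧ B.E₂ δ = 0 ∧ B.E₃ δ = 0) (K : B.IsKillingDirection B.hopfPart) :
    ∀ q, q = Z.killP ∨ q = Z.killR ∨ q = Z.killS₀ ∨ q = Z.killS₁ →
      B.E₁ q = 0 * q ∧
      B.E₂ q = - (-2 * B.t₃ * B.t₁ + (2 * δ ^ 2 * B.t₁ - B.hopfPart) * B.t₃) * q ∧
      B.E₃ q = - (2 * B.t₂ * B.t₁ - (2 * δ ^ 2 * B.t₁ - B.hopfPart) * B.t₂) * q := by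
  have hν := Z.ν_eq
  subst hν
  obtain ⟨d1, d2, d3⟩ := hδ
  have h2 : ∀ D : Derivation ℝ R R, D (2 : R) = 0 := fun D => by
    simp only [← Nat.cast_ofNat (R := R), Derivation.map_natCast]
  have h4 : ∀ D : Derivation ℝ R R, D (4 : R) = 0 := fun D => by
    simp only [← Nat.cast_ofNat (R := R), Derivation.map_natCast]
  rintro q (rfl | rfl | rfl | rfl) <;> refine ⟨?_, ?_, ?_⟩ <;>
  simp only [killP, killR, killS₀, killS₁, alpha, normSq, map_add, map_sub, map_neg, Derivation.leibniz,
    Derivation.leibniz_pow, smul_eq_mul, nsmul_eq_mul, d1, d2, d3, h2, h4, Z.E₁_z₀, Z.E₁_z₁, Z.E₁_w₀, Z.E₁_w₁,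
        Z.E₂_z₀, Z.E₂_z₁,
    Z.E₂_w₀, Z.E₂_w₁, Z.E₃_z₀, Z.E₃_z₁, Z.E₃_w₀, Z.E₃_w₁, K.1, K.2, K.3, K.4, K.5, K.6, K.7, K.8, K.9, K.10,
        K.11, K.12] <;> push_cast <;> ring

/-- The entries of the matrix are homogeneous of degree `2`. -/
theorem kill_radial (D : Derivation ℝ R R) (hδ : D δ = 0) (h₁ : D B.t₁ = 0) (h₂ : D B.t₂ = 0)
    (h₃ : D B.t₃ = 0) (hN : D B.hopfPart = 0) (z₀ : D Z.z₀ = Z.z₀) (z₁ : D Z.z₁ = Z.z₁) (w₀ : D Z.w₀ = Z.w₀)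
    (w₁ : D Z.w₁ = Z.w₁) :
    ∀ q, q = Z.killP ∨ q = Z.killR ∨ q = Z.killS₀ ∨ q = Z.killS₁ → D q = 2 * q := by
  have hν := Z.ν_eq
  subst hν
  have h2 : D (2 : R) = 0 := by
    simp only [← Nat.cast_ofNat (R := R), Derivation.map_natCast]
  have h4 : D (4 : R) = 0 := by
    simp only [← Nat.cast_ofNat (R := R), Derivation.map_natCast]
  rintro q (rfl | rfl | rfl | rfl) <;>
  simp only [killP, killR, killS₀, killS₁, alpha, normSq, map_add, map_sub, map_neg, Derivation.leibniz,
    Derivation.leibniz_pow, smul_eq_mul, nsmul_eq_mul, hδ, h₁, h₂, h₃, hN, h2, h4, z₀, z₁, w₀,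
        w₁] <;> push_cast <;> ring

end Coordinates
end UnitMetricField

/-! ### The Berger frame and skew-Hermitian maps of `ℂ²` -/

noncomputable section

/-- Multiplication by `i`, as a real-linear map of `ℂ²`. -/
def mulI : C2 →L[ℝ] C2 := (Complex.I • (1 : C2 →L[ℂ] C2)).restrictScalars ℝ

@[simp] theorem mulI_apply (x : C2) : mulI x = Complex.I • x := rfl

/-- The quaternionic structure `(z, w) ↦ (-w̄, z̄)` of `ℂ²`. -/
def quatJ : C2 →L[ℝ] C2 := LinearMap.toContinuousLinearMap
  { toFun := fun x => !₂[-(starRingEnd ℂ (x 1)), starRingEnd ℂ (x 0)]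
    map_add' := fun x y => by ext i; fin_cases i <;> simp; ring
    map_smul' := fun r x => by ext i; fin_cases i <;> simp }

@[simp] theorem quatJ_zero (x : C2) : quatJ x 0 = -(starRingEnd ℂ (x 1)) := rfl
@[simp] theorem quatJ_one (x : C2) : quatJ x 1 = starRingEnd ℂ (x 0) := rfl

/-- The linear vector field `x ↦ δ² i x`. For `δ = 1 / √ε`, the fields `bergerE₁`, `bergerE₂`,
    `bergerE₃` restrict to a
`g_ε`-orthonormal frame of `S³`. -/
def bergerE₁ (δ : ℝ) : C2 →L[ℝ] C2 := δ ^ 2 • mulI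
/-- The linear vector field `x ↦ δ J x`, where `J` is `quatJ`. -/
def bergerE₂ (δ : ℝ) : C2 →L[ℝ] C2 := δ • quatJ
/-- The linear vector field `x ↦ δ J (i x)`, where `J` is `quatJ`. -/
def bergerE₃ (δ : ℝ) : C2 →L[ℝ] C2 := δ • quatJ.comp mulI

theorem bergerE₁_apply (δ : ℝ) (x : C2) : bergerE₁ δ x = δ ^ 2 • Complex.I • x := rfl
theorem bergerE₂_apply (δ : ℝ) (x : C2) : bergerE₂ δ x = δ • quatJ x := rfl
theorem bergerE₃_apply (δ : ℝ) (x : C2) : bergerE₃ δ x = δ • quatJ (Complex.I • x) := rfl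

theorem isBergerFrame (δ : ℝ) : IsBergerFrame (bergerE₁ δ) (bergerE₂ δ) (bergerE₃ δ) (2 * δ ^ 2) := by
  constructor <;> ext x i <;> fin_cases i <;> apply Complex.ext <;>
    simp [bergerE₁_apply, bergerE₂_apply, bergerE₃_apply, pow_two] <;> ring

/-- The skew-Hermitian matrix `[[i(p + r), s₀ + i s₁], [-s₀ + i s₁, i(p - r)]]`. -/
def skewOp (p r s₀ s₁ : ℝ) : C2 →L[ℂ] C2 := LinearMap.toContinuousLinearMap
  { toFun := fun x => !₂[Complex.I * (p + r) * x 0 + (s₀ + Complex.I * s₁) * x 1,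
      -(s₀ - Complex.I * s₁) * x 0 + Complex.I * (p - r) * x 1]
    map_add' := fun x y => by ext i; fin_cases i <;> simp <;> ring
    map_smul' := fun r x => by ext i; fin_cases i <;> simp <;> ring }

theorem skewOp_zero (p r s₀ s₁ : ℝ) (x : C2) : skewOp p r s₀ s₁ x 0 =
  Complex.I * (p + r) * x 0 + (s₀ + Complex.I * s₁) * x 1 := rfl
theorem skewOp_one (p r s₀ s₁ : ℝ) (x : C2) : skewOp p r s₀ s₁ x 1 =
  -(s₀ - Complex.I * s₁) * x 0 + Complex.I * (p - r) * x 1 := rfl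

theorem skewOp_mul (p r s₀ s₁ c : ℝ) (x : C2) :
    skewOp (p * c) (r * c) (s₀ * c) (s₁ * c) x = c • skewOp p r s₀ s₁ x := by
  ext i
  fin_cases i <;> simp [skewOp_zero, skewOp_one] <;> ring

theorem skewOp_mem_skewAdjoint (p r s₀ s₁ : ℝ) : skewOp p r s₀ s₁ ∈ skewAdjoint (C2 →L[ℂ] C2) := by
  rw [skewAdjoint.mem_iff, ContinuousLinearMap.star_eq_adjoint, eq_comm, ContinuousLinearMap.eq_adjoint_iff]
  intro x y
  simp [PiLp.inner_apply, Fin.sum_univ_two, skewOp_zero, skewOp_one]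
  ring

/-- The coordinate `x ↦ x i` of `ℂ²`, as a real-linear map. -/
def coord (i : Fin 2) : C2 →L[ℝ] ℂ := (EuclideanSpace.proj i : C2 →L[ℂ] ℂ).restrictScalars ℝ
/-- The real part of a coordinate of `ℂ²`. -/
def coordRe (i : Fin 2) : C2 →L[ℝ] ℝ := Complex.reCLM.comp (coord i)
/-- The imaginary part of a coordinate of `ℂ²`. -/
def coordIm (i : Fin 2) : C2 →L[ℝ] ℝ := Complex.imCLM.comp (coord i)
@[simp] theorem coordRe_apply (i : Fin 2) (x : C2) : coordRe i x = (x i).re := rfl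
@[simp] theorem coordIm_apply (i : Fin 2) (x : C2) : coordIm i x = (x i).im := rfl

theorem norm_sq_eq_re_im (x : C2) :
    ‖x‖ ^ 2 = (x 0).re ^ 2 + (x 0).im ^ 2 + (x 1).re ^ 2 + (x 1).im ^ 2 := by
  rw [EuclideanSpace.norm_sq_eq, Fin.sum_univ_two, ← Complex.normSq_eq_norm_sq,
    ← Complex.normSq_eq_norm_sq, Complex.normSq_apply, Complex.normSq_apply]
  ring

theorem real_inner_C2 (v w : C2) : inner ℝ v w = (v 0).re * (w 0).re + (v 0).im * (w 0).im +
    (v 1).re * (w 1).re + (v 1).im * (w 1).im := by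
  simp [PiLp.inner_apply, Fin.sum_univ_two, Complex.inner]
  ring

/-- For `x ≠ 0`, the vectors `x`, `ix`, `Jx`, `J(ix)` form an orthogonal basis of `ℂ² = ℝ⁴`. -/
theorem norm_sq_smul_eq (x v : C2) : ‖x‖ ^ 2 • v = inner ℝ x v • x + inner ℝ (Complex.I • x) v • (Complex.I • x) +
    inner ℝ (quatJ x) v • quatJ x + inner ℝ (quatJ (Complex.I • x)) v • quatJ (Complex.I • x) := by
  simp only [norm_sq_eq_re_im, real_inner_C2]
  ext i; fin_cases i <;> apply Complex.ext <;> simp [pow_two] <;> ring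

theorem clm_ext_frame {δ : ℝ} (hδ : δ ≠ 0) {x : C2} (hx : x ≠ 0) {f : C2 →L[ℝ] ℝ} (h₀ : f x = 0)
    (h₁ : f (bergerE₁ δ x) = 0) (h₂ : f (bergerE₂ δ x) = 0) (h₃ : f (bergerE₃ δ x) = 0) : f = 0 := by
  simp only [bergerE₁_apply, bergerE₂_apply, bergerE₃_apply, map_smul, smul_eq_mul, mul_eq_zero,
    pow_eq_zero_iff, ne_eq, OfNat.ofNat_ne_zero, not_false_eq_true, hδ, false_or] at h₁ h₂ h₃
  ext v
  have := congrArg f (norm_sq_smul_eq x v)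
  simp only [map_smul, map_add, h₀, h₁, h₂, h₃, smul_eq_mul] at this
  simpa [hx] using this

namespace IsUnitMetricOn
open smoothFunctions
variable {δ : ℝ} {t₁ t₂ t₃ : C2 → ℝ} {U : Set C2}

theorem linearField_mk (hU : IsOpen U) (A : C2 →L[ℝ] C2) (ℓ : C2 →L[ℝ] ℝ) :
    linearField hU A (smoothFunctions.mk ℓ ℓ.contDiff.contDiffOn) =
      smoothFunctions.mk (ℓ.comp A) (ℓ.comp A).contDiff.contDiffOn := by
  ext x
  rw [linearField_apply hU A _ (f := ℓ) (fun _ => rfl), ℓ.fderiv]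
  rfl

/-- The real coordinates of `ℂ²`, as elements of `smoothFunctions U`. -/
def coordinates (h : IsUnitMetricOn (bergerE₁ δ) (bergerE₂ δ) (bergerE₃ δ) (2 * δ ^ 2) t₁ t₂ t₃ U)
    (hU : IsOpen U) : (h.toField hU (isBergerFrame δ)).Coordinates (algebraMap ℝ _ δ) where
  ν_eq := by rw [map_mul, map_pow, map_ofNat]
  z₀ := smoothFunctions.mk _ (coordRe 0).contDiff.contDiffOn
  z₁ := smoothFunctions.mk _ (coordIm 0).contDiff.contDiffOn
  w₀ := smoothFunctions.mk _ (coordRe 1).contDiff.contDiffOn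
  w₁ := smoothFunctions.mk _ (coordIm 1).contDiff.contDiffOn
  E₁_z₀ := by
    refine (linearField_mk hU _ _).trans ?_
    ext x; simp [mk_apply, bergerE₁_apply]
  E₁_z₁ := by
    refine (linearField_mk hU _ _).trans ?_
    ext x; simp [mk_apply, bergerE₁_apply]
  E₁_w₀ := by
    refine (linearField_mk hU _ _).trans ?_
    ext x; simp [mk_apply, bergerE₁_apply]
  E₁_w₁ := by
    refine (linearField_mk hU _ _).trans ?_
    ext x; simp [mk_apply, bergerE₁_apply]
  E₂_z₀ := by
    refine (linearField_mk hU _ _).trans ?_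
    ext x; simp [mk_apply, bergerE₂_apply]
  E₂_z₁ := by
    refine (linearField_mk hU _ _).trans ?_
    ext x; simp [mk_apply, bergerE₂_apply]
  E₂_w₀ := by
    refine (linearField_mk hU _ _).trans ?_
    ext x; simp [mk_apply, bergerE₂_apply]
  E₂_w₁ := by
    refine (linearField_mk hU _ _).trans ?_
    ext x; simp [mk_apply, bergerE₂_apply]
  E₃_z₀ := by
    refine (linearField_mk hU _ _).trans ?_
    ext x; simp [mk_apply, bergerE₃_apply]
  E₃_z₁ := by
    refine (linearField_mk hU _ _).trans ?_
    ext x; simp [mk_apply, bergerE₃_apply]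
  E₃_w₀ := by
    refine (linearField_mk hU _ _).trans ?_
    ext x; simp [mk_apply, bergerE₃_apply]
  E₃_w₁ := by
    refine (linearField_mk hU _ _).trans ?_
    ext x; simp [mk_apply, bergerE₃_apply]

/-- The entries of the matrix described at `UnitMetricField.Coordinates.killP`. -/
def killCoeff (h : IsUnitMetricOn (bergerE₁ δ) (bergerE₂ δ) (bergerE₃ δ) (2 * δ ^ 2) t₁ t₂ t₃ U)
    (hU : IsOpen U) : Fin 4 → smoothFunctions U :=
  ![(h.coordinates hU).killP, (h.coordinates hU).killR, (h.coordinates hU).killS₀, (h.coordinates hU).killS₁]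

theorem skewOp_killCoeff (h : IsUnitMetricOn (bergerE₁ δ) (bergerE₂ δ) (bergerE₃ δ) (2 * δ ^ 2) t₁ t₂ t₃ U)
    (hU : IsOpen U) (x : U) :
    skewOp ((h.killCoeff hU 0).1 x) ((h.killCoeff hU 1).1 x) ((h.killCoeff hU 2).1 x) ((h.killCoeff hU 3).1 x) x =
      (2 * ‖(x : C2)‖ ^ 2) • (t₁ x • bergerE₁ δ x + t₂ x • bergerE₂ δ x + t₃ x • bergerE₃ δ x) := by
  rw [norm_sq_eq_re_im]
  have e₁ := congrFun (congrArg Subtype.val (h.coordinates hU).kill_field_z₀) x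
  have e₂ := congrFun (congrArg Subtype.val (h.coordinates hU).kill_field_z₁) x
  have e₃ := congrFun (congrArg Subtype.val (h.coordinates hU).kill_field_w₀) x
  have e₄ := congrFun (congrArg Subtype.val (h.coordinates hU).kill_field_w₁) x
  change -((h.killCoeff hU 0).1 x + (h.killCoeff hU 1).1 x) * (x.1 0).im + ((h.killCoeff hU 2).1 x * (x.1 1).re -
    (h.killCoeff hU 3).1 x * (x.1 1).im) = 2 * ((x.1 0).re ^ 2 + (x.1 0).im ^ 2 + (x.1 1).re ^ 2 + (x.1 1).im ^ 2) *
    (t₁ x * (-δ ^ 2 * (x.1 0).im) + t₂ x * (-δ * (x.1 1).re) + t₃ x * (δ * (x.1 1).im)) at e₁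
  change ((h.killCoeff hU 0).1 x + (h.killCoeff hU 1).1 x) * (x.1 0).re + ((h.killCoeff hU 2).1 x * (x.1 1).im +
    (h.killCoeff hU 3).1 x * (x.1 1).re) = 2 * ((x.1 0).re ^ 2 + (x.1 0).im ^ 2 + (x.1 1).re ^ 2 + (x.1 1).im ^ 2) *
    (t₁ x * (δ ^ 2 * (x.1 0).re) + t₂ x * (δ * (x.1 1).im) + t₃ x * (δ * (x.1 1).re)) at e₂
  change -((h.killCoeff hU 0).1 x - (h.killCoeff hU 1).1 x) * (x.1 1).im - ((h.killCoeff hU 2).1 x * (x.1 0).re +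
    (h.killCoeff hU 3).1 x * (x.1 0).im) = 2 * ((x.1 0).re ^ 2 + (x.1 0).im ^ 2 + (x.1 1).re ^ 2 + (x.1 1).im ^ 2) *
    (t₁ x * (-δ ^ 2 * (x.1 1).im) + t₂ x * (δ * (x.1 0).re) + t₃ x * (-δ * (x.1 0).im)) at e₃
  change ((h.killCoeff hU 0).1 x - (h.killCoeff hU 1).1 x) * (x.1 1).re - ((h.killCoeff hU 2).1 x * (x.1 0).im -
    (h.killCoeff hU 3).1 x * (x.1 0).re) = 2 * ((x.1 0).re ^ 2 + (x.1 0).im ^ 2 + (x.1 1).re ^ 2 + (x.1 1).im ^ 2) *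
    (t₁ x * (δ ^ 2 * (x.1 1).re) + t₂ x * (-δ * (x.1 0).im) + t₃ x * (-δ * (x.1 0).re)) at e₄
  ext i
  fin_cases i <;> apply Complex.ext <;>
    simp [skewOp_zero, skewOp_one, bergerE₁_apply, bergerE₂_apply, bergerE₃_apply, -Complex.ofReal_pow]
  · linear_combination e₁
  · linear_combination e₂
  · linear_combination e₃
  · linear_combination e₄

/-- The matrix entries have pairwise proportional differentials, since their logarithmic derivatives agree along the
frame and in the radial direction. -/
theorem killCoeff_proportional (h : IsUnitMetricOn (bergerE₁ δ) (bergerE₂ δ) (bergerE₃ δ) (2 * δ ^ 2) t₁ t₂ t₃ U)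
    (hU : IsOpen U) (hδ : δ ≠ 0) (hν : 2 * δ ^ 2 ≠ 2)
    (h₁ : ∀ x ∈ U, fderiv ℝ t₁ x x = 0) (h₂ : ∀ x ∈ U, fderiv ℝ t₂ x x = 0)
    (h₃ : ∀ x ∈ U, fderiv ℝ t₃ x x = 0) (i j : Fin 4) (x : U) (hx : (x : C2) ≠ 0) :
    (h.killCoeff hU j : U → ℝ) x • fderiv ℝ (extend (h.killCoeff hU i)) x =
      (h.killCoeff hU i : U → ℝ) x • fderiv ℝ (extend (h.killCoeff hU j)) x := by
  set B := h.toField hU (isBergerFrame δ) with hB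
  have hK : B.IsKillingDirection B.hopfPart := h.isKillingDirection hU _ hν (by positivity)
  set D := linearField hU (ContinuousLinearMap.id ℝ C2) with hD
  have hcomm : ∀ (A : C2 →L[ℝ] C2) (f), D (linearField hU A f) = linearField hU A (D f) := by
    intro A f
    have := linearField_commutator hU (ContinuousLinearMap.id ℝ C2) A f
    rw [← sub_eq_zero, this]
    ext x
    simp [linearField_apply hU _ f (extend_apply f)]
  have hDt : ∀ (t : C2 → ℝ) (ht : ContDiffOn ℝ ∞ t U), (∀ x ∈ U, fderiv ℝ t x x = 0) →
      D (smoothFunctions.mk t ht) = 0 := by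
    intro t ht h0
    ext x
    rw [linearField_apply hU _ _ (f := t) (fun _ => rfl)]
    exact h0 x x.2
  have hDc : ∀ (ℓ : C2 →L[ℝ] ℝ), D (smoothFunctions.mk ℓ ℓ.contDiff.contDiffOn) =
      smoothFunctions.mk ℓ ℓ.contDiff.contDiffOn := fun ℓ => linearField_mk hU _ ℓ
  have hN : D B.hopfPart = 0 := B.radial_hopfPart D (Derivation.map_algebraMap _ _) (hDt _ h.contDiffOn₁ h₁)
      (hDt _ h.contDiffOn₂ h₂)
    (hDt _ h.contDiffOn₃ h₃) (hcomm _) (hcomm _) (hcomm _)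
  have hrad := (h.coordinates hU).kill_radial D (Derivation.map_algebraMap _ _) (hDt _ h.contDiffOn₁ h₁)
      (hDt _ h.contDiffOn₂ h₂)
    (hDt _ h.contDiffOn₃ h₃) hN (hDc _) (hDc _) (hDc _) (hDc _)
  have hder := (h.coordinates hU).kill_deriv ⟨Derivation.map_algebraMap _ _, Derivation.map_algebraMap _ _,
    Derivation.map_algebraMap _ _⟩ hK
  have hmem : ∀ i, h.killCoeff hU i = (h.coordinates hU).killP ∨ h.killCoeff hU i = (h.coordinates hU).killR ∨
      h.killCoeff hU i = (h.coordinates hU).killS₀ ∨ h.killCoeff hU i = (h.coordinates hU).killS₁ := by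
    intro i; fin_cases i <;> simp [killCoeff]
  have key : ∀ (A : C2 →L[ℝ] C2) (θ : smoothFunctions U), (∀ i, linearField hU A (h.killCoeff hU i) =
      θ * h.killCoeff hU i) → ((h.killCoeff hU j : U → ℝ) x • fderiv ℝ (extend (h.killCoeff hU i)) x -
      (h.killCoeff hU i : U → ℝ) x • fderiv ℝ (extend (h.killCoeff hU j)) x) (A x) = 0 := by
    intro A θ hA
    have e : ∀ i, fderiv ℝ (extend (h.killCoeff hU i)) x (A x) = θ.1 x * (h.killCoeff hU i).1 x :=
      fun i => congrFun (congrArg Subtype.val (hA i)) x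
    simp only [sub_apply, smul_apply, e, smul_eq_mul]
    ring
  rw [← sub_eq_zero]
  exact clm_ext_frame hδ hx (key (ContinuousLinearMap.id ℝ C2) 2 fun i => hrad _ (hmem i))
    (key _ _ fun i => (hder _ (hmem i)).1) (key _ _ fun i => (hder _ (hmem i)).2.1)
    (key _ _ fun i => (hder _ (hmem i)).2.2)

theorem frame_combination_ne_zero (hδ : δ ≠ 0) {x : C2} (hx : x ≠ 0) {a b c : ℝ} (habc : a ^ 2 + b ^ 2 + c ^ 2 = 1) :
    a • bergerE₁ δ x + b • bergerE₂ δ x + c • bergerE₃ δ x ≠ 0 := by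
  intro h0
  have hn : (x 0).re ^ 2 + (x 0).im ^ 2 + (x 1).re ^ 2 + (x 1).im ^ 2 ≠ 0 := by
    rw [← norm_sq_eq_re_im]
    simpa using hx
  have e := fun i => congrArg (fun y : C2 => y i) h0
  have e₁ := congrArg Complex.re (e 0)
  have e₂ := congrArg Complex.im (e 0)
  have e₃ := congrArg Complex.re (e 1)
  have e₄ := congrArg Complex.im (e 1)
  simp [bergerE₁_apply, bergerE₂_apply, bergerE₃_apply, -Complex.ofReal_pow] at e₁ e₂ e₃ e₄
  have ha : a = 0 := by
    refine (mul_eq_zero.1 (?_ : (δ ^ 2 * ((x 0).re ^ 2 + (x 0).im ^ 2 + (x 1).re ^ 2 + (x 1).im ^ 2)) * a = 0)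
      |>.resolve_left (by positivity))
    linear_combination -(x 0).im * e₁ + (x 0).re * e₂ - (x 1).im * e₃ + (x 1).re * e₄
  have hb : b = 0 := by
    refine (mul_eq_zero.1 (?_ : (δ * ((x 0).re ^ 2 + (x 0).im ^ 2 + (x 1).re ^ 2 + (x 1).im ^ 2)) * b = 0)
      |>.resolve_left (mul_ne_zero hδ hn))
    linear_combination -(x 1).re * e₁ + (x 1).im * e₂ + (x 0).re * e₃ - (x 0).im * e₄
  have hc : c = 0 := by
    refine (mul_eq_zero.1 (?_ : (δ * ((x 0).re ^ 2 + (x 0).im ^ 2 + (x 1).re ^ 2 + (x 1).im ^ 2)) * c = 0)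
      |>.resolve_left (mul_ne_zero hδ hn))
    linear_combination (x 1).im * e₁ + (x 1).re * e₂ - (x 0).im * e₃ - (x 0).re * e₄
  simp [ha, hb, hc] at habc

/-- Near every point of `U`, a unit field that is constant along rays and satisfies the metric equation is a multiple of
a linear field `x ↦ K x` with `K` skew-Hermitian: the quotients of the matrix entries are locally constant. -/
theorem exists_skewAdjoint (h : IsUnitMetricOn (bergerE₁ δ) (bergerE₂ δ) (bergerE₃ δ) (2 * δ ^ 2) t₁ t₂ t₃ U)
    (hU : IsOpen U) (hδ : δ ≠ 0) (hν : 2 * δ ^ 2 ≠ 2)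
    (h₁ : ∀ x ∈ U, fderiv ℝ t₁ x x = 0) (h₂ : ∀ x ∈ U, fderiv ℝ t₂ x x = 0)
    (h₃ : ∀ x ∈ U, fderiv ℝ t₃ x x = 0) (h₀ : (0 : C2) ∉ U) {x₀ : C2} (hx₀ : x₀ ∈ U) :
    ∃ K ∈ skewAdjoint (C2 →L[ℂ] C2), ∃ f : C2 → ℝ, ∀ᶠ x in 𝓝 x₀, f x ≠ 0 ∧
      K x = f x • (t₁ x • bergerE₁ δ x + t₂ x • bergerE₂ δ x + t₃ x • bergerE₃ δ x) := by
  have hne : ∀ x ∈ U, x ≠ 0 := fun x hx h => h₀ (h ▸ hx)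
  set q := fun i => extend (h.killCoeff hU i) with hq
  have hqe : ∀ i (x : U), (h.killCoeff hU i : U → ℝ) x = q i x := fun i => extend_apply _
  have hqs : ∀ i, ContDiffOn ℝ ∞ (q i) U := fun i => contDiffOn_extend _
  have hT := h.skewOp_killCoeff hU
  change ∀ x : U, skewOp ((h.killCoeff hU 0 : U → ℝ) x) ((h.killCoeff hU 1 : U → ℝ) x)
    ((h.killCoeff hU 2 : U → ℝ) x) ((h.killCoeff hU 3 : U → ℝ) x) x = _ at hT
  simp only [hqe] at hT
  obtain ⟨j, hj⟩ : ∃ j, q j x₀ ≠ 0 := by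
    by_contra! hc
    have h4 := hT ⟨x₀, hx₀⟩
    have hz : skewOp 0 0 0 0 x₀ = 0 := by
      ext i; fin_cases i <;> simp [skewOp_zero, skewOp_one]
    simp only [hc, hz] at h4
    have := smul_eq_zero.1 h4.symm
    refine this.elim (fun h => ?_) (frame_combination_ne_zero hδ (hne _ hx₀) (h.unit _ hx₀))
    simp [hne _ hx₀] at h
  obtain ⟨r, hr, hball⟩ := Metric.mem_nhds_iff.1 (((hqs j).continuousOn.continuousAt
    (hU.mem_nhds hx₀)).eventually_ne hj |>.and (hU.mem_nhds hx₀))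
  have hconst : ∀ i, ∀ x ∈ Metric.ball x₀ r, q i x = q i x₀ / q j x₀ * q j x := by
    intro i x hx
    have hd : ∀ i, ∀ y ∈ Metric.ball x₀ r, HasFDerivAt (q i) (fderiv ℝ (q i) y) y := fun i y hy =>
      (((hqs i).contDiffAt (hU.mem_nhds (hball hy).2)).differentiableAt (by simp)).hasFDerivAt
    have hd' : ∀ y ∈ Metric.ball x₀ r, HasFDerivAt (fun y => q i y / q j y) (0 : C2 →L[ℝ] ℝ) y := by
      intro y hy
      have hjy := (hball hy).1
      have := (hd i y hy).mul ((hasDerivAt_inv hjy).comp_hasFDerivAt y (hd j y hy))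
      simp only [div_eq_mul_inv]
      refine this.congr_fderiv ?_
      have e := h.killCoeff_proportional hU hδ hν h₁ h₂ h₃ i j ⟨y, (hball hy).2⟩ (hne _ (hball hy).2)
      simp only [hqe] at e
      have e' : fderiv ℝ (q i) y = ((q j y)⁻¹ * q i y) • fderiv ℝ (q j) y := by
        rw [mul_smul, ← e, inv_smul_smul₀ hjy]
      simp only [Function.comp_apply, e', smul_smul, ← add_smul]
      rw [show q i y * -(q j y ^ 2)⁻¹ + (q j y)⁻¹ * ((q j y)⁻¹ * q i y) = 0 by field_simp; ring, zero_smul]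
    have := Metric.isOpen_ball.is_const_of_fderiv_eq_zero (convex_ball x₀ r).isPreconnected
      (fun y hy => (hd' y hy).differentiableAt.differentiableWithinAt) (fun y hy => (hd' y hy).fderiv)
      hx (Metric.mem_ball_self hr)
    rw [← this, div_mul_cancel₀ _ (hball hx).1]
  refine ⟨skewOp (q 0 x₀ / q j x₀) (q 1 x₀ / q j x₀) (q 2 x₀ / q j x₀) (q 3 x₀ / q j x₀),
    skewOp_mem_skewAdjoint _ _ _ _, fun x => (q j x)⁻¹ * (2 * ‖x‖ ^ 2), ?_⟩
  filter_upwards [Metric.ball_mem_nhds x₀ hr] with x hx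
  have hjx := (hball hx).1
  refine ⟨mul_ne_zero (inv_ne_zero hjx) (by simp [hne _ (hball hx).2]), ?_⟩
  rw [mul_smul, ← hT ⟨x, (hball hx).2⟩, eq_inv_smul_iff₀ hjx]
  rw [hconst 0 x hx, hconst 1 x hx, hconst 2 x hx, hconst 3 x hx]
  rw [skewOp_mul]

end IsUnitMetricOn
end

/-! ### Vector fields on the sphere -/

noncomputable section

/-- The charts of the sphere extend to smooth maps on open subsets of the ambient space. -/
theorem exists_ambient_chart (x₀ : S3) : ∃ C : C2 → EuclideanSpace ℝ (Fin 3),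
    ContDiffOn ℝ ∞ C {y | inner ℝ (-(x₀ : C2)) y ≠ 1} ∧ ∀ x : S3, extChartAt (𝓡 3) x₀ x = C x := by
  let U : _ ≃ₗᵢ[ℝ] _ := (OrthonormalBasis.fromOrthogonalSpanSingleton (𝕜 := ℝ) 3
    (ne_zero_of_mem_unit_sphere (-x₀))).repr
  refine ⟨fun y => U (stereoToFun (-x₀ : C2) y), ?_, fun x => ?_⟩
  · exact U.contDiff.comp_contDiffOn contDiffOn_stereoToFun
  · rfl

theorem inner_neg_ne_one_of_mem_source {x₀ x : S3} (hx : x ∈ (chartAt (EuclideanSpace ℝ (Fin 3)) x₀).source) :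
    inner ℝ (-(x₀ : C2)) x ≠ 1 := by
  intro h
  have : (-(x₀ : C2)) = x := (inner_eq_one_iff_of_norm_eq_one (by simp) (by simp)).1 h
  have h2 : x = -x₀ := Subtype.ext this.symm
  have : (chartAt (EuclideanSpace ℝ (Fin 3)) x₀).source = {-x₀}ᶜ := stereographic'_source (-x₀)
  rw [this] at hx
  exact hx h2

theorem isOpen_inner_ne_one (x₀ : C2) : IsOpen {y : C2 | inner ℝ (-x₀) y ≠ 1} :=
  isOpen_ne_fun (by fun_prop) continuous_const

/-- A vector field on the sphere is smooth if it is smooth as a map to the ambient space. -/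
theorem contMDiff_section_of_sphereIncl {X : Π x : S3, TangentSpace (𝓡 3) x} {W : S3 → C2}
    (hW : ContMDiff (𝓡 3) 𝓘(ℝ, C2) ∞ W) (h : ∀ x, sphereIncl x (X x) = W x) :
    ContMDiff (𝓡 3) (𝓡 3).tangent ∞ (fun x => (⟨x, X x⟩ : TangentBundle (𝓡 3) S3)) := by
  intro x₀
  refine (contMDiffAt_section (s := X) x₀).2 ?_
  obtain ⟨C, hC, hCx⟩ := exists_ambient_chart x₀
  have hmem : (x₀ : C2) ∈ {y : C2 | inner ℝ (-(x₀ : C2)) y ≠ 1} :=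
    inner_neg_ne_one_of_mem_source (mem_chart_source _ x₀)
  have hopen := isOpen_inner_ne_one (x₀ : C2)
  have hsm : ContMDiffAt (𝓡 3) 𝓘(ℝ, EuclideanSpace ℝ (Fin 3)) ∞
      (fun x : S3 => fderiv ℝ C x (W x)) x₀ := by
    have h1 : ContDiffAt ℝ ∞ (fderiv ℝ C) (x₀ : C2) :=
      (hC.fderiv_of_isOpen hopen (by simp)).contDiffAt (hopen.mem_nhds hmem)
    exact (h1.contMDiffAt.comp x₀ (contMDiff_coe_sphere x₀)).clm_apply (hW x₀)
  refine hsm.congr_of_eventuallyEq ?_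
  filter_upwards [(chartAt (EuclideanSpace ℝ (Fin 3)) x₀).open_source.mem_nhds (mem_chart_source _ x₀)] with x hx
  have h1 := TangentBundle.continuousLinearMapAt_trivializationAt (I := 𝓡 3) hx
  have h2 : (trivializationAt (EuclideanSpace ℝ (Fin 3)) (TangentSpace (𝓡 3)) x₀ ⟨x, X x⟩).2 =
      (trivializationAt (EuclideanSpace ℝ (Fin 3)) (TangentSpace (𝓡 3)) x₀).continuousLinearMapAt ℝ x (X x) := by
    rw [Trivialization.continuousLinearMapAt_apply, Trivialization.linearMapAt_apply]
    exact (if_pos hx).symm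
  rw [h2, h1]
  have h3 : ⇑(extChartAt (𝓡 3) x₀) = C ∘ ((↑) : S3 → C2) := funext hCx
  rw [h3]
  have hd : DifferentiableAt ℝ C x := (hC.contDiffAt (hopen.mem_nhds
    (inner_neg_ne_one_of_mem_source hx))).differentiableAt (by simp)
  have := mfderiv_comp_apply (I' := 𝓘(ℝ, C2)) x hd.mdifferentiableAt
    ((contMDiff_coe_sphere (n := 3) (m := ∞) x).mdifferentiableAt (by simp)) (X x)
  refine this.trans ?_
  rw [← h x, mfderiv_eq_fderiv]
  rfl

/-- A smooth map `W` with `W x` orthogonal to `x` is a smooth vector field on the sphere. -/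
theorem exists_section {W : S3 → C2} (hW : ContMDiff (𝓡 3) 𝓘(ℝ, C2) ∞ W)
    (h : ∀ x : S3, inner ℝ (x : C2) (W x) = 0) : ∃ X : Π x : S3, TangentSpace (𝓡 3) x,
      ContMDiff (𝓡 3) (𝓡 3).tangent ∞ (fun x => (⟨x, X x⟩ : TangentBundle (𝓡 3) S3)) ∧
      ∀ x, sphereIncl x (X x) = W x := by
  have : ∀ x : S3, ∃ v : TangentSpace (𝓡 3) x, sphereIncl x v = W x := by
    intro x
    have h1 : W x ∈ (sphereIncl x).range := by
      rw [sphereIncl, range_mvfderiv_subtypeVal, Submodule.mem_orthogonal_singleton_iff_inner_right]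
      exact h x
    exact h1
  choose X hX using this
  exact ⟨X, contMDiff_section_of_sphereIncl hW hX, hX⟩

/-- The Lie bracket of vector fields that are `G`-related to linear vector fields. -/
theorem fderiv_lieBracket_of_related {E V : Type*} [NormedAddCommGroup E] [NormedSpace ℝ E]
    [NormedAddCommGroup V] [NormedSpace ℝ V] {G : E → V} {u₀ : E} (hG : ContDiffAt ℝ ∞ G u₀)
    {p q : E → E} (hp : DifferentiableAt ℝ p u₀) (hq : DifferentiableAt ℝ q u₀) {A B : V →L[ℝ] V}
    (hA : ∀ᶠ u in 𝓝 u₀, fderiv ℝ G u (p u) = A (G u)) (hB : ∀ᶠ u in 𝓝 u₀, fderiv ℝ G u (q u) = B (G u)) :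
    fderiv ℝ G u₀ (VectorField.lieBracket ℝ p q u₀) = B (A (G u₀)) - A (B (G u₀)) := by
  have hd2 : DifferentiableAt ℝ (fderiv ℝ G) u₀ :=
    (hG.fderiv_right (m := 1) (by exact WithTop.coe_le_coe.2 le_top)).differentiableAt (by simp)
  have hd1 : DifferentiableAt ℝ G u₀ := hG.differentiableAt (by simp)
  have key : ∀ (p q : E → E) (A B : V →L[ℝ] V), (∀ᶠ u in 𝓝 u₀, fderiv ℝ G u (p u) = A (G u)) →
      (∀ᶠ u in 𝓝 u₀, fderiv ℝ G u (q u) = B (G u)) → DifferentiableAt ℝ q u₀ →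
      fderiv ℝ (fderiv ℝ G) u₀ (p u₀) (q u₀) + fderiv ℝ G u₀ (fderiv ℝ q u₀ (p u₀)) = B (A (G u₀)) := by
    intro p q A B hA hB hd
    have e' := DFunLike.congr_fun (Filter.EventuallyEq.fderiv_eq (𝕜 := ℝ) hB) (p u₀)
    have hBG : HasFDerivAt (fun u => B (G u)) (B.comp (fderiv ℝ G u₀)) u₀ :=
      B.hasFDerivAt.comp u₀ hd1.hasFDerivAt
    rw [fderiv_clm_apply hd2 hd, hBG.fderiv] at e'
    simp only [ContinuousLinearMap.comp_apply, hA.self_of_nhds] at e'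
    rw [← e']
    simp [add_comm]
  have hsym : IsSymmSndFDerivAt ℝ G u₀ := hG.isSymmSndFDerivAt (by
    simp only [minSmoothness_of_isRCLikeNormedField]; exact WithTop.coe_le_coe.2 le_top)
  rw [← key p q A B hA hB hq, ← key q p B A hB hA hp, VectorField.lieBracket_eq, map_sub, hsym.eq]
  abel

/-- The Lie bracket of the restrictions to the sphere of linear vector fields. -/
theorem sphereIncl_mlieBracket {X Y : Π x : S3, TangentSpace (𝓡 3) x} {A B : C2 →L[ℝ] C2} (x : S3)
    (hX : MDifferentiableAt (𝓡 3) (𝓡 3).tangent (fun x => (⟨x, X x⟩ : TangentBundle (𝓡 3) S3)) x)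
    (hY : MDifferentiableAt (𝓡 3) (𝓡 3).tangent (fun x => (⟨x, Y x⟩ : TangentBundle (𝓡 3) S3)) x)
    (hA : ∀ x, sphereIncl x (X x) = A x) (hB : ∀ x, sphereIncl x (Y x) = B x) :
    sphereIncl x (VectorField.mlieBracket (𝓡 3) X Y x) = B (A x) - A (B x) := by
  set c := extChartAt (𝓡 3) x with hc
  set u₀ : EuclideanSpace ℝ (Fin 3) := c x with hu₀
  set G : EuclideanSpace ℝ (Fin 3) → C2 := fun u => (c.symm u : C2) with hG
  have hopen : IsOpen c.target := isOpen_extChartAt_target x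
  have hmem : u₀ ∈ c.target := mem_extChartAt_target x
  have hcs : ContMDiffOn 𝓘(ℝ, EuclideanSpace ℝ (Fin 3)) (𝓡 3) ∞ c.symm c.target := contMDiffOn_extChartAt_symm x
  have hGs : ContDiffOn ℝ ∞ G c.target := by
    rw [← contMDiffOn_iff_contDiffOn]
    exact (contMDiff_coe_sphere (n := 3) (m := ∞)).comp_contMDiffOn hcs
  have hdG : ∀ u ∈ c.target, ∀ v : EuclideanSpace ℝ (Fin 3), fderiv ℝ G u v =
      sphereIncl (c.symm u) (mfderiv 𝓘(ℝ, EuclideanSpace ℝ (Fin 3)) (𝓡 3) c.symm u v) := by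
    intro u hu v
    have := mfderiv_comp_apply (I' := 𝓡 3) (I'' := 𝓘(ℝ, C2)) (I := 𝓘(ℝ, EuclideanSpace ℝ (Fin 3))) (f := c.symm)
        (g := ((↑) : S3 → C2)) u
      ((contMDiff_coe_sphere (n := 3) (m := ∞) _).mdifferentiableAt (by simp))
      ((hcs.contMDiffAt (hopen.mem_nhds hu)).mdifferentiableAt (by simp)) v
    rw [← mfderiv_eq_fderiv]
    exact this
  have hdGc : ∀ v : TangentSpace (𝓡 3) x, fderiv ℝ G u₀ (mfderiv (𝓡 3) 𝓘(ℝ, EuclideanSpace ℝ (Fin 3)) c x v) =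
      sphereIncl x v := by
    intro v
    have h1 : DifferentiableAt ℝ G u₀ := (hGs.contDiffAt (hopen.mem_nhds hmem)).differentiableAt (by simp)
    have := mfderiv_comp_apply (I' := 𝓘(ℝ, EuclideanSpace ℝ (Fin 3))) (I'' := 𝓘(ℝ, C2)) (I := 𝓡 3)
      (f := c) (g := G) x h1.mdifferentiableAt (mdifferentiableAt_extChartAt (mem_chart_source _ x)) v
    rw [← mfderiv_eq_fderiv]
    refine this.symm.trans ?_
    have h2 : (G ∘ c) =ᶠ[𝓝 x] ((↑) : S3 → C2) := by
      filter_upwards [extChartAt_source_mem_nhds (I := 𝓡 3) x] with y hy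
      exact congrArg Subtype.val (c.left_inv hy)
    exact DFunLike.congr_fun (h2.mfderiv_eq) v
  -- the two fields in the chart
  set P : (Π x : S3, TangentSpace (𝓡 3) x) → EuclideanSpace ℝ (Fin 3) → EuclideanSpace ℝ (Fin 3) := fun Z =>
    VectorField.mpullbackWithin 𝓘(ℝ, EuclideanSpace ℝ (Fin 3)) (𝓡 3) c.symm Z (Set.range (𝓡 3)) with hP
  have hrel : ∀ (Z : Π x : S3, TangentSpace (𝓡 3) x) (D : C2 →L[ℝ] C2), (∀ x, sphereIncl x (Z x) = D x) →
      ∀ᶠ u in 𝓝 u₀, fderiv ℝ G u (P Z u) = D (G u) := by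
    intro Z D hD
    filter_upwards [hopen.mem_nhds hmem] with u hu
    have hinv := isInvertible_mfderivWithin_extChartAt_symm (I := 𝓡 3) (x := x) hu
    have := hinv.self_apply_inverse (Z (c.symm u))
    refine (hdG u hu _).trans ?_
    rw [← hD]
    refine congrArg (sphereIncl (c.symm u)) ?_
    refine Eq.trans ?_ this
    have e : mfderiv 𝓘(ℝ, EuclideanSpace ℝ (Fin 3)) (𝓡 3) c.symm u =
      mfderivWithin 𝓘(ℝ, EuclideanSpace ℝ (Fin 3)) (𝓡 3) c.symm (Set.range (𝓡 3)) u := by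
      rw [ModelWithCorners.Boundaryless.range_eq_univ, mfderivWithin_univ]
    rw [e]
    rfl
  have hpd : ∀ (Z : Π x : S3, TangentSpace (𝓡 3) x),
      MDifferentiableAt (𝓡 3) (𝓡 3).tangent (fun x => (⟨x, Z x⟩ : TangentBundle (𝓡 3) S3)) x →
      DifferentiableAt ℝ (P Z) u₀ := by
    intro Z hZ
    have h1 : DifferentiableWithinAt ℝ (P Z) (c.symm ⁻¹' Set.univ ∩ Set.range (𝓡 3)) u₀ :=
      MDifferentiableWithinAt.differentiableWithinAt_mpullbackWithin_vectorField (s := Set.univ)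
      hZ.mdifferentiableWithinAt
    have e : c.symm ⁻¹' Set.univ ∩ Set.range (𝓡 3) = Set.univ := by
      rw [ModelWithCorners.Boundaryless.range_eq_univ, Set.preimage_univ, Set.univ_inter]
    rwa [e, differentiableWithinAt_univ] at h1
  have hbr : mfderiv (𝓡 3) 𝓘(ℝ, EuclideanSpace ℝ (Fin 3)) c x (VectorField.mlieBracket (𝓡 3) X Y x) =
      VectorField.lieBracket ℝ (P X) (P Y) u₀ := by
    have e : c.symm ⁻¹' Set.univ ∩ Set.range (𝓡 3) = Set.univ := by
      rw [ModelWithCorners.Boundaryless.range_eq_univ, Set.preimage_univ, Set.univ_inter]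
    have h1 := (isInvertible_mfderiv_extChartAt (I := 𝓡 3) (mem_extChartAt_source (I := 𝓡 3) x)).self_apply_inverse
      (VectorField.lieBracketWithin ℝ (P X) (P Y) (c.symm ⁻¹' Set.univ ∩ Set.range (𝓡 3)) u₀)
    refine Eq.trans h1 ?_
    exact (congrArg (fun s => VectorField.lieBracketWithin ℝ (P X) (P Y) s u₀) e).trans
      (congrFun VectorField.lieBracketWithin_univ u₀)
  have hx : G u₀ = x := congrArg Subtype.val (c.left_inv (mem_extChartAt_source x))
  rw [← hdGc, hbr, fderiv_lieBracket_of_related (hGs.contDiffAt (hopen.mem_nhds hmem)) (hpd X hX) (hpd Y hY)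
    (hrel X A hA) (hrel Y B hB), hx]

end

/-! ### The differential equation of a metric foliation -/

noncomputable section

/-- The expression `⟨∇_x T, y⟩ + ⟨∇_y T, x⟩` in an orthonormal frame `e₁`, `e₂`,
    `e₃` with the brackets of a Berger sphere,
for `T = t₁ e₁ + t₂ e₂ + t₃ e₃` and the Levi-Civita connection `∇`, at one point: `Dᵢ v` stands for `∇_v eᵢ`,
    `dᵢ` for the
differential of `tᵢ` and `D v` for `∇_v T`. The Christoffel symbols follow from the brackets by the Koszul formula. -/
theorem metric_expression_of_connection {V : Type*} [AddCommGroup V] [Module ℝ V] [TopologicalSpace V]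
    {g : V →L[ℝ] V →L[ℝ] ℝ} (hg : ∀ u v, g u v = g v u) {e₁ e₂ e₃ : V} {D₁ D₂ D₃ : V →L[ℝ] V} {ν : ℝ}
    (g₁₁ : g e₁ e₁ = 1) (g₂₂ : g e₂ e₂ = 1) (g₃₃ : g e₃ e₃ = 1) (g₁₂ : g e₁ e₂ = 0) (g₁₃ : g e₁ e₃ = 0)
    (g₂₃ : g e₂ e₃ = 0)
    (c₁₁ : ∀ v, g (D₁ v) e₁ = 0) (c₂₂ : ∀ v, g (D₂ v) e₂ = 0)
    (c₃₃ : ∀ v, g (D₃ v) e₃ = 0)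
    (c₁₂ : ∀ v, g (D₁ v) e₂ + g (D₂ v) e₁ = 0) (c₁₃ : ∀ v, g (D₁ v) e₃ + g (D₃ v) e₁ = 0)
    (c₂₃ : ∀ v, g (D₂ v) e₃ + g (D₃ v) e₂ = 0)
    (b₂₃ : D₃ e₂ - D₂ e₃ = (2 : ℝ) • e₁) (b₁₂ : D₂ e₁ - D₁ e₂ = ν • e₃) (b₃₁ : D₁ e₃ - D₃ e₁ = ν • e₂)
    {d₁ d₂ d₃ : V →L[ℝ] ℝ} {t₁ t₂ t₃ x₁ x₂ x₃ y₁ y₂ y₃ : ℝ} {x y : V} {D : V →L[ℝ] V}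
    (hx : x = x₁ • e₁ + x₂ • e₂ + x₃ • e₃) (hy : y = y₁ • e₁ + y₂ • e₂ + y₃ • e₃)
    (hD : ∀ v, D v = (t₁ • D₁ v + d₁ v • e₁) + (t₂ • D₂ v + d₂ v • e₂) + (t₃ • D₃ v + d₃ v • e₃))
    (h : g (D x) y + g (D y) x = 0) :
    2 * d₁ e₁ * x₁ * y₁ + 2 * d₂ e₂ * x₂ * y₂ + 2 * d₃ e₃ * x₃ * y₃ +
    (d₂ e₁ + d₁ e₂ - (ν - 2) * t₃) * (x₁ * y₂ + x₂ * y₁) +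
    (d₃ e₁ + d₁ e₃ + (ν - 2) * t₂) * (x₁ * y₃ + x₃ * y₁) +
    (d₃ e₂ + d₂ e₃) * (x₂ * y₃ + x₃ * y₂) = 0 := by
  have g₂₁ := g₁₂; have g₃₁ := g₁₃; have g₃₂ := g₂₃
  rw [hg] at g₂₁ g₃₁ g₃₂
  have b₁ := fun j => congrArg (fun v => g v j) b₂₃
  have b₂ := fun j => congrArg (fun v => g v j) b₁₂
  have b₃ := fun j => congrArg (fun v => g v j) b₃₁
  have c₁₂₁ := c₁₂ e₁; have c₁₂₂ := c₁₂ e₂; have c₁₂₃ := c₁₂ e₃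
  have c₁₃₁ := c₁₃ e₁; have c₁₃₂ := c₁₃ e₂; have c₁₃₃ := c₁₃ e₃
  have c₂₃₁ := c₂₃ e₁; have c₂₃₂ := c₂₃ e₂; have c₂₃₃ := c₂₃ e₃
  have b₁₁ := b₁ e₁; have b₁₂ := b₁ e₂; have b₁₃ := b₁ e₃
  have b₂₁ := b₂ e₁; have b₂₂ := b₂ e₂; have b₂₃ := b₂ e₃
  have b₃₁ := b₃ e₁; have b₃₂ := b₃ e₂; have b₃₃ := b₃ e₃
  simp only [map_sub, map_smul, sub_apply, smul_apply, smul_eq_mul, g₁₁, g₂₂, g₃₃,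
    g₁₂, g₁₃, g₂₃, g₂₁, g₃₁, g₃₂, mul_one, mul_zero] at b₁₁ b₁₂ b₁₃ b₂₁ b₂₂ b₂₃ b₃₁ b₃₂ b₃₃
  simp only [hx, hy, hD, map_add, map_smul, add_apply, smul_apply, smul_eq_mul, g₁₁, g₂₂, g₃₃,
    g₁₂, g₁₃, g₂₃, g₂₁, g₃₁, g₃₂, mul_one, mul_zero, add_zero] at h
  -- the Christoffel symbols of the frame
  have k₁₁₁ : g (D₁ e₁) e₁ = 0 := c₁₁ e₁
  have k₁₁₂ : g (D₁ e₂) e₁ = 0 := c₁₁ e₂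
  have k₁₁₃ : g (D₁ e₃) e₁ = 0 := c₁₁ e₃
  have k₂₂₁ : g (D₂ e₁) e₂ = 0 := c₂₂ e₁
  have k₂₂₂ : g (D₂ e₂) e₂ = 0 := c₂₂ e₂
  have k₂₂₃ : g (D₂ e₃) e₂ = 0 := c₂₂ e₃
  have k₃₃₁ : g (D₃ e₁) e₃ = 0 := c₃₃ e₁
  have k₃₃₂ : g (D₃ e₂) e₃ = 0 := c₃₃ e₂
  have k₃₃₃ : g (D₃ e₃) e₃ = 0 := c₃₃ e₃
  have k₂₁₁ : g (D₂ e₁) e₁ = 0 := by linarith only [b₂₁, k₁₁₂]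
  have k₁₂₁ : g (D₁ e₁) e₂ = 0 := by linarith only [c₁₂₁, k₂₁₁]
  have k₃₁₁ : g (D₃ e₁) e₁ = 0 := by linarith only [b₃₁, k₁₁₃]
  have k₁₃₁ : g (D₁ e₁) e₃ = 0 := by linarith only [c₁₃₁, k₃₁₁]
  have k₁₂₂ : g (D₁ e₂) e₂ = 0 := by linarith only [b₂₂, k₂₂₁]
  have k₂₁₂ : g (D₂ e₂) e₁ = 0 := by linarith only [c₁₂₂, k₁₂₂]
  have k₃₂₂ : g (D₃ e₂) e₂ = 0 := by linarith only [b₁₂, k₂₂₃]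
  have k₂₃₂ : g (D₂ e₂) e₃ = 0 := by linarith only [c₂₃₂, k₃₂₂]
  have k₁₃₃ : g (D₁ e₃) e₃ = 0 := by linarith only [b₃₃, k₃₃₁]
  have k₃₁₃ : g (D₃ e₃) e₁ = 0 := by linarith only [c₁₃₃, k₁₃₃]
  have k₂₃₃ : g (D₂ e₃) e₃ = 0 := by linarith only [b₁₃, k₃₃₂]
  have k₃₂₃ : g (D₃ e₃) e₂ = 0 := by linarith only [c₂₃₃, k₂₃₃]
  have k₁₂₃ : g (D₁ e₂) e₃ = -1 := by linarith only [c₁₂₃, c₁₃₂, c₂₃₁, b₁₁, b₂₃, b₃₂]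
  have k₁₃₂ : g (D₁ e₃) e₂ = 1 := by linarith only [c₁₂₃, c₁₃₂, c₂₃₁, b₁₁, b₂₃, b₃₂]
  have k₂₁₃ : g (D₂ e₃) e₁ = -1 := by linarith only [c₁₂₃, c₁₃₂, c₂₃₁, b₁₁, b₂₃, b₃₂]
  have k₃₁₂ : g (D₃ e₂) e₁ = 1 := by linarith only [c₁₂₃, c₁₃₂, c₂₃₁, b₁₁, b₂₃, b₃₂]
  have k₂₃₁ : g (D₂ e₁) e₃ = ν - 1 := by linarith only [c₁₂₃, c₁₃₂, c₂₃₁, b₁₁, b₂₃, b₃₂]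
  have k₃₂₁ : g (D₃ e₁) e₂ = 1 - ν := by linarith only [c₁₂₃, c₁₃₂, c₂₃₁, b₁₁, b₂₃, b₃₂]
  simp only [k₁₁₁, k₁₁₂, k₁₁₃, k₂₂₁, k₂₂₂, k₂₂₃, k₃₃₁, k₃₃₂, k₃₃₃, k₂₁₁, k₃₁₁, k₁₂₂, k₃₂₂, k₁₃₃, k₂₃₃,
    k₁₂₁, k₁₃₁, k₂₁₂, k₂₃₂, k₃₁₃, k₃₂₃, k₁₂₃, k₁₃₂, k₂₁₃, k₃₁₂, k₂₃₁, k₃₂₁] at h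
  linear_combination h

theorem sphere_re_sq_add_im_sq (p : S3) : (p.1 0).re ^ 2 + (p.1 0).im ^ 2 + (p.1 1).re ^ 2 + (p.1 1).im ^ 2 = 1 := by
  rw [← norm_sq_eq_re_im]
  simp

/-- The frame is orthonormal for the Berger metric. -/
theorem bergerForm_frame {ε δ : ℝ} (h : ε * δ ^ 2 = 1) (p : S3) (x₁ x₂ x₃ y₁ y₂ y₃ : ℝ) :
    bergerForm ε p (x₁ • bergerE₁ δ p + x₂ • bergerE₂ δ p + x₃ • bergerE₃ δ p)
      (y₁ • bergerE₁ δ p + y₂ • bergerE₂ δ p + y₃ • bergerE₃ δ p) = x₁ * y₁ + x₂ * y₂ + x₃ * y₃ := by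
  have hs := sphere_re_sq_add_im_sq p
  have hh : ∀ v, hopfForm p v = -(p.1 0).im * (v 0).re + (p.1 0).re * (v 0).im - (p.1 1).im * (v 1).re +
      (p.1 1).re * (v 1).im := by
    intro v
    simp only [hopfForm, realInner_apply, real_inner_C2]
    simp
    ring
  have hi : ∀ a b c : ℝ, hopfForm p (a • bergerE₁ δ p + b • bergerE₂ δ p + c • bergerE₃ δ p) = δ ^ 2 * a := by
    intro a b c
    rw [hh]
    simp [bergerE₁_apply, bergerE₂_apply, bergerE₃_apply, -Complex.ofReal_pow]
    linear_combination δ ^ 2 * a * hs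
  have hj : inner ℝ (x₁ • bergerE₁ δ p + x₂ • bergerE₂ δ p + x₃ • bergerE₃ δ p)
      (y₁ • bergerE₁ δ p + y₂ • bergerE₂ δ p + y₃ • bergerE₃ δ p) =
      δ ^ 4 * x₁ * y₁ + δ ^ 2 * (x₂ * y₂ + x₃ * y₃) := by
    rw [real_inner_C2]
    simp [bergerE₁_apply, bergerE₂_apply, bergerE₃_apply, -Complex.ofReal_pow]
    linear_combination (δ ^ 4 * x₁ * y₁ + δ ^ 2 * (x₂ * y₂ + x₃ * y₃)) * hs
  rw [bergerForm_apply, hi, hi, hj]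
  linear_combination (x₁ * y₁ * (ε * δ ^ 2 + 1) + x₂ * y₂ + x₃ * y₃) * h

theorem inner_frame (δ : ℝ) (p : C2) (a b c : ℝ) :
    inner ℝ p (a • bergerE₁ δ p + b • bergerE₂ δ p + c • bergerE₃ δ p) = 0 := by
  rw [real_inner_C2]
  simp [bergerE₁_apply, bergerE₂_apply, bergerE₃_apply, -Complex.ofReal_pow]
  ring

theorem contDiff_mul_of_tsupport {E : Type*} [NormedAddCommGroup E] [NormedSpace ℝ E]
    {χ f : E → ℝ} {U : Set E} (hU : IsOpen U) (hχ : ContDiff ℝ ∞ χ) (hf : ContDiffOn ℝ ∞ f U)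
    (hsupp : tsupport χ ⊆ U) : ContDiff ℝ ∞ (fun x => χ x * f x) := by
  rw [contDiff_iff_contDiffAt]
  intro x
  by_cases hx : x ∈ tsupport χ
  · exact hχ.contDiffAt.mul (hf.contDiffAt (hU.mem_nhds (hsupp hx)))
  · refine (contDiffAt_const (c := (0 : ℝ))).congr_of_eventuallyEq ?_
    filter_upwards [(isClosed_tsupport χ).isOpen_compl.mem_nhds hx] with y hy
    rw [image_eq_zero_of_notMem_tsupport hy, zero_mul]

theorem exists_cutoff {E : Type*} [NormedAddCommGroup E] [InnerProductSpace ℝ E] [FiniteDimensional ℝ E] {U : Set E} (hU : IsOpen U) {x : E} (hx : x ∈ U) :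
    ∃ χ : E → ℝ, ContDiff ℝ ∞ χ ∧ tsupport χ ⊆ U ∧ (∀ᶠ y in 𝓝 x, χ y = 1) := by
  obtain ⟨r, hr, hb⟩ := Metric.isOpen_iff.1 hU x hx
  let f : ContDiffBump x := ⟨r / 3, r / 2, by positivity, by linarith⟩
  refine ⟨f, f.contDiff, ?_, f.eventuallyEq_one⟩
  rw [f.tsupport_eq]
  exact (Metric.closedBall_subset_ball (by change r / 2 < r; linarith)).trans hb

theorem contMDiff_restrict {V : Type*} [NormedAddCommGroup V] [NormedSpace ℝ V] {f : C2 → V} (hf : ContDiff ℝ ∞ f) :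
    ContMDiff (𝓡 3) 𝓘(ℝ, V) ∞ (fun x : S3 => f x) :=
  hf.contMDiff.comp contMDiff_coe_sphere

theorem mvfderiv_restrict {f : C2 → ℝ} {p : S3} (hf : DifferentiableAt ℝ f p) (v : TangentSpace (𝓡 3) p) :
    mvfderiv (𝓡 3) (fun x : S3 => f x) p v = fderiv ℝ f p (sphereIncl p v) := by
  have := mfderiv_comp_apply (I' := 𝓘(ℝ, C2)) (I'' := 𝓘(ℝ, ℝ)) (I := 𝓡 3) (f :=
      ((↑) : S3 → C2)) p hf.mdifferentiableAt
    ((contMDiff_coe_sphere (n := 3) (m := ∞) p).mdifferentiableAt (by simp)) v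
  refine Eq.trans this ?_
  rw [mfderiv_eq_fderiv]
  rfl

theorem exists_frame_section (δ : ℝ) {a b c : C2 → ℝ} (ha : ContDiff ℝ ∞ a) (hb : ContDiff ℝ ∞ b)
    (hc : ContDiff ℝ ∞ c) :
    ∃ X : Π x : S3, TangentSpace (𝓡 3) x,
      ContMDiff (𝓡 3) (𝓡 3).tangent ∞ (fun x => (⟨x, X x⟩ : TangentBundle (𝓡 3) S3)) ∧
      ∀ x : S3, sphereIncl x (X x) = a x • bergerE₁ δ x + b x • bergerE₂ δ x + c x • bergerE₃ δ x :=
  exists_section (contMDiff_restrict (((ha.smul (bergerE₁ δ).contDiff).add (hb.smul (bergerE₂ δ).contDiff)).add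
    (hc.smul (bergerE₃ δ).contDiff))) fun x => inner_frame δ x _ _ _

theorem bergerMetric_inner_eq {ε δ : ℝ} (hε : 0 < ε) (h : ε * δ ^ 2 = 1) {p : S3} {v w : TangentSpace (𝓡 3) p}
    {x₁ x₂ x₃ y₁ y₂ y₃ : ℝ} (hv : sphereIncl p v = x₁ • bergerE₁ δ p + x₂ • bergerE₂ δ p + x₃ • bergerE₃ δ p)
    (hw : sphereIncl p w = y₁ • bergerE₁ δ p + y₂ • bergerE₂ δ p + y₃ • bergerE₃ δ p) :
    (bergerMetric ε hε).inner p v w = x₁ * y₁ + x₂ * y₂ + x₃ * y₃ := by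
  change bergerInner ε p v w = _
  rw [bergerInner_apply, hv, hw, bergerForm_frame h]

variable {F : OneDimFoliation (𝓡 3) S3 2} {ε δ : ℝ} {U : Set C2} {t₁ t₂ t₃ : C2 → ℝ}

/-- At the points of `S³` in `U`, the tangent line of the foliation is spanned by the smooth field
`t₁ E₁ + t₂ E₂ + t₃ E₃`, where `E₁`, `E₂`, `E₃` is the Berger frame and `t₁² + t₂² + t₃² = 1`. -/
structure SpansTangent (F : OneDimFoliation (𝓡 3) S3 2) (δ : ℝ) (t₁ t₂ t₃ : C2 → ℝ) (U : Set C2) : Prop where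
  contDiffOn₁ : ContDiffOn ℝ ∞ t₁ U
  contDiffOn₂ : ContDiffOn ℝ ∞ t₂ U
  contDiffOn₃ : ContDiffOn ℝ ∞ t₃ U
  unit : ∀ x ∈ U, t₁ x ^ 2 + t₂ x ^ 2 + t₃ x ^ 2 = 1
  exists_eq_smul : ∀ x : S3, (x : C2) ∈ U → ∀ v ∈ F.tangentLine x, ∃ r : ℝ,
    sphereIncl x v = r • (t₁ x • bergerE₁ δ x + t₂ x • bergerE₂ δ x + t₃ x • bergerE₃ δ x)
  exists_smul_eq : ∀ x : S3, (x : C2) ∈ U → ∃ v ∈ F.tangentLine x, ∃ r : ℝ,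
    t₁ x • bergerE₁ δ x + t₂ x • bergerE₂ δ x + t₃ x • bergerE₃ δ x = r • sphereIncl x v

namespace SpansTangent

/-- Every vector at `p` orthogonal to the foliation extends to a global section of the orthogonal distribution: cut off
the projection to the orthogonal distribution of the vector field with constant coefficients. -/
theorem exists_orthogonal_section (h : SpansTangent F δ t₁ t₂ t₃ U) (hU : IsOpen U) (hε : 0 < ε) (hδ : ε * δ ^ 2 = 1)
    {χ : C2 → ℝ} (hχ : ContDiff ℝ ∞ χ) (hχU : tsupport χ ⊆ U) {p : S3} (hχp : χ p = 1) {x₁ x₂ x₃ : ℝ}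
    (hx : x₁ * t₁ p + x₂ * t₂ p + x₃ * t₃ p = 0) :
    ∃ X : Π x : S3, TangentSpace (𝓡 3) x, F.IsOrthogonalSection (bergerMetric ε hε) X ∧
      sphereIncl p (X p) = x₁ • bergerE₁ δ p + x₂ • bergerE₂ δ p + x₃ • bergerE₃ δ p ∧
      ∀ T : Π x : S3, TangentSpace (𝓡 3) x, (∀ x : S3, sphereIncl x (T x) = (χ x * t₁ x) • bergerE₁ δ x +
        (χ x * t₂ x) • bergerE₂ δ x + (χ x * t₃ x) • bergerE₃ δ x) →
        ∀ x, (bergerMetric ε hε).inner x (X x) (T x) = 0 := by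
  set m : C2 → ℝ := fun y => x₁ * t₁ y + x₂ * t₂ y + x₃ * t₃ y with hm
  have hms : ContDiffOn ℝ ∞ m U := ((contDiffOn_const.mul h.contDiffOn₁).add (contDiffOn_const.mul h.contDiffOn₂)).add
    (contDiffOn_const.mul h.contDiffOn₃)
  have hs : ∀ (a : ℝ) (t : C2 → ℝ), ContDiffOn ℝ ∞ t U → ContDiff ℝ ∞ (fun y => χ y * (a - m y * t y)) :=
    fun a t ht => contDiff_mul_of_tsupport hU hχ (contDiffOn_const.sub (hms.mul ht)) hχU
  obtain ⟨X, hXs, hX⟩ := exists_frame_section δ (hs x₁ t₁ h.contDiffOn₁) (hs x₂ t₂ h.contDiffOn₂)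
    (hs x₃ t₃ h.contDiffOn₃)
  have hzero : ∀ y : S3, ∀ r, χ y * ((x₁ - m y * t₁ y) * (r * t₁ y) + (x₂ - m y * t₂ y) * (r * t₂ y) +
      (x₃ - m y * t₃ y) * (r * t₃ y)) = 0 := by
    intro y r
    by_cases hy : (y : C2) ∈ U
    · have hmy : m y = x₁ * t₁ y + x₂ * t₂ y + x₃ * t₃ y := rfl
      linear_combination (-χ y * r * m y) * h.unit y hy - χ y * r * hmy
    · rw [image_eq_zero_of_notMem_tsupport fun hh => hy (hχU hh), zero_mul]
  refine ⟨X, ⟨hXs, fun y v hv => ?_⟩, ?_, fun T hT y => ?_⟩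
  · by_cases hy : (y : C2) ∈ U
    · obtain ⟨r, hr⟩ := h.exists_eq_smul y hy v hv
      rw [smul_add, smul_add, smul_smul, smul_smul, smul_smul] at hr
      rw [bergerMetric_inner_eq hε hδ (hX y) hr]
      linear_combination hzero y r
    · have h0 : χ y = 0 := image_eq_zero_of_notMem_tsupport fun hh => hy (hχU hh)
      have : sphereIncl y (X y) = 0 := by rw [hX]; simp [h0]
      rw [sphereIncl_injective y (this.trans (map_zero _).symm), map_zero]
      rfl
  · rw [hX, hχp]
    have : m p = 0 := hx
    simp [this]
  · rw [bergerMetric_inner_eq hε hδ (hX y) (hT y)]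
    linear_combination hzero y (χ y)

set_option maxHeartbeats 1600000 in
/-- The unit field spanning a metric foliation satisfies the metric equation of `UnitMetricField`: for orthogonal
sections `X`, `Y` and the field `T`, the derivatives of `⟨X, T⟩ = 0` and `⟨Y, T⟩ = 0` turn
`⟨∇_X Y + ∇_Y X, T⟩ = 0` into `⟨∇_X T, Y⟩ + ⟨∇_Y T, X⟩ = 0`. -/
theorem metric_equation (h : SpansTangent F δ t₁ t₂ t₃ U) (hU : IsOpen U) (hε : 0 < ε) (hδ : ε * δ ^ 2 = 1)
    (hF : F.IsMetric (bergerMetric ε hε)) {p : S3} (hp : (p : C2) ∈ U) {x₁ x₂ x₃ y₁ y₂ y₃ : ℝ}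
    (hx : x₁ * t₁ p + x₂ * t₂ p + x₃ * t₃ p = 0) (hy : y₁ * t₁ p + y₂ * t₂ p + y₃ * t₃ p = 0) :
    2 * fderiv ℝ t₁ p (bergerE₁ δ p) * x₁ * y₁ + 2 * fderiv ℝ t₂ p (bergerE₂ δ p) * x₂ * y₂ +
      2 * fderiv ℝ t₃ p (bergerE₃ δ p) * x₃ * y₃ +
    (fderiv ℝ t₂ p (bergerE₁ δ p) + fderiv ℝ t₁ p (bergerE₂ δ p) - (2 * δ ^ 2 - 2) * t₃ p) * (x₁ * y₂ + x₂ * y₁) +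
    (fderiv ℝ t₃ p (bergerE₁ δ p) + fderiv ℝ t₁ p (bergerE₃ δ p) + (2 * δ ^ 2 - 2) * t₂ p) * (x₁ * y₃ + x₃ * y₁) +
    (fderiv ℝ t₃ p (bergerE₂ δ p) + fderiv ℝ t₂ p (bergerE₃ δ p)) * (x₂ * y₃ + x₃ * y₂) = 0 := by
  obtain ⟨cov, ⟨htor, hmet⟩, hgeo⟩ := hF
  obtain ⟨χ, hχ, hχU, hχ1⟩ := exists_cutoff hU hp
  have hχp : χ p = 1 := hχ1.self_of_nhds
  obtain ⟨X, hXo, hXp, hXT⟩ := h.exists_orthogonal_section hU hε hδ hχ hχU hχp hx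
  obtain ⟨Y, hYo, hYp, hYT⟩ := h.exists_orthogonal_section hU hε hδ hχ hχU hχp hy
  obtain ⟨e₁, he₁s, he₁⟩ := exists_frame_section δ (contDiff_const (c := (1 : ℝ))) (contDiff_const (c := (0 : ℝ)))
    (contDiff_const (c := (0 : ℝ)))
  obtain ⟨e₂, he₂s, he₂⟩ := exists_frame_section δ (contDiff_const (c := (0 : ℝ))) (contDiff_const (c := (1 : ℝ)))
    (contDiff_const (c := (0 : ℝ)))
  obtain ⟨e₃, he₃s, he₃⟩ := exists_frame_section δ (contDiff_const (c := (0 : ℝ))) (contDiff_const (c := (0 : ℝ)))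
    (contDiff_const (c := (1 : ℝ)))
  have he₁' : ∀ x : S3, sphereIncl x (e₁ x) = bergerE₁ δ x := fun x => by simp [he₁]
  have he₂' : ∀ x : S3, sphereIncl x (e₂ x) = bergerE₂ δ x := fun x => by simp [he₂]
  have he₃' : ∀ x : S3, sphereIncl x (e₃ x) = bergerE₃ δ x := fun x => by simp [he₃]
  have d₁ := (he₁s p).mdifferentiableAt (by simp)
  have d₂ := (he₂s p).mdifferentiableAt (by simp)
  have d₃ := (he₃s p).mdifferentiableAt (by simp)
  have dX := (hXo.1 p).mdifferentiableAt (by simp)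
  have dY := (hYo.1 p).mdifferentiableAt (by simp)
  have sm := fun (t : C2 → ℝ) (ht : ContDiffOn ℝ ∞ t U) => contDiff_mul_of_tsupport hU hχ ht hχU
  have dm := fun (t : C2 → ℝ) (ht : ContDiffOn ℝ ∞ t U) =>
    ((contMDiff_restrict (sm t ht)) p).mdifferentiableAt (by simp)
  have dv : ∀ (t : C2 → ℝ) (ht : ContDiffOn ℝ ∞ t U) (v : TangentSpace (𝓡 3) p),
      mvfderiv (𝓡 3) (fun x : S3 => χ x * t x) p v = fderiv ℝ t p (sphereIncl p v) := by
    intro t ht v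
    rw [mvfderiv_restrict (f := fun y => χ y * t y) ((sm t ht).contDiffAt.differentiableAt (by simp))]
    congr 1
    apply Filter.EventuallyEq.fderiv_eq
    filter_upwards [hχ1] with y hy
    rw [hy, one_mul]
  -- the unit field, cut off so as to be globally defined
  set s₁ : S3 → ℝ := fun x => χ x * t₁ x
  set s₂ : S3 → ℝ := fun x => χ x * t₂ x
  set s₃ : S3 → ℝ := fun x => χ x * t₃ x
  set T : Π x : S3, TangentSpace (𝓡 3) x := s₁ • e₁ + s₂ • e₂ + s₃ • e₃ with hTdef
  have hT : ∀ x : S3, sphereIncl x (T x) = (χ x * t₁ x) • bergerE₁ δ x +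
        (χ x * t₂ x) • bergerE₂ δ x + (χ x * t₃ x) • bergerE₃ δ x := by
    intro x
    rw [← he₁', ← he₂', ← he₃', ← map_smul, ← map_smul, ← map_smul, ← map_add, ← map_add]
    rfl
  have D₁ := (dm t₁ h.contDiffOn₁).smul_section d₁
  have D₂ := (dm t₂ h.contDiffOn₂).smul_section d₂
  have D₃ := (dm t₃ h.contDiffOn₃).smul_section d₃
  have D₁₂ := mdifferentiableAt_add_section D₁ D₂
  have hDT := mdifferentiableAt_add_section D₁₂ D₃
  have hcov := cov.isCovariantDerivativeOnUniv
  have hDv : ∀ v, cov T p v = (t₁ p • cov e₁ p v + fderiv ℝ t₁ p (sphereIncl p v) • e₁ p) +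
      (t₂ p • cov e₂ p v + fderiv ℝ t₂ p (sphereIncl p v) • e₂ p) +
      (t₃ p • cov e₃ p v + fderiv ℝ t₃ p (sphereIncl p v) • e₃ p) := by
    intro v
    have e : cov T p = (s₁ p • cov e₁ p + (mvfderiv (𝓡 3) s₁ p).smulRight (e₁ p)) +
        (s₂ p • cov e₂ p + (mvfderiv (𝓡 3) s₂ p).smulRight (e₂ p)) +
        (s₃ p • cov e₃ p + (mvfderiv (𝓡 3) s₃ p).smulRight (e₃ p)) := by
      rw [hTdef, hcov.add D₁₂ D₃, hcov.add D₁ D₂, hcov.leibniz d₁ (dm t₁ h.contDiffOn₁),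
        hcov.leibniz d₂ (dm t₂ h.contDiffOn₂), hcov.leibniz d₃ (dm t₃ h.contDiffOn₃)]
    rw [e, ← dv t₁ h.contDiffOn₁, ← dv t₂ h.contDiffOn₂, ← dv t₃ h.contDiffOn₃]
    simp only [add_apply, smul_apply, ContinuousLinearMap.smulRight_apply, s₁, s₂, s₃, hχp, one_mul]
  -- compatibility with the metric, for pairs of fields with constant inner product
  have hconst : ∀ (Z W : Π x : S3, TangentSpace (𝓡 3) x) (c : ℝ),
      MDifferentiableAt (𝓡 3) (𝓡 3).tangent (fun y => (⟨y, Z y⟩ : TangentBundle (𝓡 3) S3)) p →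
      MDifferentiableAt (𝓡 3) (𝓡 3).tangent (fun y => (⟨y, W y⟩ : TangentBundle (𝓡 3) S3)) p →
      (∀ x, (bergerMetric ε hε).inner x (Z x) (W x) = c) → ∀ v,
      (bergerMetric ε hε).inner p (cov Z p v) (W p) + (bergerMetric ε hε).inner p (cov W p v) (Z p) = 0 := by
    intro Z W c hZ hW hc v
    have := hmet Z W p v hZ hW
    simp only [hc, mvfderiv_const] at this
    rw [(bergerMetric ε hε).symm p (cov W p v), ← this]
    rfl
  have hself : ∀ (Z : Π x : S3, TangentSpace (𝓡 3) x) (c : ℝ),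
      MDifferentiableAt (𝓡 3) (𝓡 3).tangent (fun y => (⟨y, Z y⟩ : TangentBundle (𝓡 3) S3)) p →
      (∀ x, (bergerMetric ε hε).inner x (Z x) (Z x) = c) → ∀ v,
      (bergerMetric ε hε).inner p (cov Z p v) (Z p) = 0 := by
    intro Z c hZ hc v
    linarith [hconst Z Z c hZ hZ hc v]
  have g₁₁ : ∀ x, (bergerMetric ε hε).inner x (e₁ x) (e₁ x) = 1 := fun x => by
    rw [bergerMetric_inner_eq hε hδ (he₁ x) (he₁ x)]; ring
  have g₂₂ : ∀ x, (bergerMetric ε hε).inner x (e₂ x) (e₂ x) = 1 := fun x => by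
    rw [bergerMetric_inner_eq hε hδ (he₂ x) (he₂ x)]; ring
  have g₃₃ : ∀ x, (bergerMetric ε hε).inner x (e₃ x) (e₃ x) = 1 := fun x => by
    rw [bergerMetric_inner_eq hε hδ (he₃ x) (he₃ x)]; ring
  have g₁₂ : ∀ x, (bergerMetric ε hε).inner x (e₁ x) (e₂ x) = 0 := fun x => by
    rw [bergerMetric_inner_eq hε hδ (he₁ x) (he₂ x)]; ring
  have g₁₃ : ∀ x, (bergerMetric ε hε).inner x (e₁ x) (e₃ x) = 0 := fun x => by
    rw [bergerMetric_inner_eq hε hδ (he₁ x) (he₃ x)]; ring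
  have g₂₃ : ∀ x, (bergerMetric ε hε).inner x (e₂ x) (e₃ x) = 0 := fun x => by
    rw [bergerMetric_inner_eq hε hδ (he₂ x) (he₃ x)]; ring
  have hE := isBergerFrame δ
  have b₂₃ : cov e₃ p (e₂ p) - cov e₂ p (e₃ p) = (2 : ℝ) • e₁ p := by
    apply sphereIncl_injective p
    rw [htor e₂ e₃ p d₂ d₃, sphereIncl_mlieBracket p d₂ d₃ he₂' he₃', map_smul, he₁']
    exact DFunLike.congr_fun hE.E₂_E₃ (p : C2)
  have b₁₂ : cov e₂ p (e₁ p) - cov e₁ p (e₂ p) = (2 * δ ^ 2) • e₃ p := by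
    apply sphereIncl_injective p
    rw [htor e₁ e₂ p d₁ d₂, sphereIncl_mlieBracket p d₁ d₂ he₁' he₂', map_smul, he₃']
    exact DFunLike.congr_fun hE.E₁_E₂ (p : C2)
  have b₃₁ : cov e₁ p (e₃ p) - cov e₃ p (e₁ p) = (2 * δ ^ 2) • e₂ p := by
    apply sphereIncl_injective p
    rw [htor e₃ e₁ p d₃ d₁, sphereIncl_mlieBracket p d₃ d₁ he₃' he₁', map_smul, he₂']
    exact DFunLike.congr_fun hE.E₃_E₁ (p : C2)
  have hXe : X p = x₁ • e₁ p + x₂ • e₂ p + x₃ • e₃ p := by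
    apply sphereIncl_injective p
    rw [hXp, map_add, map_add, map_smul, map_smul, map_smul, he₁', he₂', he₃']
  have hYe : Y p = y₁ • e₁ p + y₂ • e₂ p + y₃ • e₃ p := by
    apply sphereIncl_injective p
    rw [hYp, map_add, map_add, map_smul, map_smul, map_smul, he₁', he₂', he₃']
  have hfin : (bergerMetric ε hε).inner p (cov T p (X p)) (Y p) +
      (bergerMetric ε hε).inner p (cov T p (Y p)) (X p) = 0 := by
    have k₁ := hconst X T 0 dX hDT (hXT T hT) (Y p)
    have k₂ := hconst Y T 0 dY hDT (hYT T hT) (X p)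
    obtain ⟨v, hv, r, hr⟩ := h.exists_smul_eq p hp
    have hTv : T p = r • v := by
      apply sphereIncl_injective p
      rw [hT, map_smul, ← hr]
      simp only [hχp, one_mul]
    have k₃ := hgeo X Y hXo hYo p v hv
    rw [map_add, add_apply] at k₃
    have k₄ : (bergerMetric ε hε).inner p (cov X p (Y p))
        (T p) = r * (bergerMetric ε hε).inner p (cov X p (Y p)) v := by
      rw [hTv, map_smul, smul_eq_mul]
    have k₅ : (bergerMetric ε hε).inner p (cov Y p (X p))
        (T p) = r * (bergerMetric ε hε).inner p (cov Y p (X p)) v := by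
      rw [hTv, map_smul, smul_eq_mul]
    linear_combination k₁ + k₂ - k₄ - k₅ - r * k₃
  have key := metric_expression_of_connection (g := (bergerMetric ε hε).inner p) ((bergerMetric ε hε).symm p)
    (g₁₁ p) (g₂₂ p) (g₃₃ p) (g₁₂ p) (g₁₃ p) (g₂₃ p) (hself e₁ 1 d₁ g₁₁) (hself e₂ 1 d₂ g₂₂)
    (hself e₃ 1 d₃ g₃₃) (hconst e₁ e₂ 0 d₁ d₂ g₁₂) (hconst e₁ e₃ 0 d₁ d₃ g₁₃) (hconst e₂ e₃ 0 d₂ d₃ g₂₃)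
    b₂₃ b₁₂ b₃₁ (d₁ := (fderiv ℝ t₁ p).comp (sphereIncl p)) (d₂ := (fderiv ℝ t₂ p).comp (sphereIncl p))
    (d₃ := (fderiv ℝ t₃ p).comp (sphereIncl p)) hXe hYe hDv hfin
  simp only [ContinuousLinearMap.comp_apply, he₁', he₂', he₃'] at key
  exact key

end SpansTangent
end

/-! ### Foliated charts -/

noncomputable section

open Classical in
/-- The radial projection of `ℂ²` to `S³`; the origin is sent to `p`. -/
def radialProj (p : S3) (y : C2) : S3 :=
  if h : y = 0 then p else ⟨‖y‖⁻¹ • y, by simp [norm_smul, h]⟩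

theorem coe_radialProj (p : S3) {y : C2} (hy : y ≠ 0) : (radialProj p y : C2) = ‖y‖⁻¹ • y := by
  simp [radialProj, hy]

theorem radialProj_coe (p x : S3) : radialProj p x = x := by
  apply Subtype.ext
  rw [coe_radialProj p (ne_zero_of_mem_unit_sphere x)]
  simp

theorem radialProj_smul (p : S3) {r : ℝ} (hr : 0 < r) (y : C2) : radialProj p (r • y) = radialProj p y := by
  by_cases hy : y = 0
  · simp [hy]
  · apply Subtype.ext
    rw [coe_radialProj p hy, coe_radialProj p (smul_ne_zero hr.ne' hy), norm_smul, smul_smul,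
      Real.norm_of_nonneg hr.le, mul_inv, mul_right_comm, inv_mul_cancel₀ hr.ne', one_mul]

theorem contMDiffAt_radialProj (p : S3) {y : C2} (hy : y ≠ 0) :
    ContMDiffAt 𝓘(ℝ, C2) (𝓡 3) ∞ (radialProj p) y := by
  have hd : ContDiffAt ℝ ∞ (fun y : C2 => ‖y‖⁻¹ • y) y := ((contDiffAt_norm ℝ hy).inv (by simpa)).smul contDiffAt_id
  have he : (fun y => (radialProj p y : C2)) =ᶠ[𝓝 y] fun y => ‖y‖⁻¹ • y := by
    filter_upwards [isOpen_ne.mem_nhds hy] with z hz using coe_radialProj p hz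
  have hd' := hd.congr_of_eventuallyEq he
  rw [contMDiffAt_iff_target]
  refine ⟨Topology.IsInducing.subtypeVal.continuousAt_iff.2 hd'.continuousAt, ?_⟩
  obtain ⟨C, hC, hCx⟩ := exists_ambient_chart (radialProj p y)
  have : (extChartAt (𝓡 3) (radialProj p y)) ∘ radialProj p = fun z => C (radialProj p z) := funext fun z => hCx _
  rw [this, contMDiffAt_iff_contDiffAt]
  have h1 : ContDiffAt ℝ ∞ C (radialProj p y) := hC.contDiffAt ((isOpen_inner_ne_one _).mem_nhds
    (inner_neg_ne_one_of_mem_source (mem_chart_source _ _)))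
  exact ContDiffAt.comp (g := C) (f := fun z => (radialProj p z : C2)) y h1 hd'

/-- The chart `φ` is a foliated chart of `F`, in the sense of `OneDimFoliation.exists_foliatedChart`. -/
structure IsFoliatedChart (F : OneDimFoliation (𝓡 3) S3 2)
    (φ : OpenPartialHomeomorph S3 (ℝ × EuclideanSpace ℝ (Fin 2))) : Prop where
  contMDiffOn : ContMDiffOn (𝓡 3) 𝓘(ℝ, ℝ × EuclideanSpace ℝ (Fin 2)) ∞ φ φ.source
  contMDiffOn_symm : ContMDiffOn 𝓘(ℝ, ℝ × EuclideanSpace ℝ (Fin 2)) (𝓡 3) ∞ φ.symm φ.target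
  joinedIn_iff : ∀ x ∈ φ.source, ∀ y ∈ φ.source,
      (JoinedIn ({z : S3 | F.sameLeaf x z} ∩ φ.source) x y ↔ (φ x).2 = (φ y).2)

namespace IsFoliatedChart
variable {F : OneDimFoliation (𝓡 3) S3 2} {φ : OpenPartialHomeomorph S3 (ℝ × EuclideanSpace ℝ (Fin 2))}

/-- Along a curve in a leaf, the transverse coordinate is locally constant. -/
theorem eventually_snd_eq (h : IsFoliatedChart F φ) {γ : ℝ → S3} (hγ : Continuous γ) {s₀ : ℝ}
    (hs : γ s₀ ∈ φ.source) (hl : ∀ s, F.sameLeaf (γ s₀) (γ s)) :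
    ∀ᶠ s in 𝓝 s₀, γ s ∈ φ.source ∧ (φ (γ s)).2 = (φ (γ s₀)).2 := by
  obtain ⟨r, hr, hb⟩ := Metric.mem_nhds_iff.1 (hγ.continuousAt.preimage_mem_nhds (φ.open_source.mem_nhds hs))
  filter_upwards [Metric.ball_mem_nhds s₀ hr] with s hsb
  refine ⟨hb hsb, ((h.joinedIn_iff _ hs _ (hb hsb)).1 ?_).symm⟩
  have hpc := ((convex_ball s₀ r).isPathConnected ⟨s₀, Metric.mem_ball_self hr⟩).image hγ
  refine (hpc.joinedIn _ (Set.mem_image_of_mem γ (Metric.mem_ball_self hr)) _ (Set.mem_image_of_mem γ hsb)).mono ?_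
  rintro _ ⟨s', hs', rfl⟩
  exact ⟨hl s', hb hs'⟩

theorem sameLeaf_of_snd_eq (h : IsFoliatedChart F φ) {x y : S3} (hx : x ∈ φ.source) (hy : y ∈ φ.source)
    (hxy : (φ x).2 = (φ y).2) : F.sameLeaf x y :=
  ((h.joinedIn_iff x hx y hy).2 hxy).target_mem.1

/-- The inverse of the chart, as a map to `ℂ²`. -/
def param (φ : OpenPartialHomeomorph S3 (ℝ × EuclideanSpace ℝ (Fin 2))) (u : ℝ × EuclideanSpace ℝ (Fin 2)) : C2 :=
  (φ.symm u : C2)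

/-- The open cone over the chart domain, without its apex. -/
def cone (φ : OpenPartialHomeomorph S3 (ℝ × EuclideanSpace ℝ (Fin 2))) (p : S3) : Set C2 :=
  {y | y ≠ 0 ∧ radialProj p y ∈ φ.source}

theorem isOpen_cone (p : S3) : IsOpen (cone φ p) := by
  rw [isOpen_iff_mem_nhds]
  rintro y ⟨hy, hys⟩
  exact Filter.inter_mem (isOpen_ne.mem_nhds hy)
    ((contMDiffAt_radialProj p hy).continuousAt.preimage_mem_nhds (φ.open_source.mem_nhds hys))

theorem coe_mem_cone {p x : S3} (hx : x ∈ φ.source) : (x : C2) ∈ cone φ p :=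
  ⟨ne_zero_of_mem_unit_sphere x, by rwa [radialProj_coe]⟩

theorem contDiffOn_chart (h : IsFoliatedChart F φ) (p : S3) : ContDiffOn ℝ ∞ (fun y => φ (radialProj p y))
    (cone φ p) := by
  intro y hy
  have := (h.contMDiffOn.contMDiffAt (φ.open_source.mem_nhds hy.2)).comp y (contMDiffAt_radialProj p hy.1)
  exact this.contDiffAt.contDiffWithinAt

theorem contDiffOn_param (h : IsFoliatedChart F φ) : ContDiffOn ℝ ∞ (param φ) φ.target := by
  rw [← contMDiffOn_iff_contDiffOn]
  exact (contMDiff_coe_sphere (n := 3) (m := ∞)).comp_contMDiffOn h.contMDiffOn_symm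

theorem differentiableAt_param (h : IsFoliatedChart F φ) {u} (hu : u ∈ φ.target) : DifferentiableAt ℝ (param φ) u :=
  (h.contDiffOn_param.contDiffAt (φ.open_target.mem_nhds hu)).differentiableAt (by simp)

theorem differentiableAt_chart (h : IsFoliatedChart F φ) (p : S3) {y} (hy : y ∈ cone φ p) :
    DifferentiableAt ℝ (fun y => φ (radialProj p y)) y :=
  ((h.contDiffOn_chart p).contDiffAt ((isOpen_cone p).mem_nhds hy)).differentiableAt (by simp)

/-- The derivative of the radial extension of the chart is a left inverse of the derivative of its inverse. -/
theorem fderiv_chart_param (h : IsFoliatedChart F φ) (p : S3) {x : S3} (hx : x ∈ φ.source) (w) :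
    fderiv ℝ (fun y => φ (radialProj p y)) x (fderiv ℝ (param φ) (φ x) w) = w := by
  have h1 := h.differentiableAt_param (φ.map_source hx)
  have h2 := h.differentiableAt_chart p (coe_mem_cone (p := p) hx)
  have hx' : (x : C2) = param φ (φ x) := congrArg Subtype.val (φ.left_inv hx).symm
  have h3 := (hx' ▸ h2.hasFDerivAt).comp (φ x) h1.hasFDerivAt
  have h4 : ((fun y => φ (radialProj p y)) ∘ param φ) =ᶠ[𝓝 (φ x)] id := by
    filter_upwards [φ.open_target.mem_nhds (φ.map_source hx)] with u hu
    simp only [Function.comp_apply, param, radialProj_coe, φ.right_inv hu, id]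
  have h5 := (h3.congr_of_eventuallyEq h4.symm).unique (hasFDerivAt_id _)
  rw [hx']
  exact DFunLike.congr_fun h5 w

/-- The first coordinate vector field of the chart,
    extended to the cone over the chart domain as a field constant along
rays. It spans the tangent lines of the foliation. -/
def direction (φ : OpenPartialHomeomorph S3 (ℝ × EuclideanSpace ℝ (Fin 2))) (p : S3) (y : C2) : C2 :=
  fderiv ℝ (param φ) (φ (radialProj p y)) (1, 0)

theorem direction_coe (p x : S3) : direction φ p x = fderiv ℝ (param φ) (φ x) (1, 0) := by
  rw [direction, radialProj_coe]

theorem direction_smul (p : S3) {r : ℝ} (hr : 0 < r) (y : C2) : direction φ p (r • y) = direction φ p y := by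
  rw [direction, direction, radialProj_smul p hr]

theorem contDiffOn_direction (h : IsFoliatedChart F φ) (p : S3) : ContDiffOn ℝ ∞ (direction φ p) (cone φ p) := by
  have h1 := (h.contDiffOn_param.fderiv_of_isOpen φ.open_target (m := ∞) (by simp)).comp (h.contDiffOn_chart p)
    (fun y hy => φ.map_source hy.2)
  exact h1.clm_apply contDiffOn_const

theorem direction_coe_ne_zero (h : IsFoliatedChart F φ) (p : S3) {x : S3}
    (hx : x ∈ φ.source) : direction φ p x ≠ 0 := by
  intro h0
  have := h.fderiv_chart_param p hx (1, 0)
  rw [← direction_coe p x, h0, map_zero] at this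
  simpa using congrArg Prod.fst this

theorem inner_direction_coe (h : IsFoliatedChart F φ) (p : S3) {x : S3} (hx : x ∈ φ.source) :
    inner ℝ (x : C2) (direction φ p x) = 0 := by
  have h1 := (h.differentiableAt_param (φ.map_source hx)).hasFDerivAt
  have h2 := (h1.inner ℝ h1).congr_of_eventuallyEq (f₁ := fun _ => (1 : ℝ)) (by
    filter_upwards with u
    simp [param])
  have h3 := DFunLike.congr_fun (h2.unique (hasFDerivAt_const _ _)) (1, 0)
  have hx' : (x : C2) = param φ (φ x) := congrArg Subtype.val (φ.left_inv hx).symm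
  rw [direction_coe, hx']
  simp only [ContinuousLinearMap.comp_apply, ContinuousLinearMap.prod_apply, fderivInnerCLM_apply, zero_apply,
      real_inner_comm] at h3
  linarith
end IsFoliatedChart
end

/-! ### Tangent lines in a foliated chart -/

noncomputable section

namespace IsFoliatedChart
variable {F : OneDimFoliation (𝓡 3) S3 2} {φ : OpenPartialHomeomorph S3 (ℝ × EuclideanSpace ℝ (Fin 2))}

theorem _root_.OneDimFoliation.exists_curve_of_mem_tangentLine {p : S3} {v : TangentSpace (𝓡 3) p}
    (hv : v ∈ F.tangentLine p) :
    ∃ γ : ℝ → S3, ContMDiff 𝓘(ℝ, ℝ) (𝓡 3) ∞ γ ∧ (∀ t, F.sameLeaf p (γ t)) ∧ γ 0 = p ∧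
      HasDerivAt (fun t => (γ t : C2)) (sphereIncl p v) 0 := by
  obtain ⟨γ, hγ, hl, h⟩ := hv
  refine ⟨γ, hγ, hl, congrArg TotalSpace.proj h, ?_⟩
  have hd : DifferentiableAt ℝ (fun t => (γ t : C2)) 0 := by
    have := (contMDiff_coe_sphere (n := 3) (m := ∞)).comp hγ
    exact this.contDiff.contDiffAt.differentiableAt (by simp)
  have key : ∀ w : TangentBundle (𝓡 3) S3, tangentMap 𝓘(ℝ, ℝ) (𝓡 3) γ ⟨0, (1 : ℝ)⟩ = w →
      deriv (fun t => (γ t : C2)) 0 = sphereIncl w.proj w.2 := by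
    rintro _ rfl
    have := mfderiv_comp_apply (I' := 𝓡 3) (I'' := 𝓘(ℝ, C2)) (I := 𝓘(ℝ, ℝ)) (f := γ) (g := ((↑) : S3 → C2)) 0
      ((contMDiff_coe_sphere (n := 3) (m := ∞) _).mdifferentiableAt (by simp))
      ((hγ 0).mdifferentiableAt (by simp)) (1 : ℝ)
    rw [← fderiv_apply_one_eq_deriv, ← mfderiv_eq_fderiv]
    exact this
  have := hd.hasDerivAt
  rwa [key _ h] at this

theorem _root_.OneDimFoliation.exists_mem_tangentLine {γ : ℝ → S3} (hγ : ContMDiff 𝓘(ℝ, ℝ) (𝓡 3) ∞ γ) {p : S3}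
    (hp : γ 0 = p) (hl : ∀ t, F.sameLeaf p (γ t)) {w : C2} (hw : HasDerivAt (fun t => (γ t : C2)) w 0) :
    ∃ v ∈ F.tangentLine p, sphereIncl p v = w := by
  subst hp
  refine ⟨mfderiv 𝓘(ℝ, ℝ) (𝓡 3) γ 0 (1 : ℝ), ⟨γ, hγ, hl, rfl⟩, ?_⟩
  have := mfderiv_comp_apply (I' := 𝓡 3) (I'' := 𝓘(ℝ, C2)) (I := 𝓘(ℝ, ℝ)) (f := γ) (g := ((↑) : S3 → C2)) 0
      ((contMDiff_coe_sphere (n := 3) (m := ∞) _).mdifferentiableAt (by simp))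
      ((hγ 0).mdifferentiableAt (by simp)) (1 : ℝ)
  rw [← hw.deriv, ← fderiv_apply_one_eq_deriv, ← mfderiv_eq_fderiv]
  exact this.symm

/-- A tangent vector of the foliation is the velocity of a curve with constant transverse coordinate. -/
theorem exists_eq_smul_direction (h : IsFoliatedChart F φ) (p : S3) {x : S3} (hx : x ∈ φ.source)
    {v : TangentSpace (𝓡 3) x} (hv : v ∈ F.tangentLine x) : ∃ r : ℝ, sphereIncl x v = r • direction φ p x := by
  obtain ⟨γ, hγ, hl, rfl, hd⟩ := F.exists_curve_of_mem_tangentLine hv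
  have hev := h.eventually_snd_eq hγ.continuous hx hl
  have h2 := (h.differentiableAt_chart p (coe_mem_cone (p := p) hx)).hasFDerivAt.comp_hasDerivAt 0 hd
  have h3 := (ContinuousLinearMap.snd ℝ ℝ (EuclideanSpace ℝ (Fin 2))).hasFDerivAt.comp_hasDerivAt 0 h2
  have hc := (hasDerivAt_const (0 : ℝ) (φ (γ 0)).2).congr_of_eventuallyEq
    (f₁ := fun t => (φ (radialProj p (γ t))).2) (by
      filter_upwards [hev] with s hs
      rw [radialProj_coe, hs.2])
  have h4 : (fderiv ℝ (fun y => φ (radialProj p y)) (γ 0) (sphereIncl (γ 0) v)).2 = 0 := h3.unique hc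
  set w := fderiv ℝ (fun y => φ (radialProj p y)) (γ 0) (sphereIncl (γ 0) v) with hw
  have h1 := h.differentiableAt_param (φ.map_source hx)
  have e1 : (fun y => φ (radialProj p y)) (γ 0) = φ (γ 0) := by simp only [radialProj_coe]
  have h5 := (e1 ▸ h1.hasFDerivAt : HasFDerivAt (param φ) (fderiv ℝ (param φ) (φ (γ 0)))
    ((fun y => φ (radialProj p y)) (γ 0))).comp_hasDerivAt 0 h2
  have h6 : HasDerivAt (fun t => (γ t : C2)) (fderiv ℝ (param φ) (φ (γ 0)) w) 0 := by
    refine h5.congr_of_eventuallyEq ?_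
    filter_upwards [hev] with s hs
    simp only [Function.comp_apply, param, radialProj_coe, φ.left_inv hs.1]
  refine ⟨w.1, ?_⟩
  rw [hd.unique h6, direction_coe, ← map_smul]
  congr 1
  ext1
  · simp
  · simp [h4]

/-- The first coordinate field is tangent to the foliation. -/
theorem exists_smul_eq_direction (h : IsFoliatedChart F φ) (p : S3) {x : S3} (hx : x ∈ φ.source) :
    ∃ v ∈ F.tangentLine x, ∃ r : ℝ, direction φ p x = r • sphereIncl x v := by
  obtain ⟨r, hr, hb⟩ := Metric.isOpen_iff.1 φ.open_target (φ x) (φ.map_source hx)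
  -- the sine keeps the curve in the chart for all times, with nonzero velocity at time `0`
  have hmem : ∀ s : ℝ, φ x + (r / 2 * Real.sin s) • ((1 : ℝ), (0 : EuclideanSpace ℝ (Fin 2))) ∈ φ.target := by
    intro s
    apply hb
    rw [mem_ball_iff_norm, add_sub_cancel_left, norm_smul, Prod.norm_def]
    simp only [norm_one, norm_zero, Real.norm_eq_abs, abs_mul]
    have := Real.abs_sin_le_one s
    rw [abs_of_pos (by positivity : 0 < r / 2), max_eq_left zero_le_one]
    nlinarith
  set c : ℝ → ℝ × EuclideanSpace ℝ (Fin 2) := fun s => φ x + (r / 2 * Real.sin s) • ((1 : ℝ),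
      (0 : EuclideanSpace ℝ (Fin 2))) with hc
  have hcs : ContDiff ℝ ∞ c := by
    have := Real.contDiff_sin (n := ∞)
    fun_prop
  have hcd : HasDerivAt c ((r / 2) • ((1 : ℝ), (0 : EuclideanSpace ℝ (Fin 2)))) 0 := by
    have := (((Real.hasDerivAt_sin 0).const_mul (r / 2)).smul_const ((1 : ℝ),
        (0 : EuclideanSpace ℝ (Fin 2)))).const_add (φ x)
    rwa [Real.cos_zero, mul_one] at this
  have hc0 : c 0 = φ x := by simp [hc]
  have hγ : ContMDiff 𝓘(ℝ, ℝ) (𝓡 3) ∞ (fun s => φ.symm (c s)) :=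
    h.contMDiffOn_symm.comp_contMDiff hcs.contMDiff hmem
  have h1 := h.differentiableAt_param (φ.map_source hx)
  have hw : HasDerivAt (fun s => (φ.symm (c s) : C2)) ((r / 2) • direction φ p x) 0 := by
    rw [direction_coe, ← map_smul]
    exact (hc0 ▸ h1.hasFDerivAt : HasFDerivAt (param φ) (fderiv ℝ (param φ) (φ x)) (c 0)).comp_hasDerivAt 0 hcd
  obtain ⟨v, hv, hvw⟩ := F.exists_mem_tangentLine hγ (p := x) (by rw [hc0, φ.left_inv hx]) (fun s => by
    apply h.sameLeaf_of_snd_eq hx (φ.map_target (hmem s))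
    rw [φ.right_inv (hmem s)]
    simp) hw
  refine ⟨v, hv, (r / 2)⁻¹, ?_⟩
  rw [hvw, smul_smul, inv_mul_cancel₀ (by positivity), one_smul]

end IsFoliatedChart

theorem exists_isFoliatedChart (F : OneDimFoliation (𝓡 3) S3 2) (p : S3) :
    ∃ φ : OpenPartialHomeomorph S3 (ℝ × EuclideanSpace ℝ (Fin 2)), p ∈ φ.source ∧ IsFoliatedChart F φ := by
  obtain ⟨φ, hp, h1, h2, h3⟩ := F.exists_foliatedChart p
  exact ⟨φ, hp, h1, h2, h3⟩
end

/-! ### Skew-Hermitian maps spanning the tangent lines near a point -/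

noncomputable section

theorem fderiv_self_eq_zero_of_homogeneous {t : C2 → ℝ} (ht : ∀ r : ℝ, 0 < r → ∀ y, t (r • y) = t y) {y : C2}
    (hd : DifferentiableAt ℝ t y) : fderiv ℝ t y y = 0 := by
  have h1 : HasDerivAt (fun r : ℝ => r • y) y 1 := by
    simpa using (hasDerivAt_id (1 : ℝ)).smul_const y
  have h2 := (((one_smul ℝ y).symm ▸ hd.hasFDerivAt : HasFDerivAt t (fderiv ℝ t y)
      ((1 : ℝ) • y))).comp_hasDerivAt 1 h1
  have h3 := (hasDerivAt_const (1 : ℝ) (t y)).congr_of_eventuallyEq (f₁ := t ∘ fun r : ℝ => r • y) (by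
    filter_upwards [lt_mem_nhds (zero_lt_one (α := ℝ))] with r hr
    exact ht r hr y)
  exact h2.unique h3

theorem fderiv_smul_of_homogeneous {t : C2 → ℝ} {r : ℝ} (ht : ∀ y, t (r • y) = t y) {y : C2}
    (hd : DifferentiableAt ℝ t (r • y)) (w : C2) : fderiv ℝ t (r • y) (r • w) = fderiv ℝ t y w := by
  have h1 : HasFDerivAt (fun y : C2 => r • y) (r • ContinuousLinearMap.id ℝ C2) y := (hasFDerivAt_id y).const_smul r
  have h2 := hd.hasFDerivAt.comp y h1
  have h3 : (t ∘ fun y : C2 => r • y) = t := funext ht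
  rw [h3] at h2
  rw [h2.fderiv]
  simp

namespace SpansTangent
variable {F : OneDimFoliation (𝓡 3) S3 2} {ε δ : ℝ} {U : Set C2} {t₁ t₂ t₃ : C2 → ℝ}

/-- The metric equation holds on a cone if it holds on its intersection with the sphere, by homogeneity. -/
theorem isUnitMetricOn (h : SpansTangent F δ t₁ t₂ t₃ U) (hU : IsOpen U) (hε : 0 < ε) (hδ : ε * δ ^ 2 = 1)
    (hF : F.IsMetric (bergerMetric ε hε)) (h0 : (0 : C2) ∉ U) (hcone : ∀ y ∈ U, ‖y‖⁻¹ • y ∈ U)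
    (hom₁ : ∀ r : ℝ, 0 < r → ∀ y, t₁ (r • y) = t₁ y) (hom₂ : ∀ r : ℝ, 0 < r → ∀ y, t₂ (r • y) = t₂ y)
    (hom₃ : ∀ r : ℝ, 0 < r → ∀ y, t₃ (r • y) = t₃ y) :
    IsUnitMetricOn (bergerE₁ δ) (bergerE₂ δ) (bergerE₃ δ) (2 * δ ^ 2) t₁ t₂ t₃ U where
  contDiffOn₁ := h.contDiffOn₁
  contDiffOn₂ := h.contDiffOn₂
  contDiffOn₃ := h.contDiffOn₃
  unit := h.unit
  metric y hy x₁ x₂ x₃ y₁ y₂ y₃ hx hy' := by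
    have hy0 : y ≠ 0 := fun h' => h0 (h' ▸ hy)
    have hr : 0 < ‖y‖⁻¹ := by positivity
    set p : S3 := ⟨‖y‖⁻¹ • y, by simp [norm_smul, hy0]⟩ with hp
    have hpU : (p : C2) ∈ U := hcone y hy
    have hd : ∀ t : C2 → ℝ, ContDiffOn ℝ ∞ t U → (∀ r : ℝ, 0 < r → ∀ y, t (r • y) = t y) →
        ∀ A : C2 →L[ℝ] C2, fderiv ℝ t y (A y) = fderiv ℝ t p (A p) := by
      intro t ht hom A
      rw [← fderiv_smul_of_homogeneous (hom _ hr)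
        ((ht.contDiffAt (hU.mem_nhds hpU)).differentiableAt (by simp)), ← map_smul]
    have e₁ : t₁ p = t₁ y := hom₁ _ hr y
    have e₂ : t₂ p = t₂ y := hom₂ _ hr y
    have e₃ : t₃ p = t₃ y := hom₃ _ hr y
    rw [← e₁, ← e₂, ← e₃] at hx hy'
    simp only [hd t₁ h.contDiffOn₁ hom₁, hd t₂ h.contDiffOn₂ hom₂, hd t₃ h.contDiffOn₃ hom₃, ← e₂, ← e₃]
    exact h.metric_equation hU hε hδ hF hpU hx hy'

end SpansTangent

namespace IsFoliatedChart
variable {F : OneDimFoliation (𝓡 3) S3 2} {φ : OpenPartialHomeomorph S3 (ℝ × EuclideanSpace ℝ (Fin 2))}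

theorem direction_ne_zero (h : IsFoliatedChart F φ) (p : S3) {y : C2} (hy : y ∈ cone φ p) : direction φ p y ≠ 0 := by
  have := h.direction_coe_ne_zero p hy.2
  rwa [coe_radialProj p hy.1, direction_smul p (by have := hy.1; positivity)] at this

theorem inner_direction (h : IsFoliatedChart F φ) (p : S3) {y : C2} (hy : y ∈ cone φ p) :
    inner ℝ y (direction φ p y) = 0 := by
  have hr : 0 < ‖y‖⁻¹ := by have := hy.1; positivity
  have := h.inner_direction_coe p hy.2
  rw [coe_radialProj p hy.1, direction_smul p hr, real_inner_smul_left] at this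
  exact (mul_eq_zero.1 this).resolve_left hr.ne'

/-- The inner product of the tangent direction with the linear field `A`. -/
def dirCoeff (φ : OpenPartialHomeomorph S3 (ℝ × EuclideanSpace ℝ (Fin 2))) (p : S3) (A : C2 →L[ℝ] C2) (y : C2) : ℝ :=
  inner ℝ (A y) (direction φ p y)

/-- The length of the vector whose coefficients in the Berger frame are those of the tangent direction,
    up to the factor
`‖y‖²`, see `norm_sq_smul_direction`. -/
def dirNorm (φ : OpenPartialHomeomorph S3 (ℝ × EuclideanSpace ℝ (Fin 2))) (p : S3) (δ : ℝ) (y : C2) : ℝ :=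
  √((δ⁻¹ ^ 2 * dirCoeff φ p mulI y) ^ 2 + (δ⁻¹ * dirCoeff φ p quatJ y) ^ 2 +
    (δ⁻¹ * dirCoeff φ p (quatJ.comp mulI) y) ^ 2)

theorem contDiffOn_dirCoeff (h : IsFoliatedChart F φ) (p : S3) (A : C2 →L[ℝ] C2) :
    ContDiffOn ℝ ∞ (dirCoeff φ p A) (cone φ p) :=
  A.contDiff.contDiffOn.inner ℝ (h.contDiffOn_direction p)

theorem dirCoeff_smul (p : S3) (A : C2 →L[ℝ] C2) {r : ℝ} (hr : 0 < r) (y : C2) :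
    dirCoeff φ p A (r • y) = r * dirCoeff φ p A y := by
  rw [dirCoeff, dirCoeff, direction_smul p hr, map_smul, real_inner_smul_left]

theorem dirNorm_smul (p : S3) (δ : ℝ) {r : ℝ} (hr : 0 < r) (y : C2) :
    dirNorm φ p δ (r • y) = r * dirNorm φ p δ y := by
  rw [dirNorm, dirNorm, ← Real.sqrt_sq hr.le, ← Real.sqrt_mul (sq_nonneg _), Real.sqrt_sq hr.le]
  simp only [dirCoeff_smul p _ hr]
  congr 1
  ring

theorem norm_sq_smul_direction (h : IsFoliatedChart F φ) (p : S3) {y : C2} (hy : y ∈ cone φ p) {δ : ℝ} (hδ : δ ≠ 0) :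
    ‖y‖ ^ 2 • direction φ p y = (δ⁻¹ ^ 2 * dirCoeff φ p mulI y) • bergerE₁ δ y +
      (δ⁻¹ * dirCoeff φ p quatJ y) • bergerE₂ δ y + (δ⁻¹ * dirCoeff φ p (quatJ.comp mulI) y) • bergerE₃ δ y := by
  rw [norm_sq_smul_eq, h.inner_direction p hy, zero_smul, zero_add, bergerE₁_apply, bergerE₂_apply, bergerE₃_apply,
    smul_smul, smul_smul, smul_smul]
  congr 3
  · rw [mul_right_comm, ← mul_pow, inv_mul_cancel₀ hδ, one_pow, one_mul]; rfl
  · rw [mul_right_comm, inv_mul_cancel₀ hδ, one_mul]; rfl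
  · rw [mul_right_comm, inv_mul_cancel₀ hδ, one_mul]; rfl

theorem dirNorm_pos (h : IsFoliatedChart F φ) (p : S3) {y : C2} (hy : y ∈ cone φ p) {δ : ℝ} (hδ : δ ≠ 0) :
    0 < dirNorm φ p δ y := by
  apply Real.sqrt_pos.2
  by_contra! hc
  have h1 : δ⁻¹ ^ 2 * dirCoeff φ p mulI y = 0 := by
    nlinarith [sq_nonneg (δ⁻¹ ^ 2 * dirCoeff φ p mulI y), sq_nonneg (δ⁻¹ * dirCoeff φ p quatJ y),
      sq_nonneg (δ⁻¹ * dirCoeff φ p (quatJ.comp mulI) y)]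
  have h2 : δ⁻¹ * dirCoeff φ p quatJ y = 0 := by
    nlinarith [sq_nonneg (δ⁻¹ ^ 2 * dirCoeff φ p mulI y), sq_nonneg (δ⁻¹ * dirCoeff φ p quatJ y),
      sq_nonneg (δ⁻¹ * dirCoeff φ p (quatJ.comp mulI) y)]
  have h3 : δ⁻¹ * dirCoeff φ p (quatJ.comp mulI) y = 0 := by
    nlinarith [sq_nonneg (δ⁻¹ ^ 2 * dirCoeff φ p mulI y), sq_nonneg (δ⁻¹ * dirCoeff φ p quatJ y),
      sq_nonneg (δ⁻¹ * dirCoeff φ p (quatJ.comp mulI) y)]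
  have := h.norm_sq_smul_direction p hy hδ
  rw [h1, h2, h3, zero_smul, zero_smul, zero_smul, add_zero, add_zero, smul_eq_zero] at this
  exact this.elim (by simpa using hy.1) (h.direction_ne_zero p hy)

theorem spansTangent (h : IsFoliatedChart F φ) (p : S3) {δ : ℝ} (hδ : δ ≠ 0) :
    SpansTangent F δ (fun y => δ⁻¹ ^ 2 * dirCoeff φ p mulI y / dirNorm φ p δ y)
      (fun y => δ⁻¹ * dirCoeff φ p quatJ y / dirNorm φ p δ y)
      (fun y => δ⁻¹ * dirCoeff φ p (quatJ.comp mulI) y / dirNorm φ p δ y) (cone φ p) := by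
  have hn : ContDiffOn ℝ ∞ (dirNorm φ p δ) (cone φ p) := by
    refine ContDiffOn.sqrt (((contDiffOn_const.mul (h.contDiffOn_dirCoeff p _)).pow 2).add
      ((contDiffOn_const.mul (h.contDiffOn_dirCoeff p _)).pow 2) |>.add
      ((contDiffOn_const.mul (h.contDiffOn_dirCoeff p _)).pow 2)) fun y hy => ?_
    exact (Real.sqrt_pos.1 (h.dirNorm_pos p hy hδ)).ne'
  have hs : ∀ (c : ℝ) (A : C2 →L[ℝ] C2), ContDiffOn ℝ ∞ (fun y => c * dirCoeff φ p A y / dirNorm φ p δ y)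
      (cone φ p) :=
    fun c A => (contDiffOn_const.mul (h.contDiffOn_dirCoeff p A)).div hn fun y hy => (h.dirNorm_pos p hy hδ).ne'
  have hx : ∀ x : S3, (x : C2) ∈ cone φ p → x ∈ φ.source := fun x hx => by
    have := hx.2
    rwa [radialProj_coe] at this
  have hT : ∀ x : S3, (x : C2) ∈ cone φ p → dirNorm φ p δ x • ((δ⁻¹ ^ 2 * dirCoeff φ p mulI x / dirNorm φ p δ x) • bergerE₁ δ x +
      (δ⁻¹ * dirCoeff φ p quatJ x / dirNorm φ p δ x) • bergerE₂ δ x +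
      (δ⁻¹ * dirCoeff φ p (quatJ.comp mulI) x / dirNorm φ p δ x) • bergerE₃ δ x) = direction φ p x := by
    intro x hxc
    have h1 := h.norm_sq_smul_direction p hxc hδ
    rw [norm_eq_of_mem_sphere x, one_pow, one_smul] at h1
    have h0 := (h.dirNorm_pos p hxc hδ).ne'
    rw [h1, smul_add, smul_add, smul_smul, smul_smul, smul_smul, mul_div_cancel₀ _ h0, mul_div_cancel₀ _ h0,
      mul_div_cancel₀ _ h0]
  refine ⟨hs _ _, hs _ _, hs _ _, fun y hy => ?_, fun x hxc v hv => ?_, fun x hxc => ?_⟩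
  · have h0 := h.dirNorm_pos p hy hδ
    rw [div_pow, div_pow, div_pow, ← add_div, ← add_div, div_eq_one_iff_eq (by positivity)]
    exact (Real.sq_sqrt (Real.sqrt_pos.1 h0).le).symm
  · obtain ⟨r, hr⟩ := h.exists_eq_smul_direction p (hx x hxc) hv
    rw [← hT x hxc, smul_smul] at hr
    exact ⟨_, hr⟩
  · obtain ⟨v, hv, r, hr⟩ := h.exists_smul_eq_direction p (hx x hxc)
    refine ⟨v, hv, (dirNorm φ p δ x)⁻¹ * r, ?_⟩
    rw [mul_smul, ← hr, ← hT x hxc, inv_smul_smul₀ (h.dirNorm_pos p hxc hδ).ne']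

end IsFoliatedChart

/-- The linear map `K` of `ℂ²` spans the line tangent to the foliation at `x`: `K x ≠ 0`, and the tangent line of
`F` at `x` is `ℝ K x`. -/
structure SpansLine (F : OneDimFoliation (𝓡 3) S3 2) (K : C2 →L[ℂ] C2) (x : S3) : Prop where
  ne_zero : K x ≠ 0
  exists_eq_smul : ∀ v ∈ F.tangentLine x, ∃ r : ℝ, sphereIncl x v = r • K x
  exists_smul_eq : ∃ v ∈ F.tangentLine x, ∃ r : ℝ, K x = r • sphereIncl x v

/-- Near every point, the tangent lines of a metric foliation are spanned by a Killing field `x ↦ K x`. -/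
theorem exists_skewAdjoint_spansLine {F : OneDimFoliation (𝓡 3) S3 2} {ε : ℝ} (hε : 0 < ε) (hε1 : ε ≠ 1)
    (hF : F.IsMetric (bergerMetric ε hε)) (p : S3) :
    ∃ K ∈ skewAdjoint (C2 →L[ℂ] C2), ∀ᶠ x in 𝓝 p, SpansLine F K x := by
  obtain ⟨φ, hp, h⟩ := exists_isFoliatedChart F p
  set δ : ℝ := (√ε)⁻¹ with hδdef
  have hδ2 : δ ^ 2 = ε⁻¹ := by rw [hδdef, inv_pow, Real.sq_sqrt hε.le]
  have hδ : ε * δ ^ 2 = 1 := by rw [hδ2, mul_inv_cancel₀ hε.ne']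
  have hδ0 : δ ≠ 0 := (inv_pos.2 (Real.sqrt_pos.2 hε)).ne'
  have hν : 2 * δ ^ 2 ≠ 2 := by
    intro h2
    apply hε1
    have : δ ^ 2 = 1 := by linarith
    rw [this, mul_one] at hδ
    exact hδ
  have hopen := IsFoliatedChart.isOpen_cone (φ := φ) p
  have hst := h.spansTangent p hδ0
  have hom : ∀ (c : ℝ) (A : C2 →L[ℝ] C2) (r : ℝ), 0 < r → ∀ y,
      c * IsFoliatedChart.dirCoeff φ p A (r • y) / IsFoliatedChart.dirNorm φ p δ (r • y) =
      c * IsFoliatedChart.dirCoeff φ p A y / IsFoliatedChart.dirNorm φ p δ y := by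
    intro c A r hr y
    rw [IsFoliatedChart.dirCoeff_smul p A hr, IsFoliatedChart.dirNorm_smul p δ hr, mul_left_comm,
      mul_div_mul_left _ _ hr.ne']
  have h0 : (0 : C2) ∉ IsFoliatedChart.cone φ p := fun h => h.1 rfl
  have hm := hst.isUnitMetricOn hopen hε hδ hF h0 (fun y hy => ⟨smul_ne_zero (by have := hy.1; positivity) hy.1, by
    rw [radialProj_smul p (by have := hy.1; positivity)]; exact hy.2⟩) (hom _ _) (hom _ _) (hom _ _)
  have hrad : ∀ (c : ℝ) (A : C2 →L[ℝ] C2), ContDiffOn ℝ ∞ (fun y => c * IsFoliatedChart.dirCoeff φ p A y /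
      IsFoliatedChart.dirNorm φ p δ y) (IsFoliatedChart.cone φ p) → ∀ y ∈ IsFoliatedChart.cone φ p,
      fderiv ℝ (fun y => c * IsFoliatedChart.dirCoeff φ p A y / IsFoliatedChart.dirNorm φ p δ y) y y = 0 :=
    fun c A hs y hy => fderiv_self_eq_zero_of_homogeneous (hom c A)
      ((hs.contDiffAt (hopen.mem_nhds hy)).differentiableAt (by simp))
  have hpc := IsFoliatedChart.coe_mem_cone (p := p) hp
  obtain ⟨K, hK, f, hf⟩ := hm.exists_skewAdjoint hopen hδ0 hν (hrad _ _ hst.contDiffOn₁) (hrad _ _ hst.contDiffOn₂)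
    (hrad _ _ hst.contDiffOn₃) h0 hpc
  refine ⟨K, hK, ?_⟩
  filter_upwards [continuous_subtype_val.continuousAt.eventually hf,
    continuous_subtype_val.continuousAt.preimage_mem_nhds (hopen.mem_nhds hpc)] with x ⟨hfx, hKx⟩ hx
  have hu := IsUnitMetricOn.frame_combination_ne_zero hδ0 (ne_zero_of_mem_unit_sphere x) (hst.unit x hx)
  refine ⟨by rw [hKx]; exact smul_ne_zero hfx hu, fun v hv => ?_, ?_⟩
  · obtain ⟨r, hr⟩ := hst.exists_eq_smul x hx v hv
    refine ⟨r * (f x)⁻¹, ?_⟩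
    rw [hr, hKx, mul_smul, inv_smul_smul₀ hfx]
  · obtain ⟨v, hv, r, hr⟩ := hst.exists_smul_eq x hx
    exact ⟨v, hv, f x * r, by rw [hKx, hr, mul_smul]⟩
end

/-! ### Skew-Hermitian maps spanning all tangent lines -/

noncomputable section

namespace SpansLine
variable {F : OneDimFoliation (𝓡 3) S3 2} {K L : C2 →L[ℂ] C2} {x : S3}

theorem exists_smul_of_spansLine (hK : SpansLine F K x) (hL : SpansLine F L x) : ∃ r : ℝ, L x = r • K x := by
  obtain ⟨v, hv, r, hr⟩ := hL.exists_smul_eq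
  obtain ⟨s, hs⟩ := hK.exists_eq_smul v hv
  exact ⟨r * s, by rw [hr, hs, mul_smul]⟩

theorem smul {c : ℝ} (hc : c ≠ 0) (hK : SpansLine F K x) : SpansLine F (c • K) x := by
  refine ⟨smul_ne_zero hc hK.ne_zero, fun v hv => ?_, ?_⟩
  · obtain ⟨r, hr⟩ := hK.exists_eq_smul v hv
    refine ⟨r * c⁻¹, ?_⟩
    rw [hr, smul_apply, smul_smul, mul_assoc, inv_mul_cancel₀ hc, mul_one]
  · obtain ⟨v, hv, r, hr⟩ := hK.exists_smul_eq
    exact ⟨v, hv, c * r, by rw [smul_apply, hr, mul_smul]⟩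

end SpansLine

theorem skewAdjoint_inner {K : C2 →L[ℂ] C2} (hK : K ∈ skewAdjoint (C2 →L[ℂ] C2)) (x y : C2) :
    inner ℂ (K x) y = -inner ℂ x (K y) := by
  rw [← ContinuousLinearMap.adjoint_inner_right, ← ContinuousLinearMap.star_eq_adjoint, skewAdjoint.mem_iff.1 hK]
  simp

/-- Skew-Hermitian maps `K`, `L` whose values are real multiples of each other near `p` are themselves proportional.
Subtracting from `L` a multiple of `K`, the difference `M` vanishes at `p`. If `M ≠ 0`,
    then `M (p + s w) = s M w` is a
nonzero multiple of `K (p + s w)` for `M w ≠ 0` and small `s ≠ 0`, while `M w` is orthogonal to `p`; hence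
`⟪p, K p⟫ + s ⟪p, K w⟫ = 0` for all such `s`,
    and `K w` is orthogonal to `p`. The vectors `w` with `M w ≠ 0` span `ℂ²`, so
`⟪p, K w⟫ = -⟪K p, w⟫` vanishes for all `w`. -/
theorem eq_smul_of_eventually_eq_smul {K L : C2 →L[ℂ] C2} (hK : K ∈ skewAdjoint (C2 →L[ℂ] C2))
    (hL : L ∈ skewAdjoint (C2 →L[ℂ] C2)) {p : S3} (hKp : K p ≠ 0)
    (h : ∀ᶠ x : S3 in 𝓝 p, ∃ r : ℝ, L x = r • K x) : ∃ r : ℝ, L = r • K := by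
  have hp0 := ne_zero_of_mem_unit_sphere p
  obtain ⟨r, hr⟩ := h.self_of_nhds
  refine ⟨r, ?_⟩
  set M : C2 →L[ℂ] C2 := L - r • K with hM
  have hMs : M ∈ skewAdjoint (C2 →L[ℂ] C2) := sub_mem hL (skewAdjoint.smul_mem r hK)
  have hMp : M p = 0 := by simp [hM, hr]
  rw [← sub_eq_zero]
  change M = 0
  by_contra hM0
  obtain ⟨w₀, hw₀⟩ : ∃ w, M w ≠ 0 := by
    by_contra! hc
    exact hM0 (by ext1 w; exact hc w)
  have hcone : ∀ᶠ y : C2 in 𝓝 (p : C2), ∃ r : ℝ, M y = r • K y := by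
    have hc : ContinuousAt (radialProj p) p := (contMDiffAt_radialProj p hp0).continuousAt
    rw [← radialProj_coe p p] at h
    filter_upwards [hc.eventually h, isOpen_ne.mem_nhds hp0] with y ⟨s, hs⟩ hy
    rw [coe_radialProj p hy] at hs
    refine ⟨s - r, ?_⟩
    have hn : ‖y‖⁻¹ ≠ 0 := by have : y ≠ 0 := hy; positivity
    have e : ∀ N : C2 →L[ℂ] C2, N (‖y‖⁻¹ • y) = ‖y‖⁻¹ • N y := fun N => (N.restrictScalars ℝ).map_smul _ _
    rw [e, e, smul_comm] at hs
    have := smul_right_injective C2 hn hs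
    rw [hM, sub_apply, smul_apply, this, sub_smul]
  -- `K w` is orthogonal to `p` for every `w` outside the kernel of `M`
  have key : ∀ w, M w ≠ 0 → inner ℂ (p : C2) (K w) = 0 := by
    intro w hw
    have hline : Filter.Tendsto (fun s : ℝ => (p : C2) + s • w) (𝓝 0) (𝓝 (p : C2)) := by
      have : Continuous (fun s : ℝ => (p : C2) + s • w) := by fun_prop
      simpa using this.tendsto 0
    obtain ⟨e, he, hb⟩ := Metric.mem_nhds_iff.1 (hline.eventually hcone)
    have hz : ∀ s : ℝ, s ≠ 0 → |s| < e → inner ℂ (p : C2) (K p) + s * inner ℂ (p : C2) (K w) = 0 := by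
      intro s hs hse
      obtain ⟨a, ha⟩ := hb (by simpa using hse : s ∈ Metric.ball 0 e)
      have e1 : M ((p : C2) + s • w) = s • M w := by
        rw [map_add, hMp, zero_add]; exact (M.restrictScalars ℝ).map_smul _ _
      rw [e1] at ha
      have ha0 : a ≠ 0 := by
        rintro rfl
        rw [zero_smul] at ha
        exact smul_ne_zero hs hw ha
      have e2 : K ((p : C2) + s • w) = K p + s • K w := by
        rw [map_add]; congr 1; exact (K.restrictScalars ℝ).map_smul _ _
      have e3 : inner ℂ (p : C2) (M w) = 0 := by
        have := skewAdjoint_inner hMs p w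
        rw [hMp, inner_zero_left] at this
        exact neg_eq_zero.1 this.symm
      have e4 := congrArg (inner ℂ (p : C2)) ha
      rw [e2, RCLike.real_smul_eq_coe_smul (K := ℂ), RCLike.real_smul_eq_coe_smul (K := ℂ) a,
        RCLike.real_smul_eq_coe_smul (K := ℂ) s (K w), inner_smul_right, inner_smul_right, inner_add_right,
        inner_smul_right, e3, mul_zero] at e4
      exact (mul_eq_zero.1 e4.symm).resolve_left (by simpa using ha0)
    have h1 := hz (e / 2) (by positivity) (by rw [abs_of_pos (by positivity)]; linarith)
    have h2 := hz (e / 4) (by positivity) (by rw [abs_of_pos (by positivity)]; linarith)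
    have h3 : ((e : ℂ) / 4) * inner ℂ (p : C2) (K w) = 0 := by
      push_cast at h1 h2
      linear_combination h1 - h2
    exact (mul_eq_zero.1 h3).resolve_left (by simpa using he.ne')
  apply hKp
  rw [← inner_self_eq_zero (𝕜 := ℂ), skewAdjoint_inner hK, neg_eq_zero]
  by_cases hw : M (K p) = 0
  · have h1 := key (K p + w₀) (by rwa [map_add, hw, zero_add])
    rw [map_add, inner_add_right, key w₀ hw₀, add_zero] at h1
    exact h1
  · exact key _ hw

/-- The local Killing fields spanning the tangent lines are proportional to each other on overlaps, and `S³` is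
connected. -/
theorem exists_global_skewAdjoint_spansLine {F : OneDimFoliation (𝓡 3) S3 2} {ε : ℝ} (hε : 0 < ε) (hε1 : ε ≠ 1)
    (hF : F.IsMetric (bergerMetric ε hε)) : ∃ K ∈ skewAdjoint (C2 →L[ℂ] C2), ∀ x, SpansLine F K x := by
  have hconn : ConnectedSpace S3 := by
    refine isConnected_iff_connectedSpace.1 (isConnected_sphere ?_ 0 zero_le_one)
    rw [← Module.finrank_eq_rank, finrank_C2.out]
    norm_num
  obtain ⟨p⟩ := hconn.toNonempty
  obtain ⟨K, hK, hKp⟩ := exists_skewAdjoint_spansLine hε hε1 hF p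
  refine ⟨K, hK, fun x => ?_⟩
  set A : Set S3 := {x | ∀ᶠ y in 𝓝 x, SpansLine F K y} with hA
  have hopen : IsOpen A := isOpen_setOfPred_eventually_nhds
  have hclosed : IsClosed A := by
    rw [← closure_subset_iff_isClosed]
    intro x hx
    obtain ⟨L, hL, hLx⟩ := exists_skewAdjoint_spansLine hε hε1 hF x
    obtain ⟨y, hyL, hyA⟩ := mem_closure_iff_nhds.1 hx _ (eventually_eventually_nhds.2 hLx)
    obtain ⟨r, hr⟩ := eq_smul_of_eventually_eq_smul hL hK (Filter.Eventually.self_of_nhds hyL).ne_zero (by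
      filter_upwards [hyL, hyA] with z hz hz' using hz.exists_smul_of_spansLine hz')
    have hr0 : r ≠ 0 := by
      rintro rfl
      refine (Filter.Eventually.self_of_nhds hyA).ne_zero ?_
      rw [hr]
      exact zero_smul ℝ (L y)
    rw [hA, Set.mem_ofPred_eq, hr]
    filter_upwards [hLx] with z hz using hz.smul hr0
  have huniv : A = Set.univ := IsClopen.eq_univ ⟨hclosed, hopen⟩ ⟨p, hKp⟩
  have : x ∈ A := huniv ▸ Set.mem_univ x
  exact Filter.Eventually.self_of_nhds this

end

/-! ### The flow of a skew-Hermitian map -/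

noncomputable section

section UnitaryFlow

theorem exp_smul_mem_unitary {K : C2 →L[ℂ] C2} (hK : K ∈ skewAdjoint (C2 →L[ℂ] C2)) (t : ℝ) :
    NormedSpace.exp (t • K) ∈ unitary (C2 →L[ℂ] C2) :=
  let +nondep : NormedAlgebra ℚ (C2 →L[ℂ] C2) := .restrictScalars ℚ ℝ _
  NormedSpace.exp_mem_unitary_of_mem_skewAdjoint (skewAdjoint.smul_mem t hK)

theorem inner_apply_apply_of_mem_unitary {A : C2 →L[ℂ] C2} (hA : A ∈ unitary (C2 →L[ℂ] C2)) (x y : C2) :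
    inner ℂ (A x) (A y) = inner ℂ x y := by
  rw [← ContinuousLinearMap.adjoint_inner_right, ← ContinuousLinearMap.star_eq_adjoint,
    ← mul_apply_eq_comp, Unitary.star_mul_self_of_mem hA, one_apply_eq_self]

theorem contDiff_exp_smul_apply (K : C2 →L[ℂ] C2) :
    ContDiff ℝ ∞ fun z : ℝ × C2 => NormedSpace.exp (z.1 • K) z.2 := by
  have h1 : ContDiff ℝ ∞ (NormedSpace.exp : (C2 →L[ℂ] C2) → (C2 →L[ℂ] C2)) :=
    contDiff_iff_contDiffAt.2 fun x => (NormedSpace.exp_analytic (𝕂 := ℝ) x).contDiffAt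
  have h2 : ContDiff ℝ ∞ fun z : ℝ × C2 => (ContinuousLinearMap.restrictScalarsL ℂ C2 C2 ℝ ℝ)
      (NormedSpace.exp (z.1 • K)) :=
    (ContinuousLinearMap.contDiff _).comp (h1.comp (contDiff_fst.smul contDiff_const))
  exact h2.clm_apply contDiff_snd

/-- The flow `t ↦ exp (t K)` on the unit sphere of `ℂ²` generated by a skew-Hermitian map `K`. -/
def unitaryFlow (K : C2 →L[ℂ] C2) (hK : K ∈ skewAdjoint (C2 →L[ℂ] C2)) : Flow ℝ S3 where
  toFun t x := ⟨NormedSpace.exp (t • K) x, by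
    have h := inner_apply_apply_of_mem_unitary (exp_smul_mem_unitary hK t) x x
    rw [inner_self_eq_norm_sq_to_K, inner_self_eq_norm_sq_to_K, norm_eq_of_mem_sphere x] at h
    norm_cast at h
    rw [mem_sphere_zero_iff_norm]
    exact (pow_left_inj₀ (norm_nonneg _) zero_le_one two_ne_zero).1 (h.trans (by norm_num))⟩
  cont' := ((contDiff_exp_smul_apply K).continuous.comp
    (continuous_fst.prodMk (continuous_subtype_val.comp continuous_snd))).subtype_mk _
  map_add' s t x := by
    let +nondep : NormedAlgebra ℚ (C2 →L[ℂ] C2) := .restrictScalars ℚ ℝ _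
    have h : Commute (s • K) (t • K) := by
      ext1 y
      have hK (a : ℝ) : K (a • K y) = a • K (K y) := (K.restrictScalars ℝ).map_smul a _
      rw [mul_apply_eq_comp, mul_apply_eq_comp]
      simp only [smul_apply, hK, smul_comm s t]
    apply Subtype.ext
    change NormedSpace.exp ((s + t) • K) (x : C2) = NormedSpace.exp (s • K) (NormedSpace.exp (t • K) x)
    have hst : (s + t) • K = s • K + t • K := by
      ext1 y
      exact add_smul s t (K y)
    rw [hst, NormedSpace.exp_add_of_commute h, mul_apply_eq_comp]
  map_zero' x := by
    have h0 : (0 : ℝ) • K = 0 := by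
      ext1 y
      exact zero_smul ℝ (K y)
    apply Subtype.ext
    change NormedSpace.exp ((0 : ℝ) • K) (x : C2) = x
    rw [h0, NormedSpace.exp_zero, one_apply_eq_self]

variable {K : C2 →L[ℂ] C2} (hK : K ∈ skewAdjoint (C2 →L[ℂ] C2))

theorem coe_unitaryFlow (t : ℝ) (x : S3) : (unitaryFlow K hK t x : C2) = NormedSpace.exp (t • K) x := rfl

theorem hasDerivAt_unitaryFlow (t : ℝ) (x : S3) :
    HasDerivAt (fun s => (unitaryFlow K hK s x : C2)) (K (unitaryFlow K hK t x)) t :=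
  ((ContinuousLinearMap.apply ℂ C2 (x : C2)).restrictScalars ℝ).hasFDerivAt.comp_hasDerivAt t
    (hasDerivAt_exp_smul_const' K t)

theorem contMDiff_unitaryFlow :
    ContMDiff (𝓘(ℝ, ℝ).prod (𝓡 3)) (𝓡 3) ∞ fun z : ℝ × S3 => unitaryFlow K hK z.1 z.2 := by
  refine ContMDiff.codRestrict_sphere (f := fun z : ℝ × S3 => NormedSpace.exp (z.1 • K) (z.2 : C2)) ?_ _
  have h1 : ContMDiff (𝓘(ℝ, ℝ).prod (𝓡 3)) 𝓘(ℝ, ℝ × C2) ∞ fun z : ℝ × S3 => (z.1, (z.2 : C2)) :=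
    contMDiff_fst.prodMk_space (contMDiff_coe_sphere.comp contMDiff_snd)
  exact (contDiff_exp_smul_apply K).contMDiff.comp h1

theorem contMDiff_unitaryFlow_apply (t : ℝ) : ContMDiff (𝓡 3) (𝓡 3) ∞ (unitaryFlow K hK t) :=
  (contMDiff_unitaryFlow hK).comp (contMDiff_const.prodMk contMDiff_id)

theorem sphereIncl_mfderiv_unitaryFlow (t : ℝ) (p : S3) (v : TangentSpace (𝓡 3) p) :
    sphereIncl (unitaryFlow K hK t p) (mfderiv (𝓡 3) (𝓡 3) (unitaryFlow K hK t) p v) =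
      NormedSpace.exp (t • K) (sphereIncl p v) := by
  have hc : ∀ q : S3, MDifferentiableAt (𝓡 3) 𝓘(ℝ, C2) ((↑) : S3 → C2) q :=
    fun q => (contMDiff_coe_sphere (n := 3) (m := ∞)).mdifferentiableAt (by simp)
  have h1 := mfderiv_comp p (hc (unitaryFlow K hK t p))
    ((contMDiff_unitaryFlow_apply hK t).mdifferentiableAt (by simp))
  have hd : DifferentiableAt ℝ (fun y : C2 => NormedSpace.exp (t • K) y) (p : C2) :=
    ((NormedSpace.exp (t • K)).restrictScalars ℝ).differentiableAt
  have h2 := mfderiv_comp p hd.mdifferentiableAt (hc p)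
  have h3 : ((↑) : S3 → C2) ∘ unitaryFlow K hK t = (fun y : C2 => NormedSpace.exp (t • K) y) ∘ (↑) := rfl
  rw [h3, h2] at h1
  have h4 := DFunLike.congr_fun h1 v
  rw [mfderiv_eq_fderiv] at h4
  have h5 : fderiv ℝ (fun y : C2 => NormedSpace.exp (t • K) y)
      (p : C2) = (NormedSpace.exp (t • K)).restrictScalars ℝ :=
    ((NormedSpace.exp (t • K)).restrictScalars ℝ).fderiv
  rw [h5] at h4
  exact h4.symm

theorem real_inner_eq_re_complex_inner (x y : C2) : inner ℝ x y = (inner ℂ x y).re := by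
  simp [PiLp.inner_apply, Fin.sum_univ_two]

/-- The flow is isometric, as unitary maps preserve the real inner product and the Hopf field. -/
theorem isIsometricFlow_unitaryFlow {ε : ℝ} (hε : 0 < ε) :
    IsIsometricFlow (bergerMetric ε hε) (unitaryFlow K hK) := by
  refine ⟨contMDiff_unitaryFlow hK, fun t p v w => ?_⟩
  have hi : ∀ x y : C2, inner ℝ (NormedSpace.exp (t • K) x) (NormedSpace.exp (t • K) y) = inner ℝ x y := fun x y => by
    rw [real_inner_eq_re_complex_inner, real_inner_eq_re_complex_inner,
      inner_apply_apply_of_mem_unitary (exp_smul_mem_unitary hK t)]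
  have hh : ∀ x, hopfForm (unitaryFlow K hK t p) (NormedSpace.exp (t • K) x) = hopfForm p x := fun x => by
    rw [hopfForm, hopfForm, realInner_apply, realInner_apply, coe_unitaryFlow, ← map_smul, hi]
  change bergerInner ε _ _ _ = bergerInner ε _ _ _
  rw [bergerInner_apply, bergerInner_apply, sphereIncl_mfderiv_unitaryFlow, sphereIncl_mfderiv_unitaryFlow,
    bergerForm_apply, bergerForm_apply, hh, hh, hi]

end UnitaryFlow

/-! ### Leaves and orbits -/

section Orbits

variable {F : OneDimFoliation (𝓡 3) S3 2} {φ : OpenPartialHomeomorph S3 (ℝ × EuclideanSpace ℝ (Fin 2))}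
  {K : C2 →L[ℂ] C2}

/-- In a foliated chart, a map that spans the tangent lines points along the first coordinate axis. -/
theorem IsFoliatedChart.exists_fderiv_chart_apply (h : IsFoliatedChart F φ) (p : S3) {x : S3} (hx : x ∈ φ.source)
    (hKx : SpansLine F K x) : ∃ r : ℝ, r ≠ 0 ∧ fderiv ℝ (fun y => φ (radialProj p y)) x (K x) = (r, 0) := by
  obtain ⟨v, hv, r, hr⟩ := hKx.exists_smul_eq
  obtain ⟨s, hs⟩ := h.exists_eq_smul_direction p hx hv
  rw [hs, smul_smul] at hr
  refine ⟨r * s, fun h0 => hKx.ne_zero (by rw [hr, h0, zero_smul]), ?_⟩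
  rw [hr, map_smul, direction_coe, h.fderiv_chart_param p hx]
  simp

variable (hK : K ∈ skewAdjoint (C2 →L[ℂ] C2))

theorem IsFoliatedChart.exists_hasDerivAt_unitaryFlow (hF : ∀ x, SpansLine F K x)
    (h : IsFoliatedChart F φ) {t : ℝ} {x : S3}
    (ht : unitaryFlow K hK t x ∈ φ.source) :
    ∃ r : ℝ, r ≠ 0 ∧ HasDerivAt (fun s => φ (unitaryFlow K hK s x)) (r, 0) t := by
  obtain ⟨r, hr, hd⟩ := h.exists_fderiv_chart_apply x ht (hF _)
  have h1 := (h.differentiableAt_chart x (coe_mem_cone (p := x) ht)).hasFDerivAt.comp_hasDerivAt t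
    (hasDerivAt_unitaryFlow hK t x)
  rw [hd] at h1
  refine ⟨r, hr, h1.congr_of_eventuallyEq (Filter.Eventually.of_forall fun s => ?_)⟩
  simp only [Function.comp_apply, radialProj_coe]

/-- The transverse coordinate is constant along the flow, as its derivative vanishes. -/
theorem IsFoliatedChart.eventually_unitaryFlow (hF : ∀ x, SpansLine F K x) (h : IsFoliatedChart F φ) {t : ℝ} {x : S3}
    (ht : unitaryFlow K hK t x ∈ φ.source) : ∀ᶠ s in 𝓝 t, unitaryFlow K hK s x ∈ φ.source ∧
      (φ (unitaryFlow K hK s x)).2 = (φ (unitaryFlow K hK t x)).2 := by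
  have hc : Continuous fun s => unitaryFlow K hK s x := (unitaryFlow K hK).continuous continuous_id continuous_const
  obtain ⟨ρ, hρ, hb⟩ := Metric.mem_nhds_iff.1 (hc.continuousAt.preimage_mem_nhds (φ.open_source.mem_nhds ht))
  have hd : ∀ s ∈ Metric.ball t ρ, HasDerivAt (fun s => (φ (unitaryFlow K hK s x)).2) 0 s := fun s hs => by
    obtain ⟨r, -, hr⟩ := IsFoliatedChart.exists_hasDerivAt_unitaryFlow hK hF h (hb hs)
    exact hr.snd
  filter_upwards [Metric.ball_mem_nhds t hρ] with s hs
  exact ⟨hb hs, Metric.isOpen_ball.is_const_of_deriv_eq_zero (convex_ball t ρ).isPreconnected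
    (fun u hu => (hd u hu).differentiableAt.differentiableWithinAt) (fun u hu => (hd u hu).deriv) hs
    (Metric.mem_ball_self hρ)⟩

theorem sameLeaf_unitaryFlow (hF : ∀ x, SpansLine F K x) (t : ℝ) (x : S3) : F.sameLeaf x (unitaryFlow K hK t x) := by
  have hl : IsLocallyConstant fun s => (Quotient.mk F.sameLeaf (unitaryFlow K hK s x)) := by
    rw [IsLocallyConstant.iff_eventually_eq]
    intro s
    obtain ⟨φ, hp, h⟩ := exists_isFoliatedChart F (unitaryFlow K hK s x)
    filter_upwards [IsFoliatedChart.eventually_unitaryFlow hK hF h hp] with u hu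
    exact Quotient.sound (h.sameLeaf_of_snd_eq hu.1 hp hu.2)
  have := Quotient.exact (hl.apply_eq_of_isPreconnected isPreconnected_univ (Set.mem_univ 0) (Set.mem_univ t))
  rwa [Flow.map_zero_apply] at this

/-- The points of the plaque of `x` near `x` lie on the orbit of `x`: along the orbit, the first coordinate of the
chart has nonzero derivative, so it takes all values near its value at `x`. -/
theorem IsFoliatedChart.eventually_mem_orbit (hF : ∀ x, SpansLine F K x) (h : IsFoliatedChart F φ) {x : S3}
    (hx : x ∈ φ.source) :
    ∀ᶠ z in 𝓝 x, (φ z).2 = (φ x).2 → z ∈ (unitaryFlow K hK).orbit x := by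
  have hx0 : unitaryFlow K hK 0 x = x := Flow.map_zero_apply _ x
  have hxs : unitaryFlow K hK 0 x ∈ φ.source := by rwa [hx0]
  obtain ⟨r, hr, hd⟩ := IsFoliatedChart.exists_hasDerivAt_unitaryFlow hK hF h hxs
  have hT := IsFoliatedChart.eventually_unitaryFlow hK hF h hxs
  rw [hx0] at hT
  have hsm : ContDiffAt ℝ ∞ (fun s => (φ (unitaryFlow K hK s x)).1) 0 := by
    have h1 : ContMDiffAt 𝓘(ℝ, ℝ) (𝓡 3) ∞ (fun s => unitaryFlow K hK s x) 0 :=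
      ((contMDiff_unitaryFlow hK).comp (contMDiff_id.prodMk contMDiff_const)).contMDiffAt
    have h2 := ContMDiffAt.comp (0 : ℝ) (h.contMDiffOn.contMDiffAt (φ.open_source.mem_nhds hxs)) h1
    exact contDiff_fst.contDiffAt.comp (0 : ℝ) h2.contDiffAt
  have hst := hsm.hasStrictDerivAt' hd.fst (by simp)
  have hmap := hst.map_nhds_eq hr
  have himg : (fun s => (φ (unitaryFlow K hK s x)).1) '' {s | unitaryFlow K hK s x ∈ φ.source ∧
      (φ (unitaryFlow K hK s x)).2 = (φ x).2} ∈ 𝓝 (φ x).1 := by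
    have := Filter.image_mem_map (m := fun s => (φ (unitaryFlow K hK s x)).1) hT
    rwa [hmap, hx0] at this
  filter_upwards [φ.open_source.mem_nhds hx,
    ((continuous_fst.continuousAt.comp (φ.continuousAt hx)).preimage_mem_nhds himg)] with z hz ⟨s, hs, hzs⟩ hz2
  exact ⟨s, φ.injOn hs.1 hz (Prod.ext hzs (hs.2.trans hz2.symm))⟩

/-- Orbits are contained in leaves since the flow is tangent to the leaves. Conversely, a path in a leaf stays on one
orbit, since by `IsFoliatedChart.eventually_mem_orbit` it does so locally. -/
theorem leaf_eq_orbit (hF : ∀ x, SpansLine F K x) (p : S3) : F.leaf p = (unitaryFlow K hK).orbit p := by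
  refine Set.Subset.antisymm (fun y hy => ?_) ?_
  · have hj := (F.isPathConnected_leaf p).joinedIn p (F.sameLeaf.refl p) y hy
    set γ := hj.somePath
    have hl : ∀ s, F.sameLeaf p (γ.extend s) := fun s => hj.somePath_mem _
    have hc : IsLocallyConstant fun s => γ.extend s ∈ (unitaryFlow K hK).orbit p := by
      rw [IsLocallyConstant.iff_eventually_eq]
      intro s
      obtain ⟨φ, hp, h⟩ := exists_isFoliatedChart F (γ.extend s)
      filter_upwards [h.eventually_snd_eq γ.continuous_extend hp
        (fun u => F.sameLeaf.trans (F.sameLeaf.symm (hl s)) (hl u)),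
        γ.continuous_extend.continuousAt.eventually (IsFoliatedChart.eventually_mem_orbit hK hF h hp)] with u hu hu'
      obtain ⟨t, ht⟩ := hu' hu.2
      refine propext ⟨?_, ?_⟩
      · rintro ⟨a, ha⟩
        refine ⟨-t + a, ?_⟩
        change unitaryFlow K hK t _ = _ at ht
        change unitaryFlow K hK a p = _ at ha
        change unitaryFlow K hK (-t + a) p = _
        rw [Flow.map_add, ha, ← ht, ← Flow.map_add, neg_add_cancel, Flow.map_zero_apply]
      · rintro ⟨a, ha⟩
        refine ⟨t + a, ?_⟩
        change unitaryFlow K hK t _ = _ at ht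
        change unitaryFlow K hK a p = _ at ha
        change unitaryFlow K hK (t + a) p = _
        rw [Flow.map_add, ha, ht]
    have h01 := hc.apply_eq_of_isPreconnected isPreconnected_univ (Set.mem_univ (0 : ℝ)) (Set.mem_univ (1 : ℝ))
    simp only [Path.extend_zero, Path.extend_one] at h01
    exact h01 ▸ (unitaryFlow K hK).mem_orbit_self p
  · rintro _ ⟨t, rfl⟩
    exact sameLeaf_unitaryFlow hK hF t p

end Orbits
end

theorem mainTheorem4 (ε : ℝ) (hε : 0 < ε) (hε1 : ε ≠ 1)
    (F : OneDimFoliation (𝓡 3) S3 2) (hF : F.IsMetric (bergerMetric ε hε)) :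
    ∃ Φ : Flow ℝ S3, IsIsometricFlow (bergerMetric ε hε) Φ ∧
      ∀ p : S3, F.leaf p = Φ.orbit p := by
  obtain ⟨K, hK, hspan⟩ := exists_global_skewAdjoint_spansLine hε hε1 hF
  exact ⟨unitaryFlow K hK, isIsometricFlow_unitaryFlow hK hε, leaf_eq_orbit hK hspan⟩
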